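/- Let $\mathbb K$ be $\mathbb R$ or $\mathbb C$. For quasi-Banach spaces $X,Y$ over $\mathbb K$, a map $F:X\to Y$ is called quasilinear if it is homogeneous ($F(\lambda x)=\lambda F(x)$) and there is a constant $Q$ with $\|F(x+y)-F(x)-F(y)\|\le Q(\|x\|+\|y\|)$ for all $x,y\in X$; $Q(F)$ denotes the least such $Q$. Write $\|F\|=\inf\{C:\|F(x)\|\le C\|x\|\ \forall x\in X\}$ and call $F$ bounded if $\|F\|<\infty$. Let $K_0(X,Y)\in[0,\infty]$ be the infimum of the constants $C$ such that for every bounded quasilinear map $F:X\to Y$ there is a (not necessarily continuous) linear map $L:X\to Y$ with $\|F-L\|\le C\,Q(F)$. Let $\operatorname{Ext}(X,Y)$ be the vector space (under Baer sum) of short exact sequences $0\to Y\overset{\imath}\to Z\overset{\pi}\to X\to 0$ of quasi-Banach spaces and bounded linear operators, modulo equivalence (two sequences being equivalent if there is an operator between the middle spaces that induces the identity on $Y$ and on $X$), with the linear topology of the semi-quasi-norm $$\varrho(e)=\inf_{[(\imath,\pi)]=e}\ \inf_B\ \sup_{x,y\in X,\ (x,y)\neq(0,0)}\frac{\|\imath^{-1}(B(x+y)-Bx-By)\|_Y}{\|x\|_X+\|y\|_X},$$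 where $B$ runs over the homogeneous bounded (not necessarily linear or continuous) sections of $\pi$; that is, the sets $e+\{d:\varrho(d)<\varepsilon\}$, $\varepsilon>0$, form a base of neighbourhoods of $e$. (1) For all quasi-Banach spaces $X$ and $Y$ over $\mathbb K$, $\operatorname{Ext}(X,Y)$ is Hausdorff if and only if $K_0(X,Y)<\infty$. (2) There are Banach spaces $X$ and $Y$ for which $\operatorname{Ext}(X,Y)$ is Hausdorff and nonzero: for every uncountable set $I$ and every $1<p<\infty$, the space $\operatorname{Ext}(\ell_p(I),c_0)$ is Hausdorff and nonzero. -/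

import Mathlib

open scoped ENNReal NNReal Topology ZeroAtInfty

universe u v w

/-- `X` is a quasi-Banach space over `𝕜`: `‖·‖` is a quasi-norm and it is complete.
Every Banach space is one (see the instance below). The norm is *not* assumed to satisfy
the triangle inequality. -/
class QuasiBanachSpace (𝕜 : Type w) (X : Type u) [RCLike 𝕜] [AddCommGroup X] [Module 𝕜 X]
    [Norm X] : Prop where
  qnorm_nonneg : ∀ x : X, 0 ≤ ‖x‖
  qnorm_smul : ∀ (c : 𝕜) (x : X), ‖c • x‖ = ‖c‖ * ‖x‖
  qnorm_add_le : ∃ Δ : ℝ, ∀ x y : X, ‖x + y‖ ≤ Δ * (‖x‖ + ‖y‖)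
  eq_zero_of_qnorm : ∀ x : X, ‖x‖ = 0 → x = 0
  complete : ∀ s : ℕ → X, (∀ ε : ℝ, 0 < ε → ∃ N, ∀ m ≥ N, ∀ n ≥ N, ‖s m - s n‖ < ε) →
    ∃ x : X, Filter.Tendsto (fun n => ‖s n - x‖) Filter.atTop (𝓝 0)

instance QuasiBanachSpace.ofBanach (𝕜 : Type w) (X : Type u) [RCLike 𝕜]
    [NormedAddCommGroup X] [NormedSpace 𝕜 X] [CompleteSpace X] : QuasiBanachSpace 𝕜 X where
  qnorm_nonneg := norm_nonneg
  qnorm_smul := norm_smul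
  qnorm_add_le := ⟨1, fun x y => by simpa using norm_add_le x y⟩
  eq_zero_of_qnorm := fun x hx => norm_eq_zero.mp hx
  complete := fun s hs => by
    have hc : CauchySeq s := by
      rw [Metric.cauchySeq_iff]
      intro ε hε
      obtain ⟨N, hN⟩ := hs ε hε
      exact ⟨N, fun m hm n hn => by rw [dist_eq_norm]; exact hN m hm n hn⟩
    obtain ⟨x, hx⟩ := cauchySeq_tendsto_of_complete hc
    exact ⟨x, tendsto_iff_norm_sub_tendsto_zero.mp hx⟩

/-- A product of quasi-Banach spaces, with the maximum quasi-norm of Mathlib, which is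
equivalent to the sum quasi-norm `‖y‖ + ‖x‖`. -/
instance QuasiBanachSpace.prod (𝕜 : Type w) (Y : Type v) (X : Type u) [RCLike 𝕜]
    [AddCommGroup Y] [Module 𝕜 Y] [Norm Y] [QuasiBanachSpace 𝕜 Y]
    [AddCommGroup X] [Module 𝕜 X] [Norm X] [QuasiBanachSpace 𝕜 X] :
    QuasiBanachSpace 𝕜 (Y × X) where
  qnorm_nonneg := fun z => le_max_of_le_left (qnorm_nonneg 𝕜 z.1)
  qnorm_smul := fun c z => by
    change max ‖c • z.1‖ ‖c • z.2‖ = ‖c‖ * max ‖z.1‖ ‖z.2‖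
    rw [qnorm_smul, qnorm_smul, mul_max_of_nonneg _ _ (norm_nonneg c)]
  qnorm_add_le := by
    obtain ⟨a, ha⟩ := qnorm_add_le 𝕜 (X := Y)
    obtain ⟨b, hb⟩ := qnorm_add_le 𝕜 (X := X)
    refine ⟨max |a| |b|, fun z t => ?_⟩
    change max ‖z.1 + t.1‖ ‖z.2 + t.2‖ ≤ _ * (max ‖z.1‖ ‖z.2‖ + max ‖t.1‖ ‖t.2‖)
    have hz1 := qnorm_nonneg 𝕜 z.1
    have hz2 := qnorm_nonneg 𝕜 z.2
    have ht1 := qnorm_nonneg 𝕜 t.1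
    have ht2 := qnorm_nonneg 𝕜 t.2
    refine max_le ((ha z.1 t.1).trans ?_) ((hb z.2 t.2).trans ?_)
    · exact mul_le_mul ((le_abs_self a).trans (le_max_left _ _))
        (add_le_add (le_max_left _ _) (le_max_left _ _)) (by positivity) (by positivity)
    · exact mul_le_mul ((le_abs_self b).trans (le_max_right _ _))
        (add_le_add (le_max_right _ _) (le_max_right _ _)) (by positivity) (by positivity)
  eq_zero_of_qnorm := fun z hz => by
    have hz1 := qnorm_nonneg 𝕜 z.1
    have hz2 := qnorm_nonneg 𝕜 z.2
    have h1 : ‖z.1‖ ≤ 0 := (le_max_left _ _).trans hz.le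
    have h2 : ‖z.2‖ ≤ 0 := (le_max_right _ _).trans hz.le
    exact Prod.ext (eq_zero_of_qnorm (𝕜 := 𝕜) _ (le_antisymm h1 hz1))
      (eq_zero_of_qnorm (𝕜 := 𝕜) _ (le_antisymm h2 hz2))
  complete := fun s hs => by
    obtain ⟨y, hy⟩ := complete (𝕜 := 𝕜) (fun n => (s n).1) (fun ε hε => by
      obtain ⟨N, hN⟩ := hs ε hε
      exact ⟨N, fun m hm n hn => (le_max_left _ _).trans_lt (hN m hm n hn)⟩)
    obtain ⟨x, hx⟩ := complete (𝕜 := 𝕜) (fun n => (s n).2) (fun ε hε => by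
      obtain ⟨N, hN⟩ := hs ε hε
      exact ⟨N, fun m hm n hn => (le_max_right _ _).trans_lt (hN m hm n hn)⟩)
    refine ⟨(y, x), ?_⟩
    have h := hy.max hx
    rw [max_self] at h
    exact h

section Maps

variable {X : Type u} {Y : Type v}

/-- A map between quasi-normed spaces is bounded if `‖F x‖ ≤ C ‖x‖` for some constant `C`.
A linear map is bounded if and only if it is continuous, that is, an operator. -/
def IsBoundedMap [Norm X] [Norm Y] (F : X → Y) : Prop :=
  ∃ C : ℝ≥0, ∀ x, ‖F x‖ ≤ C * ‖x‖

/-- `‖F‖`, the least `C` with `‖F x‖ ≤ C ‖x‖` for all `x` (`∞` if `F` is not bounded). -/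
noncomputable def mapNorm [Norm X] [Norm Y] (F : X → Y) : ℝ≥0∞ :=
  ⨅ (C : ℝ≥0) (_ : ∀ x, ‖F x‖ ≤ C * ‖x‖), (C : ℝ≥0∞)

/-- `F (c x) = c F x` for all scalars `c`. -/
def IsHomogeneous (𝕜 : Type w) [SMul 𝕜 X] [SMul 𝕜 Y] (F : X → Y) : Prop :=
  ∀ (c : 𝕜) (x : X), F (c • x) = c • F x

/-- `F` is homogeneous and `‖F (x + y) - F x - F y‖ ≤ c (‖x‖ + ‖y‖)` for some `c`. -/
def IsQuasilinear (𝕜 : Type w) [SMul 𝕜 X] [SMul 𝕜 Y] [AddCommGroup X] [AddCommGroup Y]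
    [Norm X] [Norm Y] (F : X → Y) : Prop :=
  IsHomogeneous 𝕜 F ∧ ∃ c : ℝ≥0, ∀ x y, ‖F (x + y) - F x - F y‖ ≤ c * (‖x‖ + ‖y‖)

/-- `Q(F)`, the least `c` with `‖F (x + y) - F x - F y‖ ≤ c (‖x‖ + ‖y‖)` for all `x`, `y`. -/
noncomputable def quasilinearConst [AddCommGroup X] [AddCommGroup Y] [Norm X] [Norm Y]
    (F : X → Y) : ℝ≥0∞ :=
  ⨅ (c : ℝ≥0) (_ : ∀ x y, ‖F (x + y) - F x - F y‖ ≤ c * (‖x‖ + ‖y‖)), (c : ℝ≥0∞)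

end Maps

/-- The approximation constant `K₀(X, Y)` for bounded quasilinear maps: the infimum of the
constants `C` such that every bounded quasilinear `F : X → Y` admits a (not necessarily
bounded) linear map `L : X → Y` with `‖F - L‖ ≤ C Q(F)`. It is `∞` if there is no such `C`. -/
noncomputable def K₀ (𝕜 : Type w) (X : Type u) (Y : Type v) [RCLike 𝕜]
    [AddCommGroup X] [Module 𝕜 X] [Norm X] [AddCommGroup Y] [Module 𝕜 Y] [Norm Y] : ℝ≥0∞ :=
  ⨅ (C : ℝ≥0) (_ : ∀ F : X → Y, IsQuasilinear 𝕜 F → IsBoundedMap F →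
    ∃ L : X →ₗ[𝕜] Y, mapNorm (fun x => F x - L x) ≤ C * quasilinearConst F), (C : ℝ≥0∞)

/-- An extension of `X` by `Y`: a short exact sequence `0 → Y → Z → X → 0` of quasi-Banach
spaces and operators (bounded linear maps). Every such sequence is isomorphic to one whose
middle space is carried by the set `Y × X`, so the universe of `Z` is no restriction. -/
structure Extension (𝕜 : Type w) (X : Type u) (Y : Type v) [RCLike 𝕜]
    [AddCommGroup X] [Module 𝕜 X] [Norm X] [AddCommGroup Y] [Module 𝕜 Y] [Norm Y] where
  Z : Type (max u v)
  [addCommGroup : AddCommGroup Z]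
  [module : Module 𝕜 Z]
  [norm : Norm Z]
  [quasiBanach : QuasiBanachSpace 𝕜 Z]
  ι : Y →ₗ[𝕜] Z
  π : Z →ₗ[𝕜] X
  ι_bounded : IsBoundedMap ι
  π_bounded : IsBoundedMap π
  ι_injective : Function.Injective ι
  exact : LinearMap.range ι = LinearMap.ker π
  π_surjective : Function.Surjective π

attribute [instance] Extension.addCommGroup Extension.module Extension.norm
  Extension.quasiBanach

section Ext

variable {𝕜 : Type w} {X : Type u} {Y : Type v} [RCLike 𝕜]
  [AddCommGroup X] [Module 𝕜 X] [Norm X] [AddCommGroup Y] [Module 𝕜 Y] [Norm Y]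

namespace Extension

/-- There is an operator `t : Z → Z'` with `t ∘ ι = ι'` and `π' ∘ t = π`. -/
def Equivalent (E E' : Extension.{u, v, w} 𝕜 X Y) : Prop :=
  ∃ t : E.Z →ₗ[𝕜] E'.Z, IsBoundedMap t ∧ (∀ y, t (E.ι y) = E'.ι y) ∧ ∀ z, E'.π (t z) = E.π z

/-- The underlying space of the pullback of `π₁` and `π₂`. -/
def pullback (E₁ E₂ : Extension.{u, v, w} 𝕜 X Y) : Submodule 𝕜 (E₁.Z × E₂.Z) :=
  LinearMap.eqLocus (E₁.π ∘ₗ LinearMap.fst 𝕜 E₁.Z E₂.Z) (E₂.π ∘ₗ LinearMap.snd 𝕜 E₁.Z E₂.Z)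

/-- `E` is (up to equivalence) the Baer sum of `E₁` and `E₂`, i.e. the pushout along the
addition `Y × Y → Y` of the pullback extension
`0 → Y × Y → Z₁ ×_X Z₂ → X → 0`: there is an operator `s : Z₁ ×_X Z₂ → Z` which induces
the addition on `Y × Y` and the identity on `X`. -/
def IsBaerSum (E₁ E₂ E : Extension.{u, v, w} 𝕜 X Y) : Prop :=
  ∃ s : pullback E₁ E₂ →ₗ[𝕜] E.Z,
    (∃ C : ℝ≥0, ∀ p : pullback E₁ E₂, ‖s p‖ ≤ C * ‖(p : E₁.Z × E₂.Z)‖) ∧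
    (∀ (p : pullback E₁ E₂) (y₁ y₂ : Y), (p : E₁.Z × E₂.Z) = (E₁.ι y₁, E₂.ι y₂) →
      s p = E.ι (y₁ + y₂)) ∧
    ∀ p : pullback E₁ E₂, E.π (s p) = E₁.π (p : E₁.Z × E₂.Z).1

/-- A homogeneous bounded (in general neither linear nor continuous) section of `π`. -/
def IsSection (E : Extension.{u, v, w} 𝕜 X Y) (B : X → E.Z) : Prop :=
  IsHomogeneous 𝕜 B ∧ IsBoundedMap B ∧ ∀ x, E.π (B x) = x

/-- `sup ‖ι⁻¹(B (x + y) - B x - B y)‖ / (‖x‖ + ‖y‖)`, written as the least `c` with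
`‖ι⁻¹(B (x + y) - B x - B y)‖ ≤ c (‖x‖ + ‖y‖)` for all `x`, `y`. -/
noncomputable def sectionConst (E : Extension.{u, v, w} 𝕜 X Y) (B : X → E.Z) : ℝ≥0∞ :=
  ⨅ (c : ℝ≥0) (_ : ∀ (x x' : X) (y : Y), E.ι y = B (x + x') - B x - B x' →
    ‖y‖ ≤ c * (‖x‖ + ‖x'‖)), (c : ℝ≥0∞)

/-- `ϱ(ι, π)`, the infimum of the constants of the homogeneous bounded sections of `π`. -/
noncomputable def rho (E : Extension.{u, v, w} 𝕜 X Y) : ℝ≥0∞ :=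
  ⨅ (B : X → E.Z) (_ : E.IsSection B), E.sectionConst B

/-- The direct sum `0 → Y → Y × X → X → 0`. -/
def directSum (𝕜 : Type w) (X : Type u) (Y : Type v) [RCLike 𝕜]
    [AddCommGroup X] [Module 𝕜 X] [Norm X] [QuasiBanachSpace 𝕜 X]
    [AddCommGroup Y] [Module 𝕜 Y] [Norm Y] [QuasiBanachSpace 𝕜 Y] :
    Extension.{u, v, w} 𝕜 X Y where
  Z := Y × X
  ι := LinearMap.inl 𝕜 Y X
  π := LinearMap.snd 𝕜 Y X
  ι_bounded := ⟨1, fun y => by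
    have h0 : ‖(0 : X)‖ = 0 := by
      simpa using QuasiBanachSpace.qnorm_smul (0 : 𝕜) (0 : X)
    change max ‖y‖ ‖(0 : X)‖ ≤ _
    rw [h0, max_eq_left (QuasiBanachSpace.qnorm_nonneg 𝕜 y)]
    simp⟩
  π_bounded := ⟨1, fun z => by
    change ‖z.2‖ ≤ ((1 : ℝ≥0) : ℝ) * max ‖z.1‖ ‖z.2‖
    simp⟩
  ι_injective := LinearMap.inl_injective
  exact := LinearMap.range_inl 𝕜 Y X
  π_surjective := LinearMap.snd_surjective

end Extension

/-- `Ext(X, Y)`: extensions of `X` by `Y` modulo equivalence. (`Equivalent` is an equivalence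
relation, by the five lemma and the open mapping theorem.) -/
def QBExt (𝕜 : Type w) (X : Type u) (Y : Type v) [RCLike 𝕜]
    [AddCommGroup X] [Module 𝕜 X] [Norm X] [AddCommGroup Y] [Module 𝕜 Y] [Norm Y] :
    Type (max (max u v + 1) w) :=
  Quot (Extension.Equivalent (𝕜 := 𝕜) (X := X) (Y := Y))

namespace QBExt

/-- The class of an extension. -/
def mk (E : Extension.{u, v, w} 𝕜 X Y) : QBExt 𝕜 X Y := Quot.mk _ E

/-- The zero element of `Ext(X, Y)` is the class of the direct sum, i.e. of the trivial
(split) extensions. -/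
instance [QuasiBanachSpace 𝕜 X] [QuasiBanachSpace 𝕜 Y] : Zero (QBExt 𝕜 X Y) :=
  ⟨mk (Extension.directSum 𝕜 X Y)⟩

/-- `e = e₁ + e₂` in the vector space `Ext(X, Y)`, whose addition is the Baer sum. -/
def IsSum (e₁ e₂ e : QBExt 𝕜 X Y) : Prop :=
  ∃ E₁ E₂ E : Extension.{u, v, w} 𝕜 X Y,
    mk E₁ = e₁ ∧ mk E₂ = e₂ ∧ mk E = e ∧ Extension.IsBaerSum E₁ E₂ E

/-- The natural semi-quasi-norm of `Ext(X, Y)`: `ϱ(e)` is the infimum of `ϱ(ι, π)` over the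
extensions in the class `e`. -/
noncomputable def rho (e : QBExt 𝕜 X Y) : ℝ≥0∞ :=
  ⨅ (E : Extension.{u, v, w} 𝕜 X Y) (_ : mk E = e), E.rho

/-- The linear topology of the semi-quasi-norm `ϱ`: a set `U` is open if and only if for each
`e ∈ U` there is `ε > 0` such that `U` contains every `d + e` with `ϱ(d) < ε`. -/
instance : TopologicalSpace (QBExt 𝕜 X Y) where
  IsOpen U := ∀ e ∈ U, ∃ ε : ℝ≥0∞, 0 < ε ∧ ∀ d e', IsSum d e e' → rho d < ε → e' ∈ U
  isOpen_univ := fun _ _ => ⟨1, one_pos, fun _ _ _ _ => trivial⟩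
  isOpen_inter := fun U V hU hV e he => by
    obtain ⟨ε, hε, h⟩ := hU e he.1
    obtain ⟨δ, hδ, h'⟩ := hV e he.2
    exact ⟨min ε δ, lt_min hε hδ, fun d e' hs hd =>
      ⟨h d e' hs (hd.trans_le (min_le_left _ _)), h' d e' hs (hd.trans_le (min_le_right _ _))⟩⟩
  isOpen_sUnion := fun S hS e he => by
    obtain ⟨U, hU, heU⟩ := he
    obtain ⟨ε, hε, h⟩ := hS U hU e heU
    exact ⟨ε, hε, fun d e' hs hd => ⟨U, hU, h d e' hs hd⟩⟩

end QBExt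

end Ext

/-!
Everything is translated into quasilinear maps. A bounded homogeneous section `B` and a linear
section `Λ` of the quotient map of an extension differ by a quasilinear map `F : X → Y`, and `F`
gives back the extension as a twisted sum `Y ⊕_F X`. In this way `Ext(X, Y)` is the space of
quasilinear maps modulo the *trivial* ones, which are the sums of a bounded homogeneous map and a
linear map (`QBExt.ofMap_eq_iff`), the Baer sum is the pointwise sum (`QBExt.isSum_ofMap_iff`), and
`ϱ` is the distance to the trivial maps measured by the quasilinearity constant
(`QBExt.rho_ofMap_lt_iff`). So `Ext(X, Y)` is Hausdorff exactly when the trivial maps are closed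
(`QBExt.t2Space_iff_trivialMapsClosed`).

*Closedness is finiteness of `K₀`.* If `K₀` is finite and bounded maps `B n` approximate `F` modulo
linear maps at a geometric rate, then `B (n + 1) - B n` is close to a linear map; subtracting these
linear maps successively makes the sequence converge pointwise to a bounded map which differs from
`F` by a linear one (`trivialMapsClosed_of_K₀_lt_top`). Conversely, the quasilinear maps modulo
linear maps are realised as the complete quasi-normed space of quasilinear maps vanishing on a Hamel
basis. If the trivial maps are closed, the operator from bounded homogeneous maps into this space
has closed range, and the constant of the open mapping theorem for quasi-Banach spaces
(`QuasiBanachSpace.exists_bounded_lift`) bounds `K₀` (`K₀_lt_top_of_trivialMapsClosed`).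

*`K₀(ℓ_p(I), c₀)` is finite.* For scalar quasilinear functions on `ℓ_p(I)` with `1 < p`, signs are
chosen so that a signed sum of `n` unit vectors and the corresponding defect of the function are
both of smaller order than `n` (`exists_signs`). Hence such a function is nearly additive on
families with sum zero, and the Hahn–Banach theorem gives a linear function at a distance controlled by the
quasilinearity constant (`exists_linear_approx`). Applied to the coordinates of a bounded
quasilinear map into `c₀`, this gives a bounded sequence of functionals `g n` on `ℓ_p(I)` whose
weak* cluster points are small, the coordinates being null sequences. All `g n` have countable
support, and composing them with projections onto the complements of finite sets growing slowly with
`n` changes them by little and makes them weak* null, that is, a linear map into `c₀`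
(`K₀_lp_c₀_lt_top`).

*`Ext(ℓ_p(I), c₀)` is not zero.* Let `A i` be almost disjoint subsets of `ℕ`, uncountably many of
them infinite. The linear map `x ↦ ∑ x i • 1_(A i)` from `ℓ_p(I)` to `ℓ_∞ / c₀` has a homogeneous
bounded lifting to `ℓ_∞`, whose additive defects are in `c₀`; a linear correction makes it
take values in `c₀`. Were the resulting quasilinear map trivial, there would be a bounded linear
lifting `G`. Each coordinate of `G` vanishes on all but countably many unit vectors, so `G` vanishes
on a unit vector `e i` with `A i` infinite, although `1_(A i)` is not a null sequence (`not_exists_linear_isAlmostSum`).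
-/

set_option linter.unusedSectionVars false

/-! ### Quasi-normed spaces and the open mapping theorem -/

namespace QuasiBanachSpace

section Basic

variable (𝕜 : Type w) [RCLike 𝕜] {X : Type u} [AddCommGroup X] [Module 𝕜 X] [Norm X]
  [QuasiBanachSpace 𝕜 X]

include 𝕜 in
theorem qnorm_zero : ‖(0 : X)‖ = 0 := by
  simpa using qnorm_smul (0 : 𝕜) (0 : X)

include 𝕜 in
theorem qnorm_neg (x : X) : ‖-x‖ = ‖x‖ := by
  simpa using qnorm_smul (-1 : 𝕜) x

include 𝕜 in
theorem qnorm_sub_rev (x y : X) : ‖x - y‖ = ‖y - x‖ := by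
  rw [← neg_sub, qnorm_neg 𝕜]

variable (X) in
include 𝕜 in
/-- A modulus of concavity, normalised to be at least `1`. -/
theorem exists_modulus : ∃ Δ : ℝ, 1 ≤ Δ ∧ ∀ x y : X, ‖x + y‖ ≤ Δ * (‖x‖ + ‖y‖) := by
  obtain ⟨Δ, h⟩ := qnorm_add_le 𝕜 (X := X)
  refine ⟨max 1 Δ, le_max_left _ _, fun x y => (h x y).trans ?_⟩
  exact mul_le_mul_of_nonneg_right (le_max_right _ _)
    (add_nonneg (qnorm_nonneg 𝕜 x) (qnorm_nonneg 𝕜 y))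

include 𝕜 in
theorem qnorm_sub_le_of_modulus {Δ : ℝ} (h : ∀ x y : X, ‖x + y‖ ≤ Δ * (‖x‖ + ‖y‖)) (x y : X) :
    ‖x - y‖ ≤ Δ * (‖x‖ + ‖y‖) := by
  simpa [sub_eq_add_neg, qnorm_neg 𝕜] using h x (-y)

include 𝕜 in
theorem eq_zero_of_qnorm_le {x : X} (h : ‖x‖ ≤ 0) : x = 0 :=
  eq_zero_of_qnorm (𝕜 := 𝕜) x (le_antisymm h (qnorm_nonneg 𝕜 x))

include 𝕜 in
/-- In the absence of a triangle inequality, successive differences have to decay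
geometrically with a ratio adapted to the modulus of concavity. -/
theorem exists_lim_of_geometric {Δ : ℝ} (hΔ : 1 ≤ Δ)
    (h : ∀ x y : X, ‖x + y‖ ≤ Δ * (‖x‖ + ‖y‖)) (s : ℕ → X) (r : ℕ → ℝ)
    (hs : ∀ n, ‖s (n + 1) - s n‖ ≤ r n) (hr : ∀ n, r (n + 1) ≤ (2 * Δ)⁻¹ * r n) :
    ∃ x, Filter.Tendsto (fun n => ‖s n - x‖) Filter.atTop (𝓝 0) ∧
      ∀ n, ‖x - s n‖ ≤ 2 * Δ ^ 2 * r n := by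
  have hr0 : ∀ n, 0 ≤ r n := fun n => (qnorm_nonneg 𝕜 _).trans (hs n)
  have hΔ0 : 0 < Δ := by linarith
  have key : ∀ n m, ‖s (m + n) - s m‖ ≤ 2 * Δ * r m := by
    intro n
    induction n with
    | zero =>
      intro m
      simp only [add_zero, sub_self, qnorm_zero 𝕜]
      have := hr0 m
      positivity
    | succ n ih =>
      intro m
      have e : s (m + (n + 1)) - s m = (s (m + 1 + n) - s (m + 1)) + (s (m + 1) - s m) := by
        rw [show m + (n + 1) = m + 1 + n by ring]; abel
      rw [e]
      refine (h _ _).trans ?_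
      have h1 := ih (m + 1)
      have h2 := hs m
      have h3 : 2 * Δ * r (m + 1) ≤ r m := by
        calc 2 * Δ * r (m + 1) ≤ 2 * Δ * ((2 * Δ)⁻¹ * r m) := by gcongr; exact hr m
          _ = r m := by field_simp
      calc Δ * _ ≤ Δ * (r m + r m) := by gcongr; exact h1.trans h3
        _ = _ := by ring
  have hpow : ∀ n, r n ≤ ((2 * Δ)⁻¹) ^ n * r 0 := by
    intro n
    induction n with
    | zero => simp
    | succ n ih =>
      calc r (n + 1) ≤ (2 * Δ)⁻¹ * r n := hr n
        _ ≤ (2 * Δ)⁻¹ * (((2 * Δ)⁻¹) ^ n * r 0) := by gcongr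
        _ = _ := by ring
  have hlim : Filter.Tendsto r Filter.atTop (𝓝 0) := by
    refine squeeze_zero hr0 hpow ?_
    have := (tendsto_pow_atTop_nhds_zero_of_lt_one (r := (2 * Δ)⁻¹) (by positivity)
      (inv_lt_one_of_one_lt₀ (by linarith))).mul_const (r 0)
    simpa using this
  have hlim2 : Filter.Tendsto (fun n => Δ * (2 * Δ * r n + 2 * Δ * r n)) Filter.atTop (𝓝 0) := by
    simpa using ((hlim.const_mul (2 * Δ)).add (hlim.const_mul (2 * Δ))).const_mul Δ
  obtain ⟨x, hx⟩ := complete (𝕜 := 𝕜) s (by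
    intro ε hε
    obtain ⟨N, hN⟩ := (hlim2.eventually (gt_mem_nhds hε)).exists
    refine ⟨N, fun m hm n hn => lt_of_le_of_lt ?_ hN⟩
    obtain ⟨a, rfl⟩ := Nat.exists_eq_add_of_le hm
    obtain ⟨b, rfl⟩ := Nat.exists_eq_add_of_le hn
    have e : s (N + a) - s (N + b) = (s (N + a) - s N) - (s (N + b) - s N) := by abel
    rw [e]
    refine (qnorm_sub_le_of_modulus 𝕜 h _ _).trans ?_
    gcongr
    · exact key a N
    · exact key b N)
  refine ⟨x, hx, fun n => ?_⟩
  have h1 : Filter.Tendsto (fun k => Δ * (‖s (k + n) - x‖ + 2 * Δ * r n)) Filter.atTop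
      (𝓝 (Δ * (0 + 2 * Δ * r n))) :=
    ((((Filter.tendsto_add_atTop_iff_nat n).2 hx)).add_const _).const_mul Δ
  have h2 := ge_of_tendsto' h1 (b := ‖x - s n‖) (fun k => by
    have e : x - s n = (s (k + n) - s n) - (s (k + n) - x) := by abel
    rw [e]
    refine (qnorm_sub_le_of_modulus 𝕜 h _ _).trans ?_
    rw [add_comm ‖s (k + n) - s n‖]
    gcongr
    rw [add_comm k n]
    exact key k n)
  calc _ ≤ _ := h2
    _ = _ := by ring

include 𝕜 in
theorem eq_of_tendsto {s : ℕ → X} {x y : X}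
    (hx : Filter.Tendsto (fun n => ‖s n - x‖) Filter.atTop (𝓝 0))
    (hy : Filter.Tendsto (fun n => ‖s n - y‖) Filter.atTop (𝓝 0)) : x = y := by
  obtain ⟨Δ, hΔ, h⟩ := exists_modulus 𝕜 X
  have h1 : Filter.Tendsto (fun n => Δ * (‖s n - y‖ + ‖s n - x‖)) Filter.atTop (𝓝 0) := by
    simpa using (hy.add hx).const_mul Δ
  have h2 := ge_of_tendsto' h1 (b := ‖x - y‖) (fun n => by
    have e : x - y = (s n - y) - (s n - x) := by abel
    rw [e]
    exact qnorm_sub_le_of_modulus 𝕜 h _ _)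
  exact sub_eq_zero.1 (eq_zero_of_qnorm_le 𝕜 h2)

end Basic

section OpenMapping

variable {𝕜 : Type w} [RCLike 𝕜] {V : Type u} [AddCommGroup V] [Module 𝕜 V] [Norm V]
  [QuasiBanachSpace 𝕜 V] {W : Type v} [AddCommGroup W] [Module 𝕜 W] [Norm W]
  [QuasiBanachSpace 𝕜 W]

omit [QuasiBanachSpace 𝕜 V] in
/-- The category argument in the open mapping theorem: some multiple of the unit ball has an
image which is dense in a ball of the range. -/
theorem exists_ball_dense_image (T : V →ₗ[𝕜] W)
    (hR : ∀ (s : ℕ → W) (x : W), (∀ n, s n ∈ LinearMap.range T) →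
      Filter.Tendsto (fun n => ‖s n - x‖) Filter.atTop (𝓝 0) → x ∈ LinearMap.range T) :
    ∃ (n : ℕ) (w₀ : W) (r : ℝ), w₀ ∈ LinearMap.range T ∧ 0 < r ∧
      ∀ x ∈ LinearMap.range T, ‖x - w₀‖ ≤ r → ∀ ε : ℝ, 0 < ε → ∃ v, ‖v‖ ≤ n ∧ ‖x - T v‖ < ε := by
  obtain ⟨Δ, hΔ, h⟩ := exists_modulus 𝕜 W
  have hΔ0 : 0 < Δ := by linarith
  by_contra! hcon
  choose! φ hφR hφr ψ hψ0 hψ using hcon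
  -- nested balls: centre and radius; the `n`-th ball avoids the image of the ball of radius `n`
  let step : ℕ → W × ℝ → W × ℝ := fun n a =>
    (φ n a.1 a.2, min ((2 * Δ)⁻¹ * a.2) (ψ n a.1 a.2 / (4 * Δ ^ 2)))
  let a : ℕ → W × ℝ := fun n => Nat.rec (0, 1) step n
  have ha : ∀ n, a (n + 1) = step n (a n) := fun n => rfl
  have hinv : ∀ n, (a n).1 ∈ LinearMap.range T ∧ 0 < (a n).2 := by
    intro n
    induction n with
    | zero => exact ⟨Submodule.zero_mem _, one_pos⟩
    | succ n ih =>
      rw [ha]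
      refine ⟨hφR n _ _ ih.1 ih.2, ?_⟩
      have h1 := hψ0 n _ _ ih.1 ih.2
      have h2 := ih.2
      exact lt_min (by positivity) (by positivity)
  obtain ⟨x, hx, hxn⟩ := exists_lim_of_geometric 𝕜 hΔ h (fun n => (a n).1) (fun n => (a n).2)
    (fun n => hφr n _ _ (hinv n).1 (hinv n).2) (fun n => min_le_left _ _)
  obtain ⟨v, rfl⟩ := hR _ _ (fun n => (hinv n).1) hx
  obtain ⟨n, hn⟩ := exists_nat_ge ‖v‖
  have h1 := hψ n _ _ (hinv n).1 (hinv n).2 v hn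
  have h2 := hxn (n + 1)
  have h3 : (a (n + 1)).2 ≤ ψ n (a n).1 (a n).2 / (4 * Δ ^ 2) := min_le_right _ _
  have h4 := hψ0 n _ _ (hinv n).1 (hinv n).2
  rw [qnorm_sub_rev 𝕜] at h1
  have h5 : 2 * Δ ^ 2 * (a (n + 1)).2 ≤ ψ n (a n).1 (a n).2 / 2 := by
    calc _ ≤ 2 * Δ ^ 2 * (ψ n (a n).1 (a n).2 / (4 * Δ ^ 2)) := by gcongr
      _ = _ := by field_simp; ring
  have h6 : ψ n (a n).1 (a n).2 ≤ ‖T v - (a (n + 1)).1‖ := h1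
  linarith

/-- The recentred and rescaled form of `exists_ball_dense_image`. -/
theorem exists_approx_lift (T : V →ₗ[𝕜] W)
    (hR : ∀ (s : ℕ → W) (x : W), (∀ n, s n ∈ LinearMap.range T) →
      Filter.Tendsto (fun n => ‖s n - x‖) Filter.atTop (𝓝 0) → x ∈ LinearMap.range T) :
    ∃ M : ℝ, 0 ≤ M ∧ ∀ x ∈ LinearMap.range T, ∀ ε : ℝ, 0 < ε →
      ∃ v, ‖v‖ ≤ M * ‖x‖ ∧ ‖x - T v‖ < ε := by
  obtain ⟨n, w₀, r, hw₀, hr, H⟩ := exists_ball_dense_image T hR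
  obtain ⟨Δ, hΔ, h⟩ := exists_modulus 𝕜 W
  obtain ⟨Δ', hΔ', h'⟩ := exists_modulus 𝕜 V
  have hΔ0 : 0 < Δ := by linarith
  have hΔ0' : 0 < Δ' := by linarith
  -- recentre the ball at the origin
  have H0 : ∀ x ∈ LinearMap.range T, ‖x‖ ≤ r → ∀ ε : ℝ, 0 < ε →
      ∃ v, ‖v‖ ≤ Δ' * (n + n) ∧ ‖x - T v‖ < ε := by
    intro x hx hxr ε hε
    obtain ⟨v₁, hv₁, hv₁'⟩ := H (x + w₀) (Submodule.add_mem _ hx hw₀) (by simpa using hxr)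
      (ε / (2 * Δ)) (by positivity)
    obtain ⟨v₂, hv₂, hv₂'⟩ := H w₀ hw₀ (by simpa [qnorm_zero 𝕜] using hr.le)
      (ε / (2 * Δ)) (by positivity)
    refine ⟨v₁ - v₂, (qnorm_sub_le_of_modulus 𝕜 h' _ _).trans (by gcongr), ?_⟩
    have e : x - T (v₁ - v₂) = (x + w₀ - T v₁) - (w₀ - T v₂) := by rw [map_sub]; abel
    rw [e]
    calc _ ≤ Δ * (‖x + w₀ - T v₁‖ + ‖w₀ - T v₂‖) := qnorm_sub_le_of_modulus 𝕜 h _ _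
      _ < Δ * (ε / (2 * Δ) + ε / (2 * Δ)) := by gcongr
      _ = ε := by field_simp; ring
  refine ⟨Δ' * (n + n) / r, by positivity, fun x hx ε hε => ?_⟩
  rcases (qnorm_nonneg 𝕜 x).eq_or_lt with hx0 | hx0
  · refine ⟨0, ?_, ?_⟩
    · rw [qnorm_zero 𝕜, ← hx0]; simp
    · rw [map_zero, sub_zero, ← hx0]; exact hε
  · set c : ℝ := r / ‖x‖ with hc
    have hc0 : 0 < c := by positivity
    have hn : ∀ t : ℝ, 0 < t → ‖(t : 𝕜)‖ = t := fun t ht => by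
      rw [RCLike.norm_ofReal, abs_of_pos ht]
    obtain ⟨v, hv, hv'⟩ := H0 ((c : 𝕜) • x) (Submodule.smul_mem _ _ hx)
      (by rw [qnorm_smul, hn c hc0, hc, div_mul_cancel₀ _ hx0.ne']) (c * ε) (by positivity)
    have hc1 : (((c⁻¹ : ℝ) : 𝕜)) * ((c : ℝ) : 𝕜) = 1 := by
      rw [← RCLike.ofReal_mul, inv_mul_cancel₀ hc0.ne', RCLike.ofReal_one]
    refine ⟨((c⁻¹ : ℝ) : 𝕜) • v, ?_, ?_⟩
    · rw [qnorm_smul, hn _ (inv_pos.2 hc0)]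
      calc c⁻¹ * ‖v‖ ≤ c⁻¹ * (Δ' * (n + n)) := by gcongr
        _ = _ := by rw [hc]; field_simp
    · have e : x - T (((c⁻¹ : ℝ) : 𝕜) • v) = ((c⁻¹ : ℝ) : 𝕜) • ((c : 𝕜) • x - T v) := by
        rw [smul_sub, smul_smul, hc1, one_smul, map_smul]
      rw [e, qnorm_smul, hn _ (inv_pos.2 hc0)]
      calc _ < c⁻¹ * (c * ε) := by gcongr
        _ = ε := by field_simp

/-- **Open mapping theorem** for quasi-Banach spaces: an operator with closed range lifts the
elements of its range with control of the quasi-norm. -/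
theorem exists_bounded_lift (T : V →ₗ[𝕜] W) (hT : IsBoundedMap T)
    (hR : ∀ (s : ℕ → W) (x : W), (∀ n, s n ∈ LinearMap.range T) →
      Filter.Tendsto (fun n => ‖s n - x‖) Filter.atTop (𝓝 0) → x ∈ LinearMap.range T) :
    ∃ K : ℝ≥0, ∀ x ∈ LinearMap.range T, ∃ v, T v = x ∧ ‖v‖ ≤ K * ‖x‖ := by
  obtain ⟨M, hM, H⟩ := exists_approx_lift T hR
  obtain ⟨C, hC⟩ := hT
  obtain ⟨Δ, hΔ, h⟩ := exists_modulus 𝕜 W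
  obtain ⟨Δ', hΔ', h'⟩ := exists_modulus 𝕜 V
  have hΔ0 : 0 < Δ := by linarith
  have hΔ0' : 0 < Δ' := by linarith
  refine ⟨⟨2 * Δ' ^ 2 * M, by positivity⟩, fun x hx => ?_⟩
  rcases (qnorm_nonneg 𝕜 x).eq_or_lt with hx0 | hx0
  · have : x = 0 := eq_zero_of_qnorm (𝕜 := 𝕜) x hx0.symm
    subst this
    exact ⟨0, map_zero T, by rw [qnorm_zero 𝕜, qnorm_zero 𝕜]; simp⟩
  set q : ℝ := (2 * Δ')⁻¹ with hq
  have hq0 : 0 < q := by positivity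
  have hq1 : q < 1 := inv_lt_one_of_one_lt₀ (by linarith)
  choose! lift hl1 hl2 using H
  -- successive remainders
  let p : ℕ → V := fun n => Nat.rec 0 (fun n v => v + lift (x - T v) (q ^ (n + 1) * ‖x‖)) n
  have hp : ∀ n, p (n + 1) = p n + lift (x - T (p n)) (q ^ (n + 1) * ‖x‖) := fun n => rfl
  have hmem : ∀ n, x - T (p n) ∈ LinearMap.range T := fun n =>
    Submodule.sub_mem _ hx (LinearMap.mem_range_self T _)
  have hrem : ∀ n, ‖x - T (p n)‖ ≤ q ^ n * ‖x‖ := by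
    intro n
    cases n with
    | zero => simp [p]
    | succ n =>
      rw [hp, map_add, ← sub_sub]
      exact (hl2 _ (hmem n) _ (by positivity)).le
  obtain ⟨v, hv, hvn⟩ := exists_lim_of_geometric 𝕜 hΔ' h' p (fun n => M * (q ^ n * ‖x‖))
    (fun n => by
      rw [hp, add_sub_cancel_left]
      refine (hl1 _ (hmem n) _ (by positivity)).trans ?_
      gcongr
      exact hrem n)
    (fun n => by rw [← hq, pow_succ]; apply le_of_eq; ring)
  refine ⟨v, ?_, ?_⟩
  · refine eq_of_tendsto 𝕜 (s := fun n => T (p n)) ?_ ?_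
    · refine squeeze_zero (g := fun n => C * ‖p n - v‖) (fun n => qnorm_nonneg 𝕜 _)
        (fun n => by rw [← map_sub]; exact hC _) ?_
      simpa using hv.const_mul (C : ℝ)
    · refine squeeze_zero (g := fun n => q ^ n * ‖x‖) (fun n => qnorm_nonneg 𝕜 _)
        (fun n => by rw [qnorm_sub_rev 𝕜]; exact hrem n) ?_
      simpa using (tendsto_pow_atTop_nhds_zero_of_lt_one hq0.le hq1).mul_const ‖x‖
  · have h1 := hvn 0
    have h2 : p 0 = 0 := rfl
    rw [h2, sub_zero, pow_zero, one_mul] at h1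
    calc _ ≤ _ := h1
      _ = 2 * Δ' ^ 2 * M * ‖x‖ := by ring

end OpenMapping

end QuasiBanachSpace

/-! ### Quasi-normed spaces of functions -/

namespace QuasiBanachSpace

section Limits

variable (𝕜 : Type w) [RCLike 𝕜] {X : Type u} [AddCommGroup X] [Module 𝕜 X] [Norm X]
  [QuasiBanachSpace 𝕜 X]

include 𝕜 in
theorem tendsto_add {s t : ℕ → X} {x y : X}
    (hs : Filter.Tendsto (fun n => ‖s n - x‖) Filter.atTop (𝓝 0))
    (ht : Filter.Tendsto (fun n => ‖t n - y‖) Filter.atTop (𝓝 0)) :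
    Filter.Tendsto (fun n => ‖s n + t n - (x + y)‖) Filter.atTop (𝓝 0) := by
  obtain ⟨Δ, hΔ, h⟩ := exists_modulus 𝕜 X
  refine squeeze_zero (g := fun n => Δ * (‖s n - x‖ + ‖t n - y‖)) (fun n => qnorm_nonneg 𝕜 _)
    (fun n => ?_) (by simpa using (hs.add ht).const_mul Δ)
  rw [add_sub_add_comm]
  exact h _ _

theorem tendsto_smul (c : 𝕜) {s : ℕ → X} {x : X}
    (hs : Filter.Tendsto (fun n => ‖s n - x‖) Filter.atTop (𝓝 0)) :
    Filter.Tendsto (fun n => ‖c • s n - c • x‖) Filter.atTop (𝓝 0) := by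
  simpa [← smul_sub, qnorm_smul] using hs.const_mul ‖c‖

include 𝕜 in
theorem tendsto_sub {s t : ℕ → X} {x y : X}
    (hs : Filter.Tendsto (fun n => ‖s n - x‖) Filter.atTop (𝓝 0))
    (ht : Filter.Tendsto (fun n => ‖t n - y‖) Filter.atTop (𝓝 0)) :
    Filter.Tendsto (fun n => ‖s n - t n - (x - y)‖) Filter.atTop (𝓝 0) := by
  have := tendsto_add 𝕜 hs (tendsto_smul 𝕜 (-1 : 𝕜) ht)
  simpa [sub_eq_add_neg] using this

include 𝕜 in
theorem qnorm_le_of_tendsto {Δ : ℝ} (h : ∀ x y : X, ‖x + y‖ ≤ Δ * (‖x‖ + ‖y‖)) (hΔ : 1 ≤ Δ)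
    {s : ℕ → X} {x : X} {c : ℝ}
    (hs : Filter.Tendsto (fun n => ‖s n - x‖) Filter.atTop (𝓝 0))
    (hc : ∀ᶠ n in Filter.atTop, ‖s n‖ ≤ c) : ‖x‖ ≤ Δ * c := by
  have h1 : Filter.Tendsto (fun n => Δ * (c + ‖s n - x‖)) Filter.atTop (𝓝 (Δ * (c + 0))) :=
    (hs.const_add c).const_mul Δ
  rw [add_zero] at h1
  refine ge_of_tendsto h1 ?_
  filter_upwards [hc] with n hn
  have e : x = s n - (s n - x) := by abel
  calc ‖x‖ = ‖s n - (s n - x)‖ := by rw [← e]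
    _ ≤ Δ * (‖s n‖ + ‖s n - x‖) := qnorm_sub_le_of_modulus 𝕜 h _ _
    _ ≤ _ := by gcongr

end Limits

section Gauge

variable {𝕜 : Type w} [RCLike 𝕜] {X : Type u} {Y : Type v} [AddCommGroup Y] [Module 𝕜 Y]
  [Norm Y] [QuasiBanachSpace 𝕜 Y] {J : Type*}

/-- The functions `F` in `S` whose images under the linear maps `φ j` satisfy
`‖φ j F‖ ≤ c * ω j` for some constant `c`. Its quasi-norm is the least such `c`. Both the
space of bounded homogeneous maps (with `φ` the evaluations) and that of quasilinear maps modulo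
linear maps (with `φ` the additive defects) are of this kind. -/
def gaugeSpace (S : Submodule 𝕜 (X → Y)) (φ : J → (X → Y) →ₗ[𝕜] Y) (ω : J → ℝ≥0) :
    Submodule 𝕜 (X → Y) where
  carrier := {F | F ∈ S ∧ ∃ c : ℝ≥0, ∀ j, ‖φ j F‖ ≤ c * ω j}
  zero_mem' := ⟨S.zero_mem, 0, fun j => by simp [qnorm_zero 𝕜]⟩
  add_mem' := by
    rintro F G ⟨hF, a, ha⟩ ⟨hG, b, hb⟩
    obtain ⟨Δ, hΔ, h⟩ := exists_modulus 𝕜 Y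
    lift Δ to ℝ≥0 using by linarith
    refine ⟨S.add_mem hF hG, Δ * (a + b), fun j => ?_⟩
    rw [map_add]
    calc _ ≤ Δ * (‖φ j F‖ + ‖φ j G‖) := h _ _
      _ ≤ Δ * (a * ω j + b * ω j) := by gcongr <;> simp [ha, hb]
      _ = _ := by push_cast; ring
  smul_mem' := by
    rintro c F ⟨hF, a, ha⟩
    refine ⟨S.smul_mem c hF, ‖c‖₊ * a, fun j => ?_⟩
    rw [map_smul, qnorm_smul]
    push_cast
    rw [mul_assoc]
    gcongr
    exact ha j

variable {S : Submodule 𝕜 (X → Y)} {φ : J → (X → Y) →ₗ[𝕜] Y} {ω : J → ℝ≥0}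

noncomputable instance gaugeSpace.instNorm : Norm (gaugeSpace S φ ω) :=
  ⟨fun F => sInf {c : ℝ | 0 ≤ c ∧ ∀ j, ‖φ j F‖ ≤ c * ω j}⟩

theorem gaugeSpace.norm_nonneg (F : gaugeSpace S φ ω) : 0 ≤ ‖F‖ :=
  Real.sInf_nonneg fun _ h => h.1

theorem gaugeSpace.norm_le {F : gaugeSpace S φ ω} {c : ℝ} (hc : 0 ≤ c)
    (h : ∀ j, ‖φ j F‖ ≤ c * ω j) : ‖F‖ ≤ c :=
  csInf_le ⟨0, fun _ h => h.1⟩ ⟨hc, h⟩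

theorem gaugeSpace.le_norm (F : gaugeSpace S φ ω) (j : J) : ‖φ j F‖ ≤ ‖F‖ * ω j := by
  obtain ⟨c₀, hc₀⟩ := F.2.2
  rcases (ω j).2.eq_or_lt with h0 | h0
  · have := hc₀ j
    change (0 : ℝ) = (ω j : ℝ) at h0
    rw [← h0] at this ⊢
    simpa using this
  · change (0 : ℝ) < (ω j : ℝ) at h0
    rw [← div_le_iff₀ h0]
    refine le_csInf ⟨c₀, c₀.2, hc₀⟩ fun c hc => ?_
    rw [div_le_iff₀ h0]
    exact hc.2 j

/-- A gauge space is complete if evaluations are bounded and both `S` and the `φ j` are compatible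
with pointwise convergence: the limit is formed pointwise. -/
theorem gaugeSpace.quasiBanachSpace
    (heval : ∀ x, ∃ c : ℝ, 0 ≤ c ∧ ∀ F : gaugeSpace S φ ω, ‖(F : X → Y) x‖ ≤ c * ‖F‖)
    (hS : ∀ (s : ℕ → X → Y) (F : X → Y), (∀ n, s n ∈ S) →
      (∀ x, Filter.Tendsto (fun n => ‖s n x - F x‖) Filter.atTop (𝓝 0)) → F ∈ S)
    (hφ : ∀ (s : ℕ → X → Y) (F : X → Y),
      (∀ x, Filter.Tendsto (fun n => ‖s n x - F x‖) Filter.atTop (𝓝 0)) →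
      ∀ j, Filter.Tendsto (fun n => ‖φ j (s n) - φ j F‖) Filter.atTop (𝓝 0)) :
    QuasiBanachSpace 𝕜 (gaugeSpace S φ ω) where
  qnorm_nonneg := gaugeSpace.norm_nonneg
  qnorm_smul := by
    have key : ∀ (c : 𝕜) (F : gaugeSpace S φ ω), ‖c • F‖ ≤ ‖c‖ * ‖F‖ := fun c F =>
      gaugeSpace.norm_le (mul_nonneg (_root_.norm_nonneg c) (gaugeSpace.norm_nonneg F)) fun j => by
        rw [Submodule.coe_smul, map_smul, qnorm_smul, mul_assoc]
        gcongr
        exact gaugeSpace.le_norm F j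
    intro c F
    refine le_antisymm (key c F) ?_
    rcases eq_or_ne c 0 with rfl | hc
    · simpa using gaugeSpace.norm_nonneg _
    · have h1 := key c⁻¹ (c • F)
      rw [inv_smul_smul₀ hc, norm_inv] at h1
      rwa [← le_inv_mul_iff₀ (norm_pos_iff.2 hc)]
  qnorm_add_le := by
    obtain ⟨Δ, hΔ, h⟩ := exists_modulus 𝕜 Y
    refine ⟨Δ, fun F G => gaugeSpace.norm_le ?_ fun j => ?_⟩
    · have := gaugeSpace.norm_nonneg F
      have := gaugeSpace.norm_nonneg G
      positivity
    · rw [Submodule.coe_add, map_add]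
      calc _ ≤ Δ * (‖φ j F‖ + ‖φ j G‖) := h _ _
        _ ≤ Δ * (‖F‖ * ω j + ‖G‖ * ω j) := by
          gcongr <;> exact gaugeSpace.le_norm _ j
        _ = _ := by ring
  eq_zero_of_qnorm := fun F hF => by
    ext x
    obtain ⟨c, _, hc⟩ := heval x
    have := hc F
    rw [hF, mul_zero] at this
    exact eq_zero_of_qnorm_le 𝕜 this
  complete := fun s hs => by
    obtain ⟨Δ, hΔ, h⟩ := exists_modulus 𝕜 Y
    have hlim : ∀ x, ∃ y, Filter.Tendsto (fun n => ‖(s n : X → Y) x - y‖) Filter.atTop (𝓝 0) := by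
      intro x
      obtain ⟨c, hc0, hc⟩ := heval x
      refine complete (𝕜 := 𝕜) _ fun ε hε => ?_
      obtain ⟨N, hN⟩ := hs (ε / (c + 1)) (by positivity)
      refine ⟨N, fun m hm n hn => ?_⟩
      calc ‖(s m : X → Y) x - (s n : X → Y) x‖ ≤ c * ‖s m - s n‖ := hc (s m - s n)
        _ ≤ c * (ε / (c + 1)) := by gcongr; exact (hN m hm n hn).le
        _ < (c + 1) * (ε / (c + 1)) := by gcongr; linarith
        _ = ε := by field_simp
    choose F hF using hlim
    have hφlim : ∀ n j, Filter.Tendsto (fun m => ‖φ j (s m - s n : X → Y) - φ j (F - s n)‖)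
        Filter.atTop (𝓝 0) := fun n j => by
      have := hφ (fun m => (s m : X → Y)) F hF j
      simpa [map_sub] using this
    have hbound : ∀ ε : ℝ, 0 < ε → ∃ N, ∀ n ≥ N, ∀ j, ‖φ j (F - s n)‖ ≤ ε * ω j := by
      intro ε hε
      obtain ⟨N, hN⟩ := hs (ε / Δ) (by positivity)
      refine ⟨N, fun n hn j => ?_⟩
      have := qnorm_le_of_tendsto 𝕜 h hΔ (hφlim n j) (c := ε / Δ * ω j) (by
        filter_upwards [Filter.eventually_ge_atTop N] with m hm
        have h1 := gaugeSpace.le_norm (s m - s n) j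
        rw [Submodule.coe_sub] at h1
        refine h1.trans ?_
        gcongr
        exact (hN m hm n hn).le)
      refine this.trans (le_of_eq ?_)
      field_simp
    have hmemsub : ∃ n, F - s n ∈ gaugeSpace S φ ω := by
      obtain ⟨N, hN⟩ := hbound 1 one_pos
      exact ⟨N, S.sub_mem (hS _ F (fun n => (s n).2.1) hF) (s N).2.1, 1, hN N le_rfl⟩
    obtain ⟨n₀, hn₀⟩ := hmemsub
    have hmem : F ∈ gaugeSpace S φ ω := by
      have := Submodule.add_mem _ hn₀ (s n₀).2
      simpa using this
    refine ⟨⟨F, hmem⟩, ?_⟩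
    rw [Metric.tendsto_atTop]
    intro ε hε
    obtain ⟨N, hN⟩ := hbound (ε / 2) (by positivity)
    refine ⟨N, fun n hn => ?_⟩
    have h1 : ‖s n - ⟨F, hmem⟩‖ ≤ ε / 2 := gaugeSpace.norm_le (by positivity) fun j => by
      have h2 := hN n hn j
      rw [← qnorm_neg 𝕜, ← map_neg, neg_sub] at h2
      exact h2
    rw [Real.dist_eq, sub_zero, abs_of_nonneg (gaugeSpace.norm_nonneg _)]
    linarith

end Gauge

end QuasiBanachSpace

/-! ### Quasilinear maps and the constant `K₀` -/

section Quasilinear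

open QuasiBanachSpace

/-- `c` is a quasilinearity constant of `F`. -/
def IsQuasiBound {X : Type u} {Y : Type v} [AddCommGroup X] [AddCommGroup Y] [Norm X] [Norm Y]
    (F : X → Y) (c : ℝ) : Prop :=
  ∀ x y, ‖F (x + y) - F x - F y‖ ≤ c * (‖x‖ + ‖y‖)

/-- Sums of a bounded homogeneous map and a linear map. These are the quasilinear maps whose
twisted sums split. -/
def IsTrivialMap (𝕜 : Type w) {X : Type u} {Y : Type v} [RCLike 𝕜] [AddCommGroup X] [Module 𝕜 X]
    [AddCommGroup Y] [Module 𝕜 Y] [Norm X] [Norm Y] (F : X → Y) : Prop :=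
  ∃ (B : X → Y) (L : X →ₗ[𝕜] Y), IsHomogeneous 𝕜 B ∧ IsBoundedMap B ∧ ∀ x, F x = B x + L x

/-- The trivial maps are closed in the space of quasilinear maps, for the semi-quasi-norm given by
the quasilinearity constant. -/
def TrivialMapsClosed (𝕜 : Type w) (X : Type u) (Y : Type v) [RCLike 𝕜] [AddCommGroup X]
    [Module 𝕜 X] [AddCommGroup Y] [Module 𝕜 Y] [Norm X] [Norm Y] : Prop :=
  ∀ F : X → Y, IsQuasilinear 𝕜 F →
    (∀ ε : ℝ, 0 < ε → ∃ G : X → Y, IsTrivialMap 𝕜 G ∧ IsQuasiBound (F - G) ε) → IsTrivialMap 𝕜 F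

/-- The infimum of the constants `C` with `a j ≤ C * b j` for all `j` is itself such a constant. -/
theorem le_toReal_iInf_mul {J : Type*} {a b : J → ℝ} (hb : ∀ j, 0 ≤ b j)
    (h : (⨅ (C : ℝ≥0) (_ : ∀ j, a j ≤ C * b j), (C : ℝ≥0∞)) < ⊤) (j : J) :
    a j ≤ (⨅ (C : ℝ≥0) (_ : ∀ j, a j ≤ C * b j), (C : ℝ≥0∞)).toReal * b j := by
  obtain ⟨C₀, hC₀⟩ := iInf_lt_iff.1 h
  obtain ⟨hC₀, -⟩ := iInf_lt_iff.1 hC₀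
  rcases (hb j).eq_or_lt with h0 | h0
  · have := hC₀ j
    rw [← h0] at this ⊢
    simpa using this
  · rw [← div_le_iff₀ h0]
    refine (ENNReal.ofReal_le_iff_le_toReal h.ne).1 (le_iInf₂ fun C hC => ?_)
    rw [ENNReal.ofReal_le_iff_le_toReal ENNReal.coe_ne_top, ENNReal.coe_toReal, div_le_iff₀ h0]
    exact hC j

variable {𝕜 : Type w} [RCLike 𝕜] {X : Type u} {Y : Type v}
  [AddCommGroup X] [Module 𝕜 X] [Norm X] [QuasiBanachSpace 𝕜 X]
  [AddCommGroup Y] [Module 𝕜 Y] [Norm Y] [QuasiBanachSpace 𝕜 Y]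

include 𝕜 in
theorem IsQuasiBound.mono {F : X → Y} {c d : ℝ} (h : IsQuasiBound F c) (hcd : c ≤ d) :
    IsQuasiBound F d := fun x y => (h x y).trans
  (mul_le_mul_of_nonneg_right hcd (add_nonneg (qnorm_nonneg 𝕜 x) (qnorm_nonneg 𝕜 y)))

include 𝕜 in
theorem IsQuasiBound.add {Δ : ℝ} (hΔ : 1 ≤ Δ) (h : ∀ x y : Y, ‖x + y‖ ≤ Δ * (‖x‖ + ‖y‖))
    {F G : X → Y} {c d : ℝ} (hF : IsQuasiBound F c) (hG : IsQuasiBound G d) :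
    IsQuasiBound (F + G) (Δ * (c + d)) := fun x y => by
  have e : (F + G) (x + y) - (F + G) x - (F + G) y =
      (F (x + y) - F x - F y) + (G (x + y) - G x - G y) := by
    simp only [Pi.add_apply]; abel
  rw [e]
  calc _ ≤ Δ * (c * (‖x‖ + ‖y‖) + d * (‖x‖ + ‖y‖)) := (h _ _).trans (by
        gcongr
        · exact hF x y
        · exact hG x y)
    _ = _ := by ring

include 𝕜 in
theorem IsQuasiBound.neg {F : X → Y} {c : ℝ} (hF : IsQuasiBound F c) : IsQuasiBound (-F) c :=
  fun x y => by
    have e : (-F) (x + y) - (-F) x - (-F) y = -(F (x + y) - F x - F y) := by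
      simp only [Pi.neg_apply]; abel
    rw [e, qnorm_neg 𝕜]
    exact hF x y

include 𝕜 in
theorem IsQuasiBound.sub {Δ : ℝ} (hΔ : 1 ≤ Δ) (h : ∀ x y : Y, ‖x + y‖ ≤ Δ * (‖x‖ + ‖y‖))
    {F G : X → Y} {c d : ℝ} (hF : IsQuasiBound F c) (hG : IsQuasiBound G d) :
    IsQuasiBound (F - G) (Δ * (c + d)) := by
  rw [sub_eq_add_neg]
  exact hF.add (𝕜 := 𝕜) hΔ h (hG.neg (𝕜 := 𝕜))

theorem IsQuasiBound.congr_linear {F G : X → Y} {c : ℝ} (hF : IsQuasiBound F c)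
    (L : X →ₗ[𝕜] Y) (hL : ∀ x, G x = F x + L x) : IsQuasiBound G c := fun x y => by
  have e : G (x + y) - G x - G y = F (x + y) - F x - F y := by
    rw [hL, hL, hL, map_add]; abel
  rw [e]
  exact hF x y

theorem IsQuasilinear.exists_bound {F : X → Y} (h : IsQuasilinear 𝕜 F) :
    ∃ c : ℝ≥0, IsQuasiBound F c := h.2

theorem IsHomogeneous.add {F G : X → Y} (hF : IsHomogeneous 𝕜 F) (hG : IsHomogeneous 𝕜 G) :
    IsHomogeneous 𝕜 (F + G) := fun c x => by
  simp [hF c x, hG c x]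

theorem IsQuasilinear.add {F G : X → Y} (hF : IsQuasilinear 𝕜 F) (hG : IsQuasilinear 𝕜 G) :
    IsQuasilinear 𝕜 (F + G) := by
  obtain ⟨Δ, hΔ, h⟩ := exists_modulus 𝕜 Y
  obtain ⟨a, ha⟩ := hF.exists_bound
  obtain ⟨b, hb⟩ := hG.exists_bound
  lift Δ to ℝ≥0 using by linarith
  refine ⟨hF.1.add hG.1, Δ * (a + b), ?_⟩
  exact ha.add (𝕜 := 𝕜) hΔ h hb

theorem IsQuasilinear.neg {F : X → Y} (hF : IsQuasilinear 𝕜 F) : IsQuasilinear 𝕜 (-F) := by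
  obtain ⟨a, ha⟩ := hF.exists_bound
  exact ⟨fun c x => by simp [hF.1 c x], a, ha.neg (𝕜 := 𝕜)⟩

theorem IsQuasilinear.sub {F G : X → Y} (hF : IsQuasilinear 𝕜 F) (hG : IsQuasilinear 𝕜 G) :
    IsQuasilinear 𝕜 (F - G) := by
  rw [sub_eq_add_neg]; exact hF.add hG.neg

include 𝕜 in
theorem IsBoundedMap.isQuasiBound {F : X → Y} (hF : IsBoundedMap F) :
    ∃ c : ℝ≥0, IsQuasiBound F c := by
  obtain ⟨Δ, hΔ, h⟩ := exists_modulus 𝕜 Y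
  obtain ⟨D, hD, h'⟩ := exists_modulus 𝕜 X
  obtain ⟨C, hC⟩ := hF
  lift Δ to ℝ≥0 using by linarith
  lift D to ℝ≥0 using by linarith
  refine ⟨Δ * (Δ * (C * D + C) + C), fun x y => ?_⟩
  have hx := qnorm_nonneg 𝕜 x
  have hy := qnorm_nonneg 𝕜 y
  have h1 : ‖F (x + y)‖ ≤ C * (D * (‖x‖ + ‖y‖)) := (hC _).trans (by gcongr; exact h' x y)
  have h2 : ‖F x‖ ≤ C * (‖x‖ + ‖y‖) := (hC _).trans (by gcongr; linarith)
  have h3 : ‖F y‖ ≤ C * (‖x‖ + ‖y‖) := (hC _).trans (by gcongr; linarith)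
  calc ‖F (x + y) - F x - F y‖ ≤ Δ * (Δ * (C * (D * (‖x‖ + ‖y‖)) + C * (‖x‖ + ‖y‖))
        + C * (‖x‖ + ‖y‖)) := by
        refine (qnorm_sub_le_of_modulus 𝕜 h _ _).trans ?_
        gcongr
        refine (qnorm_sub_le_of_modulus 𝕜 h _ _).trans ?_
        gcongr
    _ = _ := by push_cast; ring

include 𝕜 in
theorem IsBoundedMap.add {F G : X → Y} (hF : IsBoundedMap F) (hG : IsBoundedMap G) :
    IsBoundedMap (F + G) := by
  obtain ⟨Δ, hΔ, h⟩ := exists_modulus 𝕜 Y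
  obtain ⟨a, ha⟩ := hF
  obtain ⟨b, hb⟩ := hG
  lift Δ to ℝ≥0 using by linarith
  refine ⟨Δ * (a + b), fun x => ?_⟩
  calc _ ≤ Δ * (a * ‖x‖ + b * ‖x‖) := (h _ _).trans (by
        gcongr
        · exact ha x
        · exact hb x)
    _ = _ := by push_cast; ring

include 𝕜 in
theorem IsBoundedMap.neg {F : X → Y} (hF : IsBoundedMap F) : IsBoundedMap (-F) := by
  obtain ⟨a, ha⟩ := hF
  exact ⟨a, fun x => by rw [Pi.neg_apply, qnorm_neg 𝕜]; exact ha x⟩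

theorem IsTrivialMap.isQuasilinear {F : X → Y} (hF : IsTrivialMap 𝕜 F) : IsQuasilinear 𝕜 F := by
  obtain ⟨B, L, hB, hB', hL⟩ := hF
  obtain ⟨c, hc⟩ := hB'.isQuasiBound (𝕜 := 𝕜)
  refine ⟨fun a x => ?_, c, hc.congr_linear L hL⟩
  rw [hL, hL, hB, map_smul, smul_add]

theorem IsTrivialMap.add {F G : X → Y} (hF : IsTrivialMap 𝕜 F) (hG : IsTrivialMap 𝕜 G) :
    IsTrivialMap 𝕜 (F + G) := by
  obtain ⟨B, L, hB, hB', hL⟩ := hF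
  obtain ⟨B₁, L₁, hB₁, hB₁', hL₁⟩ := hG
  refine ⟨B + B₁, L + L₁, hB.add hB₁, hB'.add (𝕜 := 𝕜) hB₁', fun x => ?_⟩
  simp only [Pi.add_apply, hL, hL₁, LinearMap.add_apply]
  abel

theorem IsTrivialMap.neg {F : X → Y} (hF : IsTrivialMap 𝕜 F) : IsTrivialMap 𝕜 (-F) := by
  obtain ⟨B, L, hB, hB', hL⟩ := hF
  refine ⟨-B, -L, fun c x => by simp [hB c x], hB'.neg (𝕜 := 𝕜), fun x => ?_⟩
  simp only [Pi.neg_apply, hL, LinearMap.neg_apply]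
  abel

theorem IsTrivialMap.sub {F G : X → Y} (hF : IsTrivialMap 𝕜 F) (hG : IsTrivialMap 𝕜 G) :
    IsTrivialMap 𝕜 (F - G) := by
  rw [sub_eq_add_neg]; exact hF.add hG.neg

theorem isTrivialMap_zero : IsTrivialMap 𝕜 (0 : X → Y) :=
  ⟨0, 0, fun c x => by simp, ⟨0, fun x => by simp [qnorm_zero 𝕜]⟩, fun x => by simp⟩

theorem IsQuasilinear.quasilinearConst_lt_top {F : X → Y} (hF : IsQuasilinear 𝕜 F) :
    quasilinearConst F < ⊤ := by
  obtain ⟨c, hc⟩ := hF.2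
  exact (iInf₂_le c hc).trans_lt ENNReal.coe_lt_top

/-- `Q(F)` is attained. -/
theorem IsQuasilinear.isQuasiBound_quasilinearConst {F : X → Y} (hF : IsQuasilinear 𝕜 F) :
    IsQuasiBound F (quasilinearConst F).toNNReal := fun x y => by
  have e : quasilinearConst F = ⨅ (c : ℝ≥0)
      (_ : ∀ p : X × X, ‖F (p.1 + p.2) - F p.1 - F p.2‖ ≤ c * (‖p.1‖ + ‖p.2‖)), (c : ℝ≥0∞) := by
    simp only [quasilinearConst, Prod.forall]
  have := le_toReal_iInf_mul
    (a := fun p : X × X => ‖F (p.1 + p.2) - F p.1 - F p.2‖)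
    (b := fun p : X × X => ‖p.1‖ + ‖p.2‖)
    (fun p => add_nonneg (qnorm_nonneg 𝕜 p.1) (qnorm_nonneg 𝕜 p.2))
    (e ▸ hF.quasilinearConst_lt_top) (x, y)
  rw [← e] at this
  exact this

/-- Finiteness of `K₀` in terms of pointwise estimates. The case `c = 0` is excluded on the right
hand side, since maps with `Q(F) = 0` are linear. -/
theorem K₀_lt_top_iff : K₀ 𝕜 X Y < ⊤ ↔ ∃ C : ℝ≥0, ∀ F : X → Y, IsQuasilinear 𝕜 F →
    IsBoundedMap F → ∀ c : ℝ≥0, 0 < c → IsQuasiBound F c →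
      ∃ L : X →ₗ[𝕜] Y, ∀ x, ‖F x - L x‖ ≤ C * c * ‖x‖ := by
  constructor
  · intro h
    obtain ⟨C, hC⟩ := iInf_lt_iff.1 h
    obtain ⟨hC, -⟩ := iInf_lt_iff.1 hC
    refine ⟨C, fun F hF hF' c _ hc => ?_⟩
    obtain ⟨L, hL⟩ := hC F hF hF'
    refine ⟨L, fun x => ?_⟩
    have h1 : quasilinearConst F ≤ c := iInf₂_le c hc
    have h2 : mapNorm (fun x => F x - L x) ≤ ((C * c : ℝ≥0) : ℝ≥0∞) := by
      refine hL.trans ?_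
      rw [ENNReal.coe_mul]
      gcongr
    refine (le_toReal_iInf_mul (qnorm_nonneg 𝕜) (h2.trans_lt ENNReal.coe_lt_top) x).trans ?_
    have := qnorm_nonneg 𝕜 x
    gcongr
    exact ENNReal.toReal_mono ENNReal.coe_ne_top h2
  · rintro ⟨C, hC⟩
    refine lt_of_le_of_lt (iInf₂_le C fun F hF hF' => ?_) (ENNReal.coe_lt_top (r := C))
    have hq := hF.isQuasiBound_quasilinearConst
    set q := (quasilinearConst F).toNNReal with hq_def
    have hL : ∃ L : X →ₗ[𝕜] Y, ∀ x, ‖F x - L x‖ ≤ C * q * ‖x‖ := by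
      rcases eq_zero_or_pos q with h0 | h0
      · have hadd : ∀ x y, F (x + y) = F x + F y := fun x y => by
          have := hq x y
          rw [h0, NNReal.coe_zero, zero_mul] at this
          have := eq_zero_of_qnorm_le 𝕜 this
          rwa [sub_sub, sub_eq_zero] at this
        refine ⟨⟨⟨F, hadd⟩, hF.1⟩, fun x => ?_⟩
        have hx := qnorm_nonneg 𝕜 x
        change ‖F x - F x‖ ≤ _
        rw [sub_self, qnorm_zero 𝕜]
        positivity
      · exact hC F hF hF' q h0 hq
    obtain ⟨L, hL⟩ := hL
    have h1 : ∀ x, ‖F x - L x‖ ≤ (C * q : ℝ≥0) * ‖x‖ := fun x => by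
      rw [NNReal.coe_mul]
      exact hL x
    have h2 : mapNorm (fun x => F x - L x) ≤ ((C * q : ℝ≥0) : ℝ≥0∞) := iInf₂_le _ h1
    refine ⟨L, h2.trans (le_of_eq ?_)⟩
    rw [ENNReal.coe_mul, hq_def, ENNReal.coe_toNNReal hF.quasilinearConst_lt_top.ne]

end Quasilinear

/-! ### Finiteness of `K₀` and closedness of the trivial maps -/

section Closedness

open QuasiBanachSpace

variable {𝕜 : Type w} [RCLike 𝕜] {X : Type u} {Y : Type v}
  [AddCommGroup X] [Module 𝕜 X] [Norm X] [QuasiBanachSpace 𝕜 X]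
  [AddCommGroup Y] [Module 𝕜 Y] [Norm Y] [QuasiBanachSpace 𝕜 Y]

include 𝕜 in
theorem tendsto_addDefect {s : ℕ → X → Y} {F : X → Y}
    (h : ∀ x, Filter.Tendsto (fun n => ‖s n x - F x‖) Filter.atTop (𝓝 0)) (x y : X) :
    Filter.Tendsto (fun n => ‖(s n (x + y) - s n x - s n y) - (F (x + y) - F x - F y)‖)
      Filter.atTop (𝓝 0) :=
  tendsto_sub 𝕜 (tendsto_sub 𝕜 (h _) (h _)) (h _)

theorem IsHomogeneous.of_tendsto {s : ℕ → X → Y} {F : X → Y} (hs : ∀ n, IsHomogeneous 𝕜 (s n))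
    (h : ∀ x, Filter.Tendsto (fun n => ‖s n x - F x‖) Filter.atTop (𝓝 0)) : IsHomogeneous 𝕜 F :=
  fun c x => by
    have h1 := tendsto_smul 𝕜 c (h x)
    simp only [← hs _ c x] at h1
    exact eq_of_tendsto 𝕜 (h (c • x)) h1

/-- If `K₀` is finite, bounded maps approximating a quasilinear map can be corrected by linear maps
so as to converge. -/
theorem trivialMapsClosed_of_K₀_lt_top (hK : K₀ 𝕜 X Y < ⊤) : TrivialMapsClosed 𝕜 X Y := by
  obtain ⟨C, hC⟩ := K₀_lt_top_iff.1 hK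
  intro F hF hG
  obtain ⟨Δ, hΔ, h⟩ := exists_modulus 𝕜 Y
  have hΔ0 : 0 < Δ := by linarith
  set q : ℝ := (2 * Δ)⁻¹ with hq
  have hq0 : 0 < q := by positivity
  have hq1 : q < 1 := inv_lt_one_of_one_lt₀ (by linarith)
  -- bounded homogeneous maps approximating `F` at a geometric rate
  have hB : ∀ n : ℕ, ∃ B : X → Y, IsHomogeneous 𝕜 B ∧ IsBoundedMap B ∧
      IsQuasiBound (F - B) (q ^ n) := fun n => by
    obtain ⟨G, ⟨B, L, hB, hB', hL⟩, hG'⟩ := hG (q ^ n) (by positivity)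
    exact ⟨B, hB, hB', hG'.congr_linear L fun x => by
      simp only [Pi.sub_apply, hL]; abel⟩
  choose B hBh hBb hBq using hB
  have hdiff : ∀ n, IsQuasiBound (B (n + 1) - B n) (Δ * (2 * q ^ n)) := fun n => by
    have h1 := (hBq n).sub (𝕜 := 𝕜) hΔ h (hBq (n + 1))
    rw [sub_sub_sub_cancel_left] at h1
    refine h1.mono (𝕜 := 𝕜) ?_
    gcongr
    have : q ^ (n + 1) ≤ q ^ n := pow_le_pow_of_le_one hq0.le hq1.le (Nat.le_succ n)
    linarith
  have hLex : ∀ n, ∃ L : X →ₗ[𝕜] Y, ∀ x,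
      ‖B (n + 1) x - B n x - L x‖ ≤ C * (Δ * (2 * q ^ n)) * ‖x‖ := fun n => by
    obtain ⟨c, hc⟩ : ∃ c : ℝ≥0, (c : ℝ) = Δ * (2 * q ^ n) := ⟨⟨_, by positivity⟩, rfl⟩
    have hb : IsBoundedMap (B (n + 1) - B n) := by
      rw [sub_eq_add_neg]
      exact (hBb _).add (𝕜 := 𝕜) ((hBb _).neg (𝕜 := 𝕜))
    have hh : IsHomogeneous 𝕜 (B (n + 1) - B n) := fun a x => by
      simp [hBh _ a x, smul_sub]
    have hc0 : 0 < c := by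
      rw [← NNReal.coe_pos, hc]; positivity
    rw [← hc]
    exact hC (B (n + 1) - B n) ⟨hh, c, hc ▸ hdiff n⟩ hb c hc0 (hc ▸ hdiff n)
  choose L hL using hLex
  let S : ℕ → X →ₗ[𝕜] Y := fun n => ∑ j ∈ Finset.range n, L j
  let s : ℕ → X → Y := fun n x => B n x - S n x
  have hs : ∀ n x, ‖s (n + 1) x - s n x‖ ≤ C * (Δ * (2 * q ^ n)) * ‖x‖ := fun n x => by
    have e : s (n + 1) x - s n x = B (n + 1) x - B n x - L n x := by
      simp only [s, S, Finset.sum_range_succ, LinearMap.add_apply]; abel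
    rw [e]; exact hL n x
  have hlim : ∀ x, ∃ y, Filter.Tendsto (fun n => ‖s n x - y‖) Filter.atTop (𝓝 0) ∧
      ∀ n, ‖y - s n x‖ ≤ 2 * Δ ^ 2 * (C * (Δ * (2 * q ^ n)) * ‖x‖) := fun x =>
    exists_lim_of_geometric 𝕜 hΔ h (fun n => s n x) _ (fun n => hs n x) fun n => by
      rw [← hq, pow_succ]; apply le_of_eq; ring
  choose G hGlim hGs using hlim
  have hsh : ∀ n, IsHomogeneous 𝕜 (s n) := fun n c x => by
    simp only [s, hBh n c x, map_smul, smul_sub]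
  have hGh : IsHomogeneous 𝕜 G := IsHomogeneous.of_tendsto hsh hGlim
  have hGb : IsBoundedMap G := by
    have h1 : IsBoundedMap (G - B 0) := by
      refine ⟨⟨2 * Δ ^ 2 * (C * (Δ * 2)), by positivity⟩, fun x => ?_⟩
      have h2 := hGs x 0
      have e : s 0 x = B 0 x := by simp [s, S]
      rw [e] at h2
      refine h2.trans (le_of_eq ?_)
      change _ = 2 * Δ ^ 2 * (C * (Δ * 2)) * ‖x‖
      ring
    have h2 := h1.add (𝕜 := 𝕜) (hBb 0)
    rwa [sub_add_cancel] at h2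
  have hadd : ∀ x y, (F - G) (x + y) - (F - G) x - (F - G) y = 0 := fun x y => by
    have hFs : ∀ n, IsQuasiBound (F - s n) (q ^ n) := fun n =>
      (hBq n).congr_linear (S n) fun x => by simp only [s, Pi.sub_apply]; abel
    have h1 : ∀ x, Filter.Tendsto (fun n => ‖(F - s n) x - (F - G) x‖) Filter.atTop (𝓝 0) :=
      fun x => by
        have := hGlim x
        refine this.congr fun n => ?_
        rw [qnorm_sub_rev 𝕜]
        congr 1
        simp only [Pi.sub_apply]; abel
    refine eq_of_tendsto 𝕜 (tendsto_addDefect (𝕜 := 𝕜) h1 x y) ?_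
    refine squeeze_zero (g := fun n => q ^ n * (‖x‖ + ‖y‖)) (fun n => qnorm_nonneg 𝕜 _)
      (fun n => by rw [sub_zero]; exact hFs n x y) ?_
    simpa using (tendsto_pow_atTop_nhds_zero_of_lt_one hq0.le hq1).mul_const (‖x‖ + ‖y‖)
  refine ⟨G, ⟨⟨F - G, fun x y => ?_⟩, fun c x => ?_⟩, hGh, hGb, fun x => ?_⟩
  · have := hadd x y
    rwa [sub_sub, sub_eq_zero] at this
  · simp [hF.1 c x, hGh c x, smul_sub]
  · simp

/-- The homogeneous maps, as a subspace of all functions. -/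
def homogeneousMaps (𝕜 : Type w) (X : Type u) (Y : Type v) [RCLike 𝕜] [AddCommGroup X]
    [Module 𝕜 X] [AddCommGroup Y] [Module 𝕜 Y] : Submodule 𝕜 (X → Y) where
  carrier := {F | IsHomogeneous 𝕜 F}
  zero_mem' := fun c x => by simp
  add_mem' := fun hF hG c x => by simp [hF c x, hG c x]
  smul_mem' := fun a F hF c x => by simp [hF c x, smul_comm a c]

/-- The additive defect `F (x + y) - F x - F y` as a linear function of `F`. -/
def addDefect (𝕜 : Type w) {X : Type u} (Y : Type v) [RCLike 𝕜] [AddCommGroup X]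
    [AddCommGroup Y] [Module 𝕜 Y] (p : X × X) : (X → Y) →ₗ[𝕜] Y where
  toFun F := F (p.1 + p.2) - F p.1 - F p.2
  map_add' F G := by simp only [Pi.add_apply]; abel
  map_smul' c F := by simp only [Pi.smul_apply, smul_sub, RingHom.id_apply]

/-- The quasi-norm as a nonnegative real number. -/
def qnnorm (𝕜 : Type w) {X : Type u} [RCLike 𝕜] [AddCommGroup X] [Module 𝕜 X] [Norm X]
    [QuasiBanachSpace 𝕜 X] (x : X) : ℝ≥0 := ⟨‖x‖, qnorm_nonneg 𝕜 x⟩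

/-- The evaluation at a point as a linear map. -/
def evalMap (𝕜 : Type w) {X : Type u} (Y : Type v) [RCLike 𝕜]
    [AddCommGroup Y] [Module 𝕜 Y] (x : X) : (X → Y) →ₗ[𝕜] Y where
  toFun F := F x
  map_add' _ _ := rfl
  map_smul' _ _ := rfl

/-- The bounded homogeneous maps, with the quasi-norm `‖F‖`. -/
abbrev BoundedMaps (𝕜 : Type w) (X : Type u) (Y : Type v) [RCLike 𝕜]
    [AddCommGroup X] [Module 𝕜 X] [Norm X] [QuasiBanachSpace 𝕜 X]
    [AddCommGroup Y] [Module 𝕜 Y] [Norm Y] [QuasiBanachSpace 𝕜 Y] : Submodule 𝕜 (X → Y) :=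
  gaugeSpace (homogeneousMaps 𝕜 X Y) (evalMap 𝕜 Y)
    (qnnorm 𝕜)

/-- The quasilinear maps vanishing on a Hamel basis, with the quasi-norm `Q(F)`. They represent
the quasilinear maps modulo the linear ones. -/
noncomputable abbrev NormalizedMaps (𝕜 : Type w) (X : Type u) (Y : Type v) [RCLike 𝕜]
    [AddCommGroup X] [Module 𝕜 X] [Norm X] [QuasiBanachSpace 𝕜 X]
    [AddCommGroup Y] [Module 𝕜 Y] [Norm Y] [QuasiBanachSpace 𝕜 Y] : Submodule 𝕜 (X → Y) :=
  gaugeSpace (homogeneousMaps 𝕜 X Y ⊓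
      ⨅ i, LinearMap.ker (LinearMap.proj (R := 𝕜) (φ := fun _ : X => Y)
        (Module.Basis.ofVectorSpace 𝕜 X i)))
    (addDefect 𝕜 Y) (fun p => qnnorm 𝕜 p.1 + qnnorm 𝕜 p.2)

instance : QuasiBanachSpace 𝕜 (BoundedMaps 𝕜 X Y) :=
  gaugeSpace.quasiBanachSpace
    (fun x => ⟨‖x‖, qnorm_nonneg 𝕜 x, fun F => by
      rw [mul_comm]
      exact gaugeSpace.le_norm F x⟩)
    (fun _ _ hs h => IsHomogeneous.of_tendsto hs h)
    (fun _ _ h j => h j)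

/-- Evaluations are bounded: the value at a linear combination of basis vectors is controlled by
the additive defects met in assembling it. -/
theorem NormalizedMaps.exists_eval_le (x : X) :
    ∃ c : ℝ, 0 ≤ c ∧ ∀ F : NormalizedMaps 𝕜 X Y, ‖(F : X → Y) x‖ ≤ c * ‖F‖ := by
  obtain ⟨Δ, hΔ, h⟩ := exists_modulus 𝕜 Y
  have hx : x ∈ Submodule.span 𝕜 (Set.range (Module.Basis.ofVectorSpace 𝕜 X)) := by
    rw [Module.Basis.span_eq]; trivial
  induction hx using Submodule.span_induction with
  | mem x hx =>
    obtain ⟨i, rfl⟩ := hx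
    refine ⟨0, le_rfl, fun F => ?_⟩
    have h1 : (F : X → Y) (Module.Basis.ofVectorSpace 𝕜 X i) = 0 :=
      (Submodule.mem_iInf _).1 F.2.1.2 i
    rw [h1, qnorm_zero 𝕜, zero_mul]
  | zero =>
    refine ⟨0, le_rfl, fun F => ?_⟩
    have h1 : (F : X → Y) 0 = 0 := by simpa using F.2.1.1 (0 : 𝕜) 0
    rw [h1, qnorm_zero 𝕜, zero_mul]
  | add x y _ _ hx hy =>
    obtain ⟨a, ha0, ha⟩ := hx
    obtain ⟨b, hb0, hb⟩ := hy
    have hx0 := qnorm_nonneg 𝕜 x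
    have hy0 := qnorm_nonneg 𝕜 y
    refine ⟨Δ * ((‖x‖ + ‖y‖) + Δ * (a + b)), by positivity, fun F => ?_⟩
    have e : (F : X → Y) (x + y) = ((F : X → Y) (x + y) - (F : X → Y) x - (F : X → Y) y)
        + ((F : X → Y) x + (F : X → Y) y) := by abel
    have h1 : ‖(F : X → Y) (x + y) - (F : X → Y) x - (F : X → Y) y‖ ≤ ‖F‖ * (‖x‖ + ‖y‖) :=
      gaugeSpace.le_norm F (x, y)
    rw [e]
    calc _ ≤ Δ * (‖F‖ * (‖x‖ + ‖y‖) + Δ * (a * ‖F‖ + b * ‖F‖)) := by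
          refine (h _ _).trans ?_
          gcongr
          refine (h _ _).trans ?_
          gcongr
          · exact ha F
          · exact hb F
      _ = _ := by ring
  | smul c x _ hx =>
    obtain ⟨a, ha0, ha⟩ := hx
    refine ⟨‖c‖ * a, by positivity, fun F => ?_⟩
    rw [F.2.1.1 c x, qnorm_smul, mul_assoc]
    gcongr
    exact ha F

instance : QuasiBanachSpace 𝕜 (NormalizedMaps 𝕜 X Y) :=
  gaugeSpace.quasiBanachSpace NormalizedMaps.exists_eval_le
    (fun s F hs h => by
      refine ⟨IsHomogeneous.of_tendsto (fun n => (hs n).1) h, ?_⟩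
      refine (Submodule.mem_iInf _).2 fun i => ?_
      refine eq_of_tendsto 𝕜 (h _) ?_
      have : ∀ n, s n (Module.Basis.ofVectorSpace 𝕜 X i) = 0 := fun n =>
        (Submodule.mem_iInf _).1 (hs n).2 i
      simp only [this, sub_self, qnorm_zero 𝕜]
      exact tendsto_const_nhds)
    (fun _ _ h p => tendsto_addDefect (𝕜 := 𝕜) h p.1 p.2)

/-- The linear map agreeing with `F` on a Hamel basis. -/
noncomputable def linearInterpolation (𝕜 : Type w) {X : Type u} {Y : Type v} [RCLike 𝕜]
    [AddCommGroup X] [Module 𝕜 X] [AddCommGroup Y] [Module 𝕜 Y] (F : X → Y) : X →ₗ[𝕜] Y :=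
  (Module.Basis.ofVectorSpace 𝕜 X).constr 𝕜 fun i => F (Module.Basis.ofVectorSpace 𝕜 X i)

theorem linearInterpolation_basis (F : X → Y) (i) :
    linearInterpolation 𝕜 F (Module.Basis.ofVectorSpace 𝕜 X i) =
      F (Module.Basis.ofVectorSpace 𝕜 X i) :=
  Module.Basis.constr_basis _ _ _ _

theorem linearInterpolation_unique (F : X → Y) (L : X →ₗ[𝕜] Y)
    (h : ∀ i, L (Module.Basis.ofVectorSpace 𝕜 X i) = F (Module.Basis.ofVectorSpace 𝕜 X i)) :
    L = linearInterpolation 𝕜 F :=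
  (Module.Basis.ofVectorSpace 𝕜 X).ext fun i => by rw [h, linearInterpolation_basis]

theorem sub_linearInterpolation_mem {F : X → Y} (hF : IsQuasilinear 𝕜 F) :
    F - ⇑(linearInterpolation 𝕜 F) ∈ NormalizedMaps 𝕜 X Y := by
  refine ⟨⟨fun c x => by simp [hF.1 c x, smul_sub], (Submodule.mem_iInf _).2 fun i => ?_⟩, ?_⟩
  · change F _ - linearInterpolation 𝕜 F _ = 0
    rw [linearInterpolation_basis, sub_self]
  · obtain ⟨c, hc⟩ := hF.exists_bound
    exact ⟨c, fun p => (hc.congr_linear (-linearInterpolation 𝕜 F)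
      (G := F - ⇑(linearInterpolation 𝕜 F)) fun x => by simp [sub_eq_add_neg]) p.1 p.2⟩

theorem BoundedMaps.isBoundedMap (B : BoundedMaps 𝕜 X Y) : IsBoundedMap (B : X → Y) := B.2.2

theorem BoundedMaps.isQuasilinear (B : BoundedMaps 𝕜 X Y) : IsQuasilinear 𝕜 (B : X → Y) :=
  ⟨B.2.1, (BoundedMaps.isBoundedMap B).isQuasiBound (𝕜 := 𝕜)⟩

/-- The canonical map from bounded maps to quasilinear maps modulo linear maps. -/
noncomputable def BoundedMaps.normalize : BoundedMaps 𝕜 X Y →ₗ[𝕜] NormalizedMaps 𝕜 X Y where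
  toFun B := ⟨_, sub_linearInterpolation_mem (BoundedMaps.isQuasilinear B)⟩
  map_add' B B' := by
    ext x
    have : linearInterpolation 𝕜 (B + B' : X → Y) =
        linearInterpolation 𝕜 (B : X → Y) + linearInterpolation 𝕜 (B' : X → Y) :=
      (linearInterpolation_unique _ _ fun i => by
        simp only [LinearMap.add_apply, linearInterpolation_basis, Pi.add_apply]).symm
    simp only [Submodule.coe_add, Pi.sub_apply, Pi.add_apply, this, LinearMap.add_apply]
    abel
  map_smul' c B := by
    ext x
    have : linearInterpolation 𝕜 (c • (B : X → Y)) = c • linearInterpolation 𝕜 (B : X → Y) :=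
      (linearInterpolation_unique _ _ fun i => by
        simp only [LinearMap.smul_apply, linearInterpolation_basis, Pi.smul_apply]).symm
    simp only [Submodule.coe_smul, Pi.sub_apply, Pi.smul_apply, this, LinearMap.smul_apply,
      smul_sub, RingHom.id_apply]

theorem BoundedMaps.normalize_apply (B : BoundedMaps 𝕜 X Y) (x : X) :
    (BoundedMaps.normalize B : X → Y) x = (B : X → Y) x - linearInterpolation 𝕜 (B : X → Y) x :=
  rfl

theorem BoundedMaps.normalize_isBoundedMap :
    IsBoundedMap (BoundedMaps.normalize : BoundedMaps 𝕜 X Y →ₗ[𝕜] NormalizedMaps 𝕜 X Y) := by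
  obtain ⟨Δ, hΔ, h⟩ := exists_modulus 𝕜 Y
  obtain ⟨D, hD, h'⟩ := exists_modulus 𝕜 X
  refine ⟨⟨Δ * (Δ * (D + 1) + 1), by positivity⟩, fun B => ?_⟩
  have hB0 := gaugeSpace.norm_nonneg B
  refine gaugeSpace.norm_le (mul_nonneg (NNReal.coe_nonneg _) hB0) fun p => ?_
  obtain ⟨x, y⟩ := p
  have hx := qnorm_nonneg 𝕜 x
  have hy := qnorm_nonneg 𝕜 y
  have hev : ∀ x, ‖(B : X → Y) x‖ ≤ ‖B‖ * ‖x‖ := fun x => gaugeSpace.le_norm B x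
  have e : addDefect 𝕜 Y (x, y) (BoundedMaps.normalize B : X → Y) =
      (B : X → Y) (x + y) - (B : X → Y) x - (B : X → Y) y := by
    change (BoundedMaps.normalize B : X → Y) (x + y) - (BoundedMaps.normalize B : X → Y) x -
      (BoundedMaps.normalize B : X → Y) y = _
    simp only [BoundedMaps.normalize_apply, map_add]; abel
  rw [e]
  change _ ≤ Δ * (Δ * (D + 1) + 1) * ‖B‖ * (‖x‖ + ‖y‖)
  have h1 : ‖(B : X → Y) (x + y)‖ ≤ ‖B‖ * (D * (‖x‖ + ‖y‖)) :=
    (hev _).trans (by gcongr; exact h' x y)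
  have h2 : ‖(B : X → Y) x‖ ≤ ‖B‖ * (‖x‖ + ‖y‖) := (hev _).trans (by gcongr; linarith)
  have h3 : ‖(B : X → Y) y‖ ≤ ‖B‖ * (‖x‖ + ‖y‖) := (hev _).trans (by gcongr; linarith)
  calc _ ≤ Δ * (Δ * (‖B‖ * (D * (‖x‖ + ‖y‖)) + ‖B‖ * (‖x‖ + ‖y‖)) + ‖B‖ * (‖x‖ + ‖y‖)) := by
        refine (qnorm_sub_le_of_modulus 𝕜 h _ _).trans ?_
        gcongr
        refine (qnorm_sub_le_of_modulus 𝕜 h _ _).trans ?_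
        gcongr
    _ = _ := by ring

/-- If the trivial maps are closed, then the map from bounded maps to quasilinear maps modulo
linear maps has closed range, and the open mapping theorem bounds `K₀`. -/
theorem K₀_lt_top_of_trivialMapsClosed (hcl : TrivialMapsClosed 𝕜 X Y) : K₀ 𝕜 X Y < ⊤ := by
  obtain ⟨C, hC⟩ := exists_bounded_lift
    (BoundedMaps.normalize : BoundedMaps 𝕜 X Y →ₗ[𝕜] NormalizedMaps 𝕜 X Y)
    BoundedMaps.normalize_isBoundedMap (by
      intro s F hs hlim
      have hFq : IsQuasilinear 𝕜 (F : X → Y) := by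
        obtain ⟨c, hc⟩ := F.2.2
        exact ⟨F.2.1.1, c, fun x y => hc (x, y)⟩
      obtain ⟨B, L, hB, hB', hL⟩ := hcl F hFq (by
        intro ε hε
        obtain ⟨n, hn⟩ := (hlim.eventually (gt_mem_nhds hε)).exists
        obtain ⟨B, hB⟩ := hs n
        refine ⟨(s n : X → Y), ⟨B, -linearInterpolation 𝕜 (B : X → Y), B.2.1,
          BoundedMaps.isBoundedMap B, fun x => ?_⟩, fun x y => ?_⟩
        · rw [← hB, BoundedMaps.normalize_apply, LinearMap.neg_apply, sub_eq_add_neg]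
        · rw [qnorm_sub_rev 𝕜] at hn
          refine (gaugeSpace.le_norm (F - s n) (x, y)).trans ?_
          have hx := qnorm_nonneg 𝕜 x
          have hy := qnorm_nonneg 𝕜 y
          change _ * (‖x‖ + ‖y‖) ≤ _
          gcongr)
      refine ⟨⟨B, hB, hB'⟩, ?_⟩
      ext x
      have hLB : -L = linearInterpolation 𝕜 B := linearInterpolation_unique _ _ fun i => by
        have h1 : (F : X → Y) (Module.Basis.ofVectorSpace 𝕜 X i) = 0 :=
          (Submodule.mem_iInf _).1 F.2.1.2 i
        rw [hL] at h1
        rw [LinearMap.neg_apply]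
        exact (eq_neg_of_add_eq_zero_left h1).symm
      rw [BoundedMaps.normalize_apply, ← hLB, LinearMap.neg_apply, sub_neg_eq_add]
      exact (hL x).symm)
  refine K₀_lt_top_iff.2 ⟨C, fun F hF hF' c _ hc => ?_⟩
  let B₀ : BoundedMaps 𝕜 X Y := ⟨F, hF.1, hF'⟩
  obtain ⟨B, hB, hBn⟩ := hC (BoundedMaps.normalize B₀) (LinearMap.mem_range_self _ _)
  refine ⟨linearInterpolation 𝕜 F - linearInterpolation 𝕜 (B : X → Y), fun x => ?_⟩
  have e : F x - (linearInterpolation 𝕜 F - linearInterpolation 𝕜 (B : X → Y)) x =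
      (B : X → Y) x := by
    have h1 : (BoundedMaps.normalize B : X → Y) x = (BoundedMaps.normalize B₀ : X → Y) x := by
      rw [hB]
    rw [BoundedMaps.normalize_apply, BoundedMaps.normalize_apply] at h1
    change _ = F x - linearInterpolation 𝕜 F x at h1
    rw [LinearMap.sub_apply, ← sub_add, ← h1, sub_add_cancel]
  rw [e]
  have h2 : ‖BoundedMaps.normalize B₀‖ ≤ c := gaugeSpace.norm_le c.2 fun p =>
    (hc.congr_linear (-linearInterpolation 𝕜 F) (G := F - ⇑(linearInterpolation 𝕜 F))
      fun x => by simp [sub_eq_add_neg]) p.1 p.2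
  have hx := qnorm_nonneg 𝕜 x
  calc _ ≤ ‖B‖ * ‖x‖ := gaugeSpace.le_norm B x
    _ ≤ C * c * ‖x‖ := by
      gcongr
      exact hBn.trans (by gcongr)

theorem K₀_lt_top_iff_trivialMapsClosed : K₀ 𝕜 X Y < ⊤ ↔ TrivialMapsClosed 𝕜 X Y :=
  ⟨trivialMapsClosed_of_K₀_lt_top, K₀_lt_top_of_trivialMapsClosed⟩

end Closedness

/-! ### Extensions and quasilinear maps -/

section Twisted

open QuasiBanachSpace

variable {𝕜 : Type w} [RCLike 𝕜] {X : Type u} {Y : Type v}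
  [AddCommGroup X] [Module 𝕜 X] [Norm X] [AddCommGroup Y] [Module 𝕜 Y] [Norm Y]

/-- Selections compatible with scalar multiplication: choose on one vector of each line. -/
theorem exists_homogeneous_selection {X Z : Type*} [AddCommGroup X] [Module 𝕜 X] [AddCommGroup Z]
    [Module 𝕜 Z] {P : X → Z → Prop} (hP : ∀ (c : 𝕜) x z, P x z → P (c • x) (c • z))
    (h : ∀ x, ∃ z, P x z) : ∃ B : X → Z, IsHomogeneous 𝕜 B ∧ ∀ x, P x (B x) := by
  classical
  choose b hb using h
  let r : X → X := fun x => if hx : x = 0 then 0 else (Projectivization.mk 𝕜 x hx).rep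
  have hr : ∀ x (hx : x ≠ 0), r x = (Projectivization.mk 𝕜 x hx).rep := fun x hx => dif_neg hx
  have hr0 : ∀ x, x ≠ 0 → r x ≠ 0 := fun x hx => by
    rw [hr x hx]; exact Projectivization.rep_nonzero _
  have hex : ∀ x, ∃ a : 𝕜, x = a • r x := fun x => by
    by_cases hx : x = 0
    · exact ⟨0, by rw [hx, zero_smul]⟩
    · obtain ⟨a, ha⟩ := Projectivization.exists_smul_eq_mk_rep 𝕜 x hx
      refine ⟨((a⁻¹ : 𝕜ˣ) : 𝕜), ?_⟩
      rw [hr x hx, ← ha]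
      change x = a⁻¹ • a • x
      rw [inv_smul_smul]
  choose a ha using hex
  have hrs : ∀ (c : 𝕜) x, c ≠ 0 → x ≠ 0 → r (c • x) = r x := fun c x hc hx => by
    rw [hr x hx, hr _ (smul_ne_zero hc hx)]
    congr 1
    exact (Projectivization.mk_eq_mk_iff' 𝕜 _ _ _ _).2 ⟨c, rfl⟩
  refine ⟨fun x => if x = 0 then 0 else a x • b (r x), fun c x => ?_, fun x => ?_⟩
  · by_cases hx : x = 0
    · simp [hx]
    by_cases hc : c = 0
    · simp [hc]
    have hcx := smul_ne_zero hc hx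
    simp only [hx, hcx, if_false]
    have h1 := ha (c • x)
    rw [hrs c x hc hx] at h1 ⊢
    conv_lhs at h1 => rw [ha x, smul_smul]
    rw [← smul_left_injective 𝕜 (hr0 x hx) h1, smul_smul]
  · by_cases hx : x = 0
    · simp only [hx, if_true]
      have := hP 0 0 _ (hb 0)
      simpa using this
    · simp only [hx, if_false]
      have := hP (a x) _ _ (hb (r x))
      rwa [← ha x] at this

/-- The underlying space of the twisted sum `Y ⊕_F X`: the vector space `Y × X` with the
quasi-norm `‖y - F x‖ + ‖x‖`. -/
def TwistedSum (_F : X → Y) : Type (max u v) := Y × X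

namespace TwistedSum

variable (F : X → Y)

instance : AddCommGroup (TwistedSum F) := inferInstanceAs (AddCommGroup (Y × X))

instance : Module 𝕜 (TwistedSum F) := inferInstanceAs (Module 𝕜 (Y × X))

instance : Norm (TwistedSum F) := ⟨fun z => ‖z.1 - F z.2‖ + ‖z.2‖⟩

theorem norm_def (z : TwistedSum F) : ‖z‖ = ‖z.1 - F z.2‖ + ‖z.2‖ := rfl

variable [QuasiBanachSpace 𝕜 X] [QuasiBanachSpace 𝕜 Y]

variable {F} in
theorem quasiBanachSpace (hF : IsQuasilinear 𝕜 F) : QuasiBanachSpace 𝕜 (TwistedSum F) where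
  qnorm_nonneg := fun z => add_nonneg (qnorm_nonneg 𝕜 _) (qnorm_nonneg 𝕜 _)
  qnorm_smul := fun c z => by
    change ‖c • z.1 - F (c • z.2)‖ + ‖c • z.2‖ = ‖c‖ * (‖z.1 - F z.2‖ + ‖z.2‖)
    rw [hF.1, ← smul_sub, qnorm_smul, qnorm_smul, mul_add]
  qnorm_add_le := by
    obtain ⟨Δ, hΔ, h⟩ := exists_modulus 𝕜 Y
    obtain ⟨D, hD, h'⟩ := exists_modulus 𝕜 X
    obtain ⟨c, hc⟩ := hF.exists_bound
    refine ⟨Δ * (c + Δ) + D, fun z t => ?_⟩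
    have hz1 := qnorm_nonneg 𝕜 (z.1 - F z.2)
    have ht1 := qnorm_nonneg 𝕜 (t.1 - F t.2)
    have hz2 := qnorm_nonneg 𝕜 z.2
    have ht2 := qnorm_nonneg 𝕜 t.2
    change ‖z.1 + t.1 - F (z.2 + t.2)‖ + ‖z.2 + t.2‖ ≤
      _ * (‖z.1 - F z.2‖ + ‖z.2‖ + (‖t.1 - F t.2‖ + ‖t.2‖))
    have e : z.1 + t.1 - F (z.2 + t.2) =
        ((z.1 - F z.2) + (t.1 - F t.2)) - (F (z.2 + t.2) - F z.2 - F t.2) := by abel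
    have h1 : ‖z.1 + t.1 - F (z.2 + t.2)‖ ≤
        Δ * (Δ * (‖z.1 - F z.2‖ + ‖t.1 - F t.2‖) + c * (‖z.2‖ + ‖t.2‖)) := by
      rw [e]
      refine (qnorm_sub_le_of_modulus 𝕜 h _ _).trans ?_
      gcongr
      · exact h _ _
      · exact hc _ _
    have h2 := h' z.2 t.2
    have hD' : 0 ≤ D := by linarith
    have hΔ' : 0 ≤ Δ := by linarith
    have p1 : 0 ≤ (Δ * c + D) * (‖z.1 - F z.2‖ + ‖t.1 - F t.2‖) := by positivity
    have p2 : 0 ≤ Δ * Δ * (‖z.2‖ + ‖t.2‖) := by positivity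
    calc _ ≤ Δ * (Δ * (‖z.1 - F z.2‖ + ‖t.1 - F t.2‖) + c * (‖z.2‖ + ‖t.2‖))
          + D * (‖z.2‖ + ‖t.2‖) := add_le_add h1 h2
      _ ≤ _ := by linarith
  eq_zero_of_qnorm := fun z hz => by
    have h1 := qnorm_nonneg 𝕜 (z.1 - F z.2)
    have h2 := qnorm_nonneg 𝕜 z.2
    rw [norm_def] at hz
    have hz2 : z.2 = 0 := eq_zero_of_qnorm_le 𝕜 (by linarith)
    have hz1 : z.1 - F z.2 = 0 := eq_zero_of_qnorm_le 𝕜 (by linarith)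
    have hF0 : F 0 = 0 := by simpa using hF.1 (0 : 𝕜) 0
    rw [hz2, hF0, sub_zero] at hz1
    exact Prod.ext hz1 hz2
  complete := fun s hs => by
    obtain ⟨Δ, hΔ, h⟩ := exists_modulus 𝕜 Y
    have hΔ0 : 0 < Δ := by linarith
    obtain ⟨c, hc⟩ := hF.exists_bound
    have hs1 : ∀ ε : ℝ, 0 < ε → ∃ N, ∀ m ≥ N, ∀ n ≥ N,
        ‖((s m).1 - (s n).1) - F ((s m).2 - (s n).2)‖ < ε ∧ ‖(s m).2 - (s n).2‖ < ε := by
      intro ε hε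
      obtain ⟨N, hN⟩ := hs ε hε
      refine ⟨N, fun m hm n hn => ?_⟩
      have h1 : ‖((s m).1 - (s n).1) - F ((s m).2 - (s n).2)‖ + ‖(s m).2 - (s n).2‖ < ε :=
        hN m hm n hn
      have h2 := qnorm_nonneg 𝕜 (((s m).1 - (s n).1) - F ((s m).2 - (s n).2))
      have h3 := qnorm_nonneg 𝕜 ((s m).2 - (s n).2)
      exact ⟨by linarith, by linarith⟩
    obtain ⟨x, hx⟩ := complete (𝕜 := 𝕜) (fun n => (s n).2) fun ε hε => by
      obtain ⟨N, hN⟩ := hs1 ε hε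
      exact ⟨N, fun m hm n hn => (hN m hm n hn).2⟩
    -- the components `y_n - F x_n`, recentred at the limit `x`, form a Cauchy sequence
    obtain ⟨y, hy⟩ := complete (𝕜 := 𝕜) (fun n => (s n).1 - F x - F ((s n).2 - x)) fun ε hε => by
      set δ : ℝ := ε / (Δ * (1 + c * 2) + 1) with hδ
      have hδ0 : 0 < δ := by positivity
      obtain ⟨N, hN⟩ := hs1 δ hδ0
      obtain ⟨M, hM⟩ := Filter.eventually_atTop.1 (hx.eventually (gt_mem_nhds hδ0))
      refine ⟨max N M, fun m hm n hn => ?_⟩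
      have hm1 := hN m ((le_max_left _ _).trans hm) n ((le_max_left _ _).trans hn)
      have hn2 := hM n ((le_max_right _ _).trans hn)
      have e : (s m).1 - F x - F ((s m).2 - x) - ((s n).1 - F x - F ((s n).2 - x)) =
          (((s m).1 - (s n).1) - F ((s m).2 - (s n).2)) -
          (F (((s m).2 - (s n).2) + ((s n).2 - x)) - F ((s m).2 - (s n).2) - F ((s n).2 - x)) := by
        rw [sub_add_sub_cancel]; abel
      rw [e]
      have h2 := hc ((s m).2 - (s n).2) ((s n).2 - x)
      have h1 : c * (‖(s m).2 - (s n).2‖ + ‖(s n).2 - x‖) ≤ c * (δ + δ) := by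
        gcongr
        exact hm1.2.le
      calc _ ≤ Δ * (δ + c * (δ + δ)) := by
            refine (qnorm_sub_le_of_modulus 𝕜 h _ _).trans ?_
            gcongr
            · exact hm1.1.le
            · exact h2.trans h1
        _ = (Δ * (1 + c * 2)) * δ := by ring
        _ < (Δ * (1 + c * 2) + 1) * δ := by gcongr; linarith
        _ = ε := by rw [hδ]; field_simp
    refine ⟨(F x + y, x), ?_⟩
    have h1 := hy.add hx
    rw [add_zero] at h1
    refine h1.congr fun n => ?_
    change _ = ‖(s n).1 - (F x + y) - F ((s n).2 - x)‖ + ‖(s n).2 - x‖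
    congr 2
    abel

/-- The extension `0 → Y → Y ⊕_F X → X → 0` defined by a quasilinear map. -/
def extension (F : X → Y) (hF : IsQuasilinear 𝕜 F) : Extension.{u, v, w} 𝕜 X Y :=
  { Z := TwistedSum F
    quasiBanach := quasiBanachSpace hF
    ι := LinearMap.inl 𝕜 Y X
    π := LinearMap.snd 𝕜 Y X
    ι_bounded := ⟨1, fun y => by
      have hF0 : F 0 = 0 := by simpa using hF.1 (0 : 𝕜) 0
      change ‖y - F 0‖ + ‖(0 : X)‖ ≤ _
      rw [hF0, qnorm_zero 𝕜, sub_zero]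
      simp⟩
    π_bounded := ⟨1, fun z => by
      have := qnorm_nonneg 𝕜 (z.1 - F z.2)
      change ‖z.2‖ ≤ ((1 : ℝ≥0) : ℝ) * (‖z.1 - F z.2‖ + ‖z.2‖)
      simpa using this⟩
    ι_injective := LinearMap.inl_injective
    exact := LinearMap.range_inl 𝕜 Y X
    π_surjective := LinearMap.snd_surjective }

end TwistedSum

namespace Extension

/-- The quasilinear map `F = ι⁻¹ (B - Λ)` obtained from a bounded homogeneous section `B` and a
linear section `Λ` of the quotient map represents the extension. -/
def Represents (E : Extension.{u, v, w} 𝕜 X Y) (F : X → Y) : Prop :=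
  ∃ (B : X → E.Z) (Λ : X →ₗ[𝕜] E.Z), E.IsSection B ∧ (∀ x, E.π (Λ x) = x) ∧
    ∀ x, E.ι (F x) = B x - Λ x

variable {E : Extension.{u, v, w} 𝕜 X Y}

theorem exists_ι_eq {z : E.Z} (hz : E.π z = 0) : ∃ y, E.ι y = z := by
  have : z ∈ LinearMap.range E.ι := by rw [E.exact]; exact hz
  exact this

theorem π_ι (y : Y) : E.π (E.ι y) = 0 := by
  have : E.ι y ∈ LinearMap.ker E.π := by rw [← E.exact]; exact LinearMap.mem_range_self _ y
  exact this

variable (E) in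
theorem exists_linear_section : ∃ Λ : X →ₗ[𝕜] E.Z, ∀ x, E.π (Λ x) = x := by
  obtain ⟨Λ, hΛ⟩ := E.π.exists_rightInverse_of_surjective (LinearMap.range_eq_top.2 E.π_surjective)
  exact ⟨Λ, fun x => LinearMap.congr_fun hΛ x⟩

theorem IsSection.exists_map {B : X → E.Z} (hB : E.IsSection B) {Λ : X →ₗ[𝕜] E.Z}
    (hΛ : ∀ x, E.π (Λ x) = x) : ∃ F : X → Y, ∀ x, E.ι (F x) = B x - Λ x := by
  have : ∀ x, ∃ y, E.ι y = B x - Λ x := fun x => exists_ι_eq (by rw [map_sub, hB.2.2, hΛ, sub_self])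
  choose F hF using this
  exact ⟨F, hF⟩

theorem ι_addDefect {B : X → E.Z} {Λ : X →ₗ[𝕜] E.Z} {F : X → Y}
    (hF : ∀ x, E.ι (F x) = B x - Λ x) (x x' : X) :
    E.ι (F (x + x') - F x - F x') = B (x + x') - B x - B x' := by
  rw [map_sub, map_sub, hF, hF, hF, map_add]; abel

/-- The constant of a section is the quasilinearity constant of the map it defines. -/
theorem sectionConst_eq {B : X → E.Z} {Λ : X →ₗ[𝕜] E.Z} {F : X → Y}
    (hF : ∀ x, E.ι (F x) = B x - Λ x) :
    E.sectionConst B = ⨅ (c : ℝ≥0) (_ : IsQuasiBound F c), (c : ℝ≥0∞) := by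
  unfold sectionConst
  have : ∀ c : ℝ≥0, (∀ (x x' : X) (y : Y), E.ι y = B (x + x') - B x - B x' →
      ‖y‖ ≤ c * (‖x‖ + ‖x'‖)) ↔ IsQuasiBound F c := fun c => by
    constructor
    · intro h x x'
      exact h x x' _ (ι_addDefect hF x x')
    · intro h x x' y hy
      rw [← ι_addDefect hF x x'] at hy
      rw [E.ι_injective hy]
      exact h x x'
  simp only [this]

variable [QuasiBanachSpace 𝕜 X] [QuasiBanachSpace 𝕜 Y]

variable (E) in
/-- A consequence of the open mapping theorem for the quotient map. -/
theorem exists_isSection : ∃ B, E.IsSection B := by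
  obtain ⟨K, hK⟩ := exists_bounded_lift E.π E.π_bounded fun _ x _ _ => E.π_surjective x
  obtain ⟨B, hB, hB'⟩ := exists_homogeneous_selection (𝕜 := 𝕜)
    (P := fun x (z : E.Z) => E.π z = x ∧ ‖z‖ ≤ K * ‖x‖)
    (fun c x z hz => ⟨by rw [map_smul, hz.1], by
      rw [qnorm_smul, qnorm_smul, mul_left_comm]
      exact mul_le_mul_of_nonneg_left hz.2 (norm_nonneg c)⟩)
    (fun x => hK x (E.π_surjective x))
  exact ⟨B, hB, ⟨K, fun x => (hB' x).2⟩, fun x => (hB' x).1⟩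

variable (E) in
/-- A consequence of the open mapping theorem for `ι`, whose range is closed. -/
theorem exists_le_norm_ι : ∃ K : ℝ≥0, ∀ y, ‖y‖ ≤ K * ‖E.ι y‖ := by
  obtain ⟨K, hK⟩ := exists_bounded_lift E.ι E.ι_bounded (by
    intro s z hs hz
    rw [E.exact, LinearMap.mem_ker]
    obtain ⟨C, hC⟩ := E.π_bounded
    refine eq_of_tendsto 𝕜 (s := fun n => E.π (s n)) ?_ ?_
    · refine squeeze_zero (g := fun n => C * ‖s n - z‖) (fun n => qnorm_nonneg 𝕜 _)
        (fun n => by rw [← map_sub]; exact hC _) ?_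
      simpa using hz.const_mul (C : ℝ)
    · have : ∀ n, E.π (s n) = 0 := fun n => by
        have := hs n
        rw [E.exact] at this
        exact this
      simp only [this, sub_self, qnorm_zero 𝕜]
      exact tendsto_const_nhds)
  refine ⟨K, fun y => ?_⟩
  obtain ⟨y', hy', h⟩ := hK (E.ι y) (LinearMap.mem_range_self _ y)
  rwa [E.ι_injective hy'] at h

variable (E) in
theorem exists_represents : ∃ F, E.Represents F := by
  obtain ⟨B, hB⟩ := E.exists_isSection
  obtain ⟨Λ, hΛ⟩ := E.exists_linear_section
  obtain ⟨F, hF⟩ := hB.exists_map hΛ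
  exact ⟨F, B, Λ, hB, hΛ, hF⟩

theorem Represents.isQuasilinear {F : X → Y} (h : E.Represents F) : IsQuasilinear 𝕜 F := by
  obtain ⟨B, Λ, hB, hΛ, hF⟩ := h
  obtain ⟨K, hK⟩ := E.exists_le_norm_ι
  obtain ⟨c, hc⟩ := hB.2.1.isQuasiBound (𝕜 := 𝕜)
  refine ⟨fun a x => E.ι_injective ?_, K * c, fun x x' => ?_⟩
  · rw [map_smul, hF, hF, hB.1, map_smul, smul_sub]
  · refine (hK _).trans ?_
    rw [ι_addDefect hF, NNReal.coe_mul, mul_assoc]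
    exact mul_le_mul_of_nonneg_left (hc x x') K.2

theorem Represents.sub {F G : X → Y} (hF : E.Represents F) (hG : E.Represents G) :
    IsTrivialMap 𝕜 (F - G) := by
  obtain ⟨B, Λ, hB, hΛ, hF⟩ := hF
  obtain ⟨B', Λ', hB', hΛ', hG⟩ := hG
  obtain ⟨K, hK⟩ := E.exists_le_norm_ι
  have h1 : ∀ x, ∃ y, E.ι y = B x - B' x := fun x =>
    exists_ι_eq (by rw [map_sub, hB.2.2, hB'.2.2, sub_self])
  choose D hD using h1
  have hBB : IsBoundedMap (B - B') := by
    rw [sub_eq_add_neg]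
    exact hB.2.1.add (𝕜 := 𝕜) (hB'.2.1.neg (𝕜 := 𝕜))
  obtain ⟨C, hC⟩ := hBB
  have hDD : ∀ x, E.ι ((F - G - D) x) = Λ' x - Λ x := fun x => by
    simp only [Pi.sub_apply, map_sub, hF, hG, hD]; abel
  refine ⟨D, ⟨⟨F - G - D, fun x y => E.ι_injective ?_⟩, fun c x => E.ι_injective ?_⟩,
    fun c x => E.ι_injective ?_, ⟨K * C, fun x => ?_⟩, fun x => ?_⟩
  · rw [map_add, hDD, hDD, hDD, map_add, map_add]; abel
  · simp only [hDD, map_smul, smul_sub, RingHom.id_apply]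
  · rw [hD, map_smul, hD, hB.1, hB'.1, smul_sub]
  · refine (hK _).trans ?_
    rw [hD, NNReal.coe_mul, mul_assoc]
    exact mul_le_mul_of_nonneg_left (hC x) K.2
  · change F x - G x = D x + (F x - G x - D x)
    abel

theorem Represents.add_trivial {F G : X → Y} (hF : E.Represents F) (hG : IsTrivialMap 𝕜 G) :
    E.Represents (F + G) := by
  obtain ⟨B, Λ, hB, hΛ, hF⟩ := hF
  obtain ⟨A, L, hA, hA', hL⟩ := hG
  have hb : IsBoundedMap (fun x => E.ι (A x)) := by
    obtain ⟨a, ha⟩ := hA'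
    obtain ⟨C, hC⟩ := E.ι_bounded
    refine ⟨C * a, fun x => (hC _).trans ?_⟩
    rw [NNReal.coe_mul, mul_assoc]
    exact mul_le_mul_of_nonneg_left (ha x) C.2
  refine ⟨B + fun x => E.ι (A x), Λ - E.ι ∘ₗ L, ⟨hB.1.add fun c x => ?_, hB.2.1.add (𝕜 := 𝕜) hb,
    fun x => ?_⟩, fun x => ?_, fun x => ?_⟩
  · simp only [hA c x, map_smul]
  · rw [Pi.add_apply, map_add, hB.2.2, π_ι, add_zero]
  · rw [LinearMap.sub_apply, map_sub, hΛ, LinearMap.comp_apply, π_ι, sub_zero]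
  · simp only [Pi.add_apply, map_add, hF, hL, LinearMap.sub_apply, LinearMap.comp_apply]
    abel

theorem Represents.of_equivalent {E' : Extension.{u, v, w} 𝕜 X Y} {F : X → Y}
    (hF : E.Represents F) (h : E.Equivalent E') : E'.Represents F := by
  obtain ⟨B, Λ, hB, hΛ, hF⟩ := hF
  obtain ⟨t, ⟨C, hC⟩, hι, hπ⟩ := h
  obtain ⟨b, hb⟩ := hB.2.1
  refine ⟨fun x => t (B x), t ∘ₗ Λ, ⟨fun c x => ?_, ⟨C * b, fun x => (hC _).trans ?_⟩, fun x => ?_⟩,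
    fun x => ?_, fun x => ?_⟩
  · simp only [hB.1 c x, map_smul]
  · rw [NNReal.coe_mul, mul_assoc]
    exact mul_le_mul_of_nonneg_left (hb x) C.2
  · rw [hπ, hB.2.2]
  · rw [LinearMap.comp_apply, hπ, hΛ]
  · rw [← hι, hF, map_sub, LinearMap.comp_apply]

/-- The converse implication comes without an inverse operator: any two maps representing the target
differ by a trivial map. -/
theorem represents_iff_of_equivalent {E' : Extension.{u, v, w} 𝕜 X Y} {F : X → Y}
    (h : E.Equivalent E') : E.Represents F ↔ E'.Represents F := by
  refine ⟨fun hF => hF.of_equivalent h, fun hF => ?_⟩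
  obtain ⟨G, hG⟩ := E.exists_represents
  have := hG.add_trivial (hF.sub (hG.of_equivalent h))
  rwa [add_sub_cancel] at this

theorem represents_twistedSum {F : X → Y} (hF : IsQuasilinear 𝕜 F) :
    (TwistedSum.extension F hF).Represents F := by
  refine ⟨fun x => (F x, x), LinearMap.inr 𝕜 Y X, ⟨fun c x => ?_, ⟨1, fun x => ?_⟩, fun x => rfl⟩,
    fun x => rfl, fun x => ?_⟩
  · exact Prod.ext (hF.1 c x) rfl
  · change ‖F x - F x‖ + ‖x‖ ≤ _
    rw [sub_self, qnorm_zero 𝕜, zero_add, NNReal.coe_one, one_mul]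
  · exact Prod.ext (sub_zero _).symm (sub_self _).symm

theorem Represents.twistedSum_equivalent {F : X → Y} (h : E.Represents F) :
    (TwistedSum.extension F h.isQuasilinear).Equivalent E := by
  have hq := h.isQuasilinear
  obtain ⟨B, Λ, hB, hΛ, hF⟩ := h
  obtain ⟨Δ, hΔ, h⟩ := exists_modulus 𝕜 E.Z
  lift Δ to ℝ≥0 using by linarith
  obtain ⟨b, hb⟩ := hB.2.1
  obtain ⟨C, hC⟩ := E.ι_bounded
  refine ⟨E.ι.coprod Λ, ⟨Δ * (C + b), fun z => ?_⟩, fun y => ?_, fun z => ?_⟩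
  · obtain ⟨y, x⟩ := z
    change ‖E.ι y + Λ x‖ ≤ ((Δ * (C + b) : ℝ≥0) : ℝ) * (‖y - F x‖ + ‖x‖)
    have e : E.ι y + Λ x = E.ι (y - F x) + B x := by rw [map_sub, hF]; abel
    have h1 := qnorm_nonneg 𝕜 (y - F x)
    have h2 := qnorm_nonneg 𝕜 x
    rw [e]
    calc _ ≤ Δ * (C * ‖y - F x‖ + b * ‖x‖) := by
          refine (h _ _).trans ?_
          gcongr
          · exact hC _
          · exact hb _
      _ ≤ Δ * ((C + b) * (‖y - F x‖ + ‖x‖)) := by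
          gcongr
          have : 0 ≤ C * ‖x‖ + b * ‖y - F x‖ := by positivity
          linarith
      _ = _ := by push_cast; ring
  · change E.ι y + Λ 0 = E.ι y
    rw [map_zero, add_zero]
  · obtain ⟨y, x⟩ := z
    change E.π (E.ι y + Λ x) = x
    rw [map_add, π_ι, hΛ, zero_add]

theorem IsBaerSum.represents {E₁ E₂ : Extension.{u, v, w} 𝕜 X Y} {F₁ F₂ : X → Y}
    (h : IsBaerSum E₁ E₂ E) (h₁ : E₁.Represents F₁) (h₂ : E₂.Represents F₂) :
    E.Represents (F₁ + F₂) := by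
  obtain ⟨B₁, Λ₁, hB₁, hΛ₁, hF₁⟩ := h₁
  obtain ⟨B₂, Λ₂, hB₂, hΛ₂, hF₂⟩ := h₂
  obtain ⟨s, ⟨C, hC⟩, hι, hπ⟩ := h
  obtain ⟨b₁, hb₁⟩ := hB₁.2.1
  obtain ⟨b₂, hb₂⟩ := hB₂.2.1
  have hmem : ∀ x, (B₁ x, B₂ x) ∈ pullback E₁ E₂ := fun x => by
    change E₁.π (B₁ x) = E₂.π (B₂ x)
    rw [hB₁.2.2, hB₂.2.2]
  let Λ : X →ₗ[𝕜] pullback E₁ E₂ := LinearMap.codRestrict _ (Λ₁.prod Λ₂) fun x => by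
    change E₁.π (Λ₁ x) = E₂.π (Λ₂ x)
    rw [hΛ₁, hΛ₂]
  refine ⟨fun x => s ⟨(B₁ x, B₂ x), hmem x⟩, s ∘ₗ Λ, ⟨fun c x => ?_,
    ⟨C * max b₁ b₂, fun x => (hC _).trans ?_⟩, fun x => ?_⟩, fun x => ?_, fun x => ?_⟩
  · simp only [← map_smul]
    congr 1
    exact Subtype.ext (Prod.ext (hB₁.1 c x) (hB₂.1 c x))
  · have hx := qnorm_nonneg 𝕜 x
    rw [NNReal.coe_mul, mul_assoc]
    refine mul_le_mul_of_nonneg_left ?_ C.2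
    change max ‖B₁ x‖ ‖B₂ x‖ ≤ _
    refine max_le ((hb₁ x).trans ?_) ((hb₂ x).trans ?_)
    · gcongr; exact le_max_left _ _
    · gcongr; exact le_max_right _ _
  · rw [hπ]; exact hB₁.2.2 x
  · rw [LinearMap.comp_apply, hπ]; exact hΛ₁ x
  · rw [LinearMap.comp_apply, ← map_sub]
    exact (hι _ _ _ (Prod.ext (hF₁ x).symm (hF₂ x).symm)).symm

theorem isBaerSum_twistedSum {F₁ F₂ : X → Y} (h₁ : IsQuasilinear 𝕜 F₁) (h₂ : IsQuasilinear 𝕜 F₂) :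
    IsBaerSum (TwistedSum.extension F₁ h₁) (TwistedSum.extension F₂ h₂)
      (TwistedSum.extension (F₁ + F₂) (h₁.add h₂)) := by
  obtain ⟨Δ, hΔ, h⟩ := exists_modulus 𝕜 Y
  lift Δ to ℝ≥0 using by linarith
  let s₀ : (Y × X) × (Y × X) →ₗ[𝕜] Y × X :=
    (LinearMap.fst 𝕜 Y X ∘ₗ LinearMap.fst 𝕜 (Y × X) (Y × X) +
      LinearMap.fst 𝕜 Y X ∘ₗ LinearMap.snd 𝕜 (Y × X) (Y × X)).prod
        (LinearMap.snd 𝕜 Y X ∘ₗ LinearMap.fst 𝕜 (Y × X) (Y × X))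
  refine ⟨s₀ ∘ₗ (pullback (TwistedSum.extension F₁ h₁) (TwistedSum.extension F₂ h₂)).subtype,
    ⟨Δ * 2 + 1, fun p => ?_⟩, fun p y₁ y₂ hp => ?_, fun p => rfl⟩
  · obtain ⟨⟨⟨y₁, x₁⟩, ⟨y₂, x₂⟩⟩, hp⟩ := p
    change x₁ = x₂ at hp
    subst hp
    have h1 := qnorm_nonneg 𝕜 (y₁ - F₁ x₁)
    have h2 := qnorm_nonneg 𝕜 (y₂ - F₂ x₁)
    have h3 := qnorm_nonneg 𝕜 x₁
    change ‖y₁ + y₂ - (F₁ x₁ + F₂ x₁)‖ + ‖x₁‖ ≤ ((Δ * 2 + 1 : ℝ≥0) : ℝ) *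
      max (‖y₁ - F₁ x₁‖ + ‖x₁‖) (‖y₂ - F₂ x₁‖ + ‖x₁‖)
    set M := max (‖y₁ - F₁ x₁‖ + ‖x₁‖) (‖y₂ - F₂ x₁‖ + ‖x₁‖)
    have hM1 : ‖y₁ - F₁ x₁‖ + ‖x₁‖ ≤ M := le_max_left _ _
    have hM2 : ‖y₂ - F₂ x₁‖ + ‖x₁‖ ≤ M := le_max_right _ _
    rw [add_sub_add_comm]
    calc _ ≤ Δ * (M + M) + M := by
          gcongr
          · refine (h _ _).trans ?_
            gcongr <;> linarith
          · linarith
      _ = _ := by push_cast; ring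
  · change s₀ p.1 = (y₁ + y₂, 0)
    have hp' : p.1 = ((y₁, 0), (y₂, 0)) := hp
    rw [hp']
    rfl

theorem represents_directSum : (directSum 𝕜 X Y).Represents (0 : X → Y) := by
  refine ⟨LinearMap.inr 𝕜 Y X, LinearMap.inr 𝕜 Y X, ⟨fun c x => map_smul _ _ _, ⟨1, fun x => ?_⟩,
    fun x => rfl⟩, fun x => rfl, fun x => ?_⟩
  · change max ‖(0 : Y)‖ ‖x‖ ≤ _
    rw [qnorm_zero 𝕜, max_eq_right (qnorm_nonneg 𝕜 x), NNReal.coe_one, one_mul]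
  · exact (LinearMap.map_zero _).trans (sub_self _).symm

end Extension

end Twisted

/-! ### The topology of `Ext` -/

namespace QBExt

open QuasiBanachSpace Extension

variable {𝕜 : Type w} [RCLike 𝕜] {X : Type u} {Y : Type v}
  [AddCommGroup X] [Module 𝕜 X] [Norm X] [QuasiBanachSpace 𝕜 X]
  [AddCommGroup Y] [Module 𝕜 Y] [Norm Y] [QuasiBanachSpace 𝕜 Y]

/-- The class of the twisted sum defined by a quasilinear map. -/
def ofMap (F : X → Y) (hF : IsQuasilinear 𝕜 F) : QBExt.{u, v, w} 𝕜 X Y :=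
  mk (TwistedSum.extension F hF)

theorem represents_iff_of_mk_eq {E E' : Extension.{u, v, w} 𝕜 X Y} {F : X → Y}
    (h : mk E = mk E') : E.Represents F ↔ E'.Represents F := by
  let φ : QBExt.{u, v, w} 𝕜 X Y → Prop :=
    Quot.lift (fun E => E.Represents F) fun _ _ h => propext (represents_iff_of_equivalent h)
  exact iff_of_eq (congrArg φ h)

theorem mk_eq_ofMap {E : Extension.{u, v, w} 𝕜 X Y} {F : X → Y} (h : E.Represents F) :
    mk E = ofMap F h.isQuasilinear :=
  (Quot.sound h.twistedSum_equivalent).symm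

theorem exists_eq_ofMap (e : QBExt.{u, v, w} 𝕜 X Y) :
    ∃ (F : X → Y) (hF : IsQuasilinear 𝕜 F), e = ofMap F hF := by
  obtain ⟨E, rfl⟩ := Quot.exists_rep e
  obtain ⟨F, hF⟩ := E.exists_represents
  exact ⟨F, hF.isQuasilinear, mk_eq_ofMap hF⟩

theorem ofMap_eq_iff {F G : X → Y} (hF : IsQuasilinear 𝕜 F) (hG : IsQuasilinear 𝕜 G) :
    ofMap F hF = ofMap G hG ↔ IsTrivialMap 𝕜 (F - G) := by
  constructor
  · intro h
    exact ((represents_iff_of_mk_eq h).1 (represents_twistedSum hF)).sub (represents_twistedSum hG)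
  · intro h
    have := (represents_twistedSum hG).add_trivial h
    rw [add_sub_cancel] at this
    exact (mk_eq_ofMap this).symm

theorem ofMap_eq_zero_iff {F : X → Y} (hF : IsQuasilinear 𝕜 F) :
    ofMap F hF = 0 ↔ IsTrivialMap 𝕜 F := by
  have : (0 : QBExt.{u, v, w} 𝕜 X Y) = ofMap 0 represents_directSum.isQuasilinear :=
    mk_eq_ofMap represents_directSum
  rw [this, ofMap_eq_iff, sub_zero]

theorem isSum_ofMap_iff {F G : X → Y} (hF : IsQuasilinear 𝕜 F) (hG : IsQuasilinear 𝕜 G)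
    {e : QBExt.{u, v, w} 𝕜 X Y} :
    IsSum (ofMap F hF) (ofMap G hG) e ↔ e = ofMap (F + G) (hF.add hG) := by
  constructor
  · rintro ⟨E₁, E₂, E, h₁, h₂, rfl, h⟩
    exact mk_eq_ofMap (h.represents ((represents_iff_of_mk_eq h₁).2 (represents_twistedSum hF))
      ((represents_iff_of_mk_eq h₂).2 (represents_twistedSum hG)))
  · rintro rfl
    exact ⟨_, _, _, rfl, rfl, rfl, isBaerSum_twistedSum hF hG⟩

/-- The semi-quasi-norm of `Ext` is the distance of a quasilinear map to the trivial maps. -/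
theorem rho_ofMap_lt_iff {F : X → Y} (hF : IsQuasilinear 𝕜 F) {ε : ℝ≥0∞} :
    rho (ofMap F hF) < ε ↔
      ∃ G : X → Y, IsTrivialMap 𝕜 G ∧ ∃ c : ℝ≥0, c < ε ∧ IsQuasiBound (F - G) c := by
  constructor
  · intro h
    obtain ⟨E, h⟩ := iInf_lt_iff.1 h
    obtain ⟨hE, h⟩ := iInf_lt_iff.1 h
    obtain ⟨B, h⟩ := iInf_lt_iff.1 h
    obtain ⟨hB, h⟩ := iInf_lt_iff.1 h
    obtain ⟨Λ, hΛ⟩ := E.exists_linear_section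
    obtain ⟨G, hG⟩ := hB.exists_map hΛ
    rw [sectionConst_eq hG] at h
    obtain ⟨c, h⟩ := iInf_lt_iff.1 h
    obtain ⟨hc, h⟩ := iInf_lt_iff.1 h
    have hEG : E.Represents G := ⟨B, Λ, hB, hΛ, hG⟩
    have hEF : E.Represents F := (represents_iff_of_mk_eq hE).2 (represents_twistedSum hF)
    exact ⟨F - G, hEF.sub hEG, c, h, by rwa [sub_sub_cancel]⟩
  · rintro ⟨G, hG, c, hc, hFG⟩
    have hR : (TwistedSum.extension F hF).Represents (F - G) := by
      rw [sub_eq_add_neg]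
      exact (represents_twistedSum hF).add_trivial hG.neg
    obtain ⟨B, Λ, hB, hΛ, hFG'⟩ := hR
    have h1 : rho (ofMap F hF) ≤ (TwistedSum.extension F hF).rho :=
      iInf₂_le (f := fun E (_ : mk E = ofMap F hF) => E.rho) (TwistedSum.extension F hF) rfl
    have h2 : (TwistedSum.extension F hF).rho ≤ (TwistedSum.extension F hF).sectionConst B :=
      iInf₂_le B hB
    refine lt_of_le_of_lt ((h1.trans h2).trans ?_) hc
    rw [sectionConst_eq hFG']
    exact iInf₂_le c hFG

/-- The open sets of `Ext`, in terms of quasilinear maps. -/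
theorem isOpen_iff {U : Set (QBExt.{u, v, w} 𝕜 X Y)} :
    IsOpen U ↔ ∀ (F : X → Y) (hF : IsQuasilinear 𝕜 F), ofMap F hF ∈ U →
      ∃ ε : ℝ≥0, 0 < ε ∧ ∀ (G : X → Y) (hG : IsQuasilinear 𝕜 G), IsQuasiBound G ε →
        ofMap (G + F) (hG.add hF) ∈ U := by
  constructor
  · intro hU F hF hFU
    obtain ⟨ε, hε, h⟩ := hU _ hFU
    obtain ⟨δ, hδ, hδε⟩ := ENNReal.lt_iff_exists_nnreal_btwn.1 hε
    refine ⟨δ, by exact_mod_cast hδ, fun G hG hGδ => ?_⟩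
    refine h (ofMap G hG) _ ((isSum_ofMap_iff hG hF).2 rfl) ((rho_ofMap_lt_iff hG).2 ?_)
    exact ⟨0, isTrivialMap_zero, δ, hδε, by rwa [sub_zero]⟩
  · intro h e he
    obtain ⟨F, hF, rfl⟩ := exists_eq_ofMap e
    obtain ⟨ε, hε, h⟩ := h F hF he
    refine ⟨ε, by exact_mod_cast hε, fun d e' hs hd => ?_⟩
    obtain ⟨D, hD, rfl⟩ := exists_eq_ofMap d
    obtain ⟨G, hG, c, hc, hDG⟩ := (rho_ofMap_lt_iff hD).1 hd
    rw [(isSum_ofMap_iff hD hF).1 hs]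
    have h1 := h (D - G) (hD.sub hG.isQuasilinear)
      (hDG.mono (𝕜 := 𝕜) (by exact_mod_cast hc.le))
    rw [← (ofMap_eq_iff (hD.add hF) _).2] at h1
    · exact h1
    · have e1 : D + F - (D - G + F) = G := by abel
      rw [e1]; exact hG

/-- The points that have a ball contained in `A`; since balls can be halved, they form an open
set. -/
theorem isOpen_interiorSet (A : Set (QBExt.{u, v, w} 𝕜 X Y)) :
    IsOpen {e | ∃ (F : X → Y) (hF : IsQuasilinear 𝕜 F), e = ofMap F hF ∧ ∃ ε : ℝ≥0, 0 < ε ∧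
      ∀ (G : X → Y) (hG : IsQuasilinear 𝕜 G), IsQuasiBound G ε →
        ofMap (G + F) (hG.add hF) ∈ A} := by
  obtain ⟨Δ, hΔ, h⟩ := exists_modulus 𝕜 Y
  lift Δ to ℝ≥0 using by linarith
  have hΔ0 : (0 : ℝ≥0) < Δ := lt_of_lt_of_le one_pos (by exact_mod_cast hΔ)
  refine isOpen_iff.2 fun F hF hFU => ?_
  obtain ⟨F', hF', hFF', ε, hε, hA⟩ := hFU
  refine ⟨ε / (2 * Δ), by positivity, fun G hG hGε => ?_⟩
  refine ⟨G + F', hG.add hF', ?_, ε / (2 * Δ), by positivity, fun D hD hDε => ?_⟩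
  · rw [ofMap_eq_iff, add_sub_add_left_eq_sub, ← ofMap_eq_iff hF hF']
    exact hFF'
  · have h1 : IsQuasiBound (D + G) ε := by
      refine (hDε.add (𝕜 := 𝕜) hΔ h hGε).mono (𝕜 := 𝕜) (le_of_eq ?_)
      have : (Δ : ℝ) ≠ 0 := by exact_mod_cast hΔ0.ne'
      push_cast
      field_simp
      ring
    have h2 := hA (D + G) (hD.add hG) h1
    simpa only [add_assoc] using h2

/-- The closure of zero consists of the classes at distance zero from the trivial maps. -/
theorem t2Space_iff_trivialMapsClosed :
    T2Space (QBExt.{u, v, w} 𝕜 X Y) ↔ TrivialMapsClosed 𝕜 X Y := by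
  constructor
  · intro hT F hF hG
    rw [← ofMap_eq_zero_iff hF]
    by_contra hne
    obtain ⟨U, V, hU, hV, hFU, h0V, hUV⟩ := t2_separation hne
    -- the class of `F` lies in every neighbourhood of zero
    rw [← (ofMap_eq_zero_iff (isTrivialMap_zero (𝕜 := 𝕜) (X := X) (Y := Y)).isQuasilinear).2
      isTrivialMap_zero] at h0V
    obtain ⟨ε, hε, h⟩ := isOpen_iff.1 hV _ _ h0V
    obtain ⟨G, hG, hFG⟩ := hG ε hε
    have h1 := h (F - G) (hF.sub hG.isQuasilinear) hFG
    have h2 : ofMap F hF = ofMap (F - G + 0) ((hF.sub hG.isQuasilinear).add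
        isTrivialMap_zero.isQuasilinear) := (ofMap_eq_iff _ _).2 (by
      rw [add_zero, sub_sub_cancel]; exact hG)
    exact Set.disjoint_left.1 hUV hFU (h2 ▸ h1)
  · intro hcl
    obtain ⟨Δ, hΔ, h⟩ := exists_modulus 𝕜 Y
    lift Δ to ℝ≥0 using by linarith
    have hΔ0 : (0 : ℝ≥0) < Δ := lt_of_lt_of_le one_pos (by exact_mod_cast hΔ)
    refine ⟨fun e e' hne => ?_⟩
    obtain ⟨F, hF, rfl⟩ := exists_eq_ofMap e
    obtain ⟨F', hF', rfl⟩ := exists_eq_ofMap e'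
    have hsep : ∃ ε : ℝ, 0 < ε ∧ ∀ G : X → Y, IsTrivialMap 𝕜 G → ¬ IsQuasiBound (F - F' - G) ε := by
      by_contra! hcon
      exact hne ((ofMap_eq_iff hF hF').2 (hcl _ (hF.sub hF') hcon))
    obtain ⟨ε, hε, hsep⟩ := hsep
    lift ε to ℝ≥0 using hε.le
    have hε0 : (0 : ℝ≥0) < ε := by exact_mod_cast hε
    let δ : ℝ≥0 := ε / (2 * Δ)
    have hδ : 0 < δ := by positivity
    let ball : (H : X → Y) → IsQuasilinear 𝕜 H → Set (QBExt.{u, v, w} 𝕜 X Y) := fun H hH =>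
      {e | ∃ (G : X → Y) (hG : IsQuasilinear 𝕜 G), IsQuasiBound G δ ∧ e = ofMap (G + H) (hG.add hH)}
    refine ⟨_, _, isOpen_interiorSet (ball F hF), isOpen_interiorSet (ball F' hF'),
      ⟨F, hF, rfl, δ, hδ, fun G hG hGδ => ⟨G, hG, hGδ, rfl⟩⟩,
      ⟨F', hF', rfl, δ, hδ, fun G hG hGδ => ⟨G, hG, hGδ, rfl⟩⟩, ?_⟩
    have hsub : ∀ (H : X → Y) (hH : IsQuasilinear 𝕜 H),
        {e | ∃ (F : X → Y) (hF : IsQuasilinear 𝕜 F), e = ofMap F hF ∧ ∃ ε : ℝ≥0, 0 < ε ∧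
          ∀ (G : X → Y) (hG : IsQuasilinear 𝕜 G), IsQuasiBound G ε →
            ofMap (G + F) (hG.add hF) ∈ ball H hH} ⊆ ball H hH := by
      rintro H hH _ ⟨F, hF, rfl, η, hη, hA⟩
      have := hA 0 isTrivialMap_zero.isQuasilinear (fun x y => by
        have hx := qnorm_nonneg 𝕜 x
        have hy := qnorm_nonneg 𝕜 y
        simp only [Pi.zero_apply, sub_self, qnorm_zero 𝕜]
        positivity)
      simpa only [zero_add] using this
    refine Set.disjoint_of_subset (hsub F hF) (hsub F' hF') (Set.disjoint_left.2 ?_)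
    rintro _ ⟨G, hG, hGδ, rfl⟩ ⟨G', hG', hGδ', hGG'⟩
    refine hsep _ ((ofMap_eq_iff _ _).1 hGG') ?_
    have e1 : F - F' - (G + F - (G' + F')) = G' - G := by abel
    rw [e1]
    refine (hGδ'.sub (𝕜 := 𝕜) hΔ h hGδ).mono (𝕜 := 𝕜) (le_of_eq ?_)
    have : (Δ : ℝ) ≠ 0 := by exact_mod_cast hΔ0.ne'
    simp only [δ]
    push_cast
    field_simp
    ring

theorem t2Space_iff_K₀_lt_top : T2Space (QBExt.{u, v, w} 𝕜 X Y) ↔ K₀ 𝕜 X Y < ⊤ :=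
  t2Space_iff_trivialMapsClosed.trans K₀_lt_top_iff_trivialMapsClosed.symm

end QBExt

/-! ### Scalar quasilinear maps on spaces of nontrivial type -/

section ScalarMaps

/-- An elementary substitute for Minkowski's inequality. -/
theorem abs_add_rpow_le {q η : ℝ} (hq : 0 ≤ q) (hη : 0 < η) (a e : ℝ) :
    |a + e| ^ q ≤ (1 + η) ^ q * |a| ^ q + (1 + η⁻¹) ^ q * |e| ^ q := by
  rcases le_total |e| (η * |a|) with h | h
  · have h1 : |a + e| ≤ (1 + η) * |a| := (abs_add_le a e).trans (by linarith)
    calc |a + e| ^ q ≤ ((1 + η) * |a|) ^ q := by gcongr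
      _ = (1 + η) ^ q * |a| ^ q := Real.mul_rpow (by positivity) (abs_nonneg _)
      _ ≤ _ := by
        have : 0 ≤ (1 + η⁻¹) ^ q * |e| ^ q := by positivity
        linarith
  · have h0 : |a| ≤ η⁻¹ * |e| := by rwa [le_inv_mul_iff₀ hη]
    have h1 : |a + e| ≤ (1 + η⁻¹) * |e| := (abs_add_le a e).trans (by linarith)
    calc |a + e| ^ q ≤ ((1 + η⁻¹) * |e|) ^ q := by gcongr
      _ = (1 + η⁻¹) ^ q * |e| ^ q := Real.mul_rpow (by positivity) (abs_nonneg _)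
      _ ≤ _ := by
        have : 0 ≤ (1 + η) ^ q * |a| ^ q := by positivity
        linarith

theorem add_rpow_le_two_rpow_mul {q a b : ℝ} (hq : 0 ≤ q) (ha : 0 ≤ a) (hb : 0 ≤ b) :
    (a + b) ^ q ≤ 2 ^ q * (a ^ q + b ^ q) := by
  have h1 : a + b ≤ 2 * max a b := by
    have := le_max_left a b
    have := le_max_right a b
    linarith
  have h0 : 0 ≤ max a b := ha.trans (le_max_left _ _)
  calc (a + b) ^ q ≤ (2 * max a b) ^ q := by gcongr
    _ = 2 ^ q * (max a b) ^ q := Real.mul_rpow (by norm_num) h0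
    _ ≤ _ := by
      gcongr
      have := Real.rpow_nonneg ha q
      have := Real.rpow_nonneg hb q
      rcases max_choice a b with h | h <;> rw [h] <;> linarith

/-- `‖u + v‖ ^ q + ‖u - v‖ ^ q ≤ 2 * c * (‖u‖ ^ q + ‖v‖ ^ q)`. If `2 * c < 2 ^ q`, then by iteration
suitable signed sums of `n` unit vectors have norm of order at most `n ^ s` for some `s < 1`. -/
def HasTwoPointBound (E : Type*) [SeminormedAddCommGroup E] (q c : ℝ) : Prop :=
  ∀ u v : E, ‖u + v‖ ^ q + ‖u - v‖ ^ q ≤ 2 * c * (‖u‖ ^ q + ‖v‖ ^ q)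

theorem Multiset.exists_add_card_le {α : Type*} (s : Multiset α) {m n : ℕ}
    (h : s.card ≤ m + n) : ∃ a b : Multiset α, s = a + b ∧ a.card ≤ m ∧ b.card ≤ n := by
  induction s using Quotient.inductionOn with
  | h l =>
    refine ⟨(l.take m : List α), (l.drop m : List α), ?_, ?_, ?_⟩
    · simp [List.take_append_drop]
    · simp
    · have : l.length ≤ m + n := by simpa using h
      simp
      omega

variable {X : Type u} [NormedAddCommGroup X] [NormedSpace ℝ X]

/-- Signs can be chosen so that a signed sum of unit vectors and the corresponding defect of a
quasilinear function are simultaneously small. The signs are chosen greedily, combining the two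
halves of the family so that the potential `‖w‖ ^ q + l * |D| ^ q` of the signed sum `w` and
its defect `D` grows by a factor less than `2 ^ q`. -/
theorem exists_signs {q c : ℝ} (hq : 1 ≤ q) (hc : 0 < c) (hcq : 2 * c < 2 ^ q)
    (hX : HasTwoPointBound X q c) (hR : HasTwoPointBound ℝ q c) :
    ∃ σ C : ℝ, 0 < σ ∧ σ < 2 ∧ 0 ≤ C ∧ ∀ f : X → ℝ, (∀ (r : ℝ) x, f (r • x) = r * f x) →
      (∀ x y, |f (x + y) - f x - f y| ≤ ‖x‖ + ‖y‖) →
      ∀ (k : ℕ) (s : Multiset X), s.card ≤ 2 ^ k → (∀ x ∈ s, ‖x‖ ≤ 1) →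
        ∃ a b : Multiset X, s = a + b ∧ ‖a.sum - b.sum‖ ≤ σ ^ k ∧
          |(a.map f).sum - (b.map f).sum - f (a.sum - b.sum)| ≤ C * σ ^ k := by
  have hq0 : 0 < q := by linarith
  obtain ⟨η, hη0, hη⟩ : ∃ η : ℝ, 0 < η ∧ 2 * ((1 + η) ^ q * c) < 2 ^ q := by
    have hcont : ContinuousAt (fun η : ℝ => 2 * ((1 + η) ^ q * c)) 0 := by
      have : ContinuousAt (fun η : ℝ => (1 + η) ^ q) 0 :=
        (continuousAt_const.add continuousAt_id).rpow_const (Or.inr hq0.le)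
      fun_prop
    have h1 : ∀ᶠ η in 𝓝 (0 : ℝ), 2 * ((1 + η) ^ q * c) < 2 ^ q :=
      hcont.eventually (gt_mem_nhds (by simpa using hcq))
    have h2 : ∀ᶠ η in 𝓝[>] (0 : ℝ), 0 < η := self_mem_nhdsWithin
    exact (h2.and (h1.filter_mono nhdsWithin_le_nhds)).exists
  set c₁ : ℝ := (1 + η) ^ q * c with hc₁
  have hc₁0 : 0 < c₁ := by positivity
  have hcc₁ : c < c₁ := by
    have : 1 < (1 + η) ^ q := Real.one_lt_rpow (by linarith) hq0
    rw [hc₁]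
    nlinarith
  set M : ℝ := (1 + η⁻¹) ^ q with hM
  have hM0 : 0 < M := by positivity
  set l : ℝ := (2 * c₁ - 2 * c) / (2 * (M * 2 ^ q)) with hl
  have hl0 : 0 < l := div_pos (by linarith) (by positivity)
  have hlM : 2 * c + l * (2 * (M * 2 ^ q)) = 2 * c₁ := by
    rw [hl, div_mul_cancel₀ _ (by positivity)]; ring
  set σ : ℝ := (2 * c₁) ^ q⁻¹ with hσ
  have hσ0 : 0 < σ := by positivity
  have hσq : σ ^ q = 2 * c₁ := by
    rw [hσ, ← Real.rpow_mul (by positivity), inv_mul_cancel₀ hq0.ne', Real.rpow_one]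
  have hσ2 : σ < 2 := by
    rw [← Real.rpow_lt_rpow_iff hσ0.le (by norm_num) hq0, hσq]; exact hη
  refine ⟨σ, l⁻¹ ^ q⁻¹, hσ0, hσ2, by positivity, fun f hf hfq => ?_⟩
  have hf0 : f 0 = 0 := by simpa using hf 0 0
  have key : ∀ (k : ℕ) (s : Multiset X), s.card ≤ 2 ^ k → (∀ x ∈ s, ‖x‖ ≤ 1) →
      ∃ a b : Multiset X, s = a + b ∧ ‖a.sum - b.sum‖ ^ q +
        l * |(a.map f).sum - (b.map f).sum - f (a.sum - b.sum)| ^ q ≤ (2 * c₁) ^ k := by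
    intro k
    induction k with
    | zero =>
      intro s hs hs1
      rw [pow_zero, Nat.le_one_iff_eq_zero_or_eq_one, Multiset.card_eq_zero,
        Multiset.card_eq_one] at hs
      refine ⟨s, 0, by simp, ?_⟩
      rcases hs with rfl | ⟨x, rfl⟩
      · simp [hf0, Real.zero_rpow hq0.ne']
      · simp only [Multiset.sum_singleton, Multiset.sum_zero, sub_zero, Multiset.map_singleton,
          Multiset.map_zero, sub_self, abs_zero, Real.zero_rpow hq0.ne', mul_zero, add_zero,
          pow_zero]
        exact Real.rpow_le_one (norm_nonneg _) (hs1 x (Multiset.mem_singleton_self x)) hq0.le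
    | succ k ih =>
      intro s hs hs1
      obtain ⟨s₁, s₂, rfl, h1, h2⟩ := s.exists_add_card_le (m := 2 ^ k) (n := 2 ^ k)
        (by rw [← two_mul, ← pow_succ']; exact hs)
      obtain ⟨a₁, b₁, rfl, hu⟩ := ih s₁ h1 fun x hx => hs1 x (Multiset.mem_add.2 (Or.inl hx))
      obtain ⟨a₂, b₂, rfl, hv⟩ := ih s₂ h2 fun x hx => hs1 x (Multiset.mem_add.2 (Or.inr hx))
      set u := a₁.sum - b₁.sum with hu_def
      set v := a₂.sum - b₂.sum with hv_def
      set Du := (a₁.map f).sum - (b₁.map f).sum - f u with hDu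
      set Dv := (a₂.map f).sum - (b₂.map f).sum - f v with hDv
      have herr : ∀ e : ℝ, |e| ≤ ‖u‖ + ‖v‖ → ∀ A : ℝ, |A + e| ^ q ≤
          (1 + η) ^ q * |A| ^ q + M * (2 ^ q * (‖u‖ ^ q + ‖v‖ ^ q)) := fun e he A => by
        refine (abs_add_rpow_le hq0.le hη0 A e).trans ?_
        gcongr
        calc |e| ^ q ≤ (‖u‖ + ‖v‖) ^ q := by gcongr
          _ ≤ _ := add_rpow_le_two_rpow_mul hq0.le (norm_nonneg _) (norm_nonneg _)
      have hplus := herr (f u + f v - f (u + v)) (by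
        rw [abs_sub_comm, ← sub_sub]; exact hfq u v) (Du + Dv)
      have hminus := herr (f u - f v - f (u - v)) (by
        have h3 := hfq u (-v)
        have h4 : f (-v) = - f v := by simpa using hf (-1) v
        rw [h4, ← sub_eq_add_neg, norm_neg] at h3
        rw [abs_sub_comm]
        refine le_trans (le_of_eq ?_) h3
        congr 1; ring) (Du - Dv)
      have hRuv := hR Du Dv
      simp only [Real.norm_eq_abs] at hRuv
      have hXuv := hX u v
      -- the two choices of the relative sign are good on average
      have hsum : (‖u + v‖ ^ q + l * |Du + Dv + (f u + f v - f (u + v))| ^ q) +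
          (‖u - v‖ ^ q + l * |Du - Dv + (f u - f v - f (u - v))| ^ q) ≤
          (2 * c₁) ^ (k + 1) + (2 * c₁) ^ (k + 1) := by
        have h5 : l * (|Du + Dv + (f u + f v - f (u + v))| ^ q
            + |Du - Dv + (f u - f v - f (u - v))| ^ q) ≤
            l * ((1 + η) ^ q * (|Du + Dv| ^ q + |Du - Dv| ^ q)
              + 2 * (M * 2 ^ q) * (‖u‖ ^ q + ‖v‖ ^ q)) :=
          mul_le_mul_of_nonneg_left (by linarith) hl0.le
        have h6 : (1 + η) ^ q * (|Du + Dv| ^ q + |Du - Dv| ^ q) ≤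
            2 * c₁ * (|Du| ^ q + |Dv| ^ q) := by
          calc _ ≤ (1 + η) ^ q * (2 * c * (|Du| ^ q + |Dv| ^ q)) := by gcongr
            _ = _ := by rw [hc₁]; ring
        have h7 : l * ((1 + η) ^ q * (|Du + Dv| ^ q + |Du - Dv| ^ q)) ≤
            l * (2 * c₁ * (|Du| ^ q + |Dv| ^ q)) := by gcongr
        calc _ ≤ (2 * c + l * (2 * (M * 2 ^ q))) * (‖u‖ ^ q + ‖v‖ ^ q)
              + l * (2 * c₁ * (|Du| ^ q + |Dv| ^ q)) := by linarith
          _ = 2 * c₁ * ((‖u‖ ^ q + l * |Du| ^ q) + (‖v‖ ^ q + l * |Dv| ^ q)) := by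
            rw [hlM]; ring
          _ ≤ 2 * c₁ * ((2 * c₁) ^ k + (2 * c₁) ^ k) := by gcongr
          _ = _ := by ring
      rcases le_or_gt (‖u + v‖ ^ q + l * |Du + Dv + (f u + f v - f (u + v))| ^ q)
          ((2 * c₁) ^ (k + 1)) with h8 | h8
      · refine ⟨a₁ + a₂, b₁ + b₂, by abel, ?_⟩
        have e1 : (a₁ + a₂).sum - (b₁ + b₂).sum = u + v := by
          rw [Multiset.sum_add, Multiset.sum_add, hu_def, hv_def]; abel
        have e2 : ((a₁ + a₂).map f).sum - ((b₁ + b₂).map f).sum - f (u + v) =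
            Du + Dv + (f u + f v - f (u + v)) := by
          rw [Multiset.map_add, Multiset.map_add, Multiset.sum_add, Multiset.sum_add, hDu, hDv]
          ring
        rw [e1, e2]
        exact h8
      · refine ⟨a₁ + b₂, b₁ + a₂, by abel, ?_⟩
        have e1 : (a₁ + b₂).sum - (b₁ + a₂).sum = u - v := by
          rw [Multiset.sum_add, Multiset.sum_add, hu_def, hv_def]; abel
        have e2 : ((a₁ + b₂).map f).sum - ((b₁ + a₂).map f).sum - f (u - v) =
            Du - Dv + (f u - f v - f (u - v)) := by
          rw [Multiset.map_add, Multiset.map_add, Multiset.sum_add, Multiset.sum_add, hDu, hDv]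
          ring
        rw [e1, e2]
        linarith
  intro k s hs hs1
  obtain ⟨a, b, hab, h⟩ := key k s hs hs1
  have hpow : (2 * c₁) ^ k = (σ ^ k) ^ q := by
    rw [← hσq, ← Real.rpow_natCast, ← Real.rpow_natCast, ← Real.rpow_mul hσ0.le,
      ← Real.rpow_mul hσ0.le, mul_comm]
  refine ⟨a, b, hab, ?_, ?_⟩
  · rw [← Real.rpow_le_rpow_iff (norm_nonneg _) (by positivity) hq0, ← hpow]
    refine le_trans ?_ h
    have : 0 ≤ l * |(a.map f).sum - (b.map f).sum - f (a.sum - b.sum)| ^ q := by positivity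
    linarith
  · rw [← Real.rpow_le_rpow_iff (abs_nonneg _) (by positivity) hq0,
      Real.mul_rpow (by positivity) (by positivity), ← hpow, ← Real.rpow_mul (by positivity),
      inv_mul_cancel₀ hq0.ne', Real.rpow_one, le_inv_mul_iff₀ hl0]
    refine le_trans ?_ h
    have : 0 ≤ ‖a.sum - b.sum‖ ^ q := by positivity
    linarith

/-- A quasilinear function is nearly additive on families of vectors whose sum is small. In the
inductive step half of the family is replaced, thanks to the choice of signs, by a multiple of the
sum of the other half. -/
theorem exists_abs_sum_sub_le {q c : ℝ} (hq : 1 ≤ q) (hc : 0 < c) (hcq : 2 * c < 2 ^ q)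
    (hX : HasTwoPointBound X q c) (hR : HasTwoPointBound ℝ q c) :
    ∃ K : ℝ, 0 ≤ K ∧ ∀ f : X → ℝ, (∀ (r : ℝ) x, f (r • x) = r * f x) →
      (∀ x y, |f (x + y) - f x - f y| ≤ ‖x‖ + ‖y‖) →
      ∀ (k : ℕ) (s : Multiset X), s.card ≤ 2 ^ k → (∀ x ∈ s, ‖x‖ ≤ 1) → s.sum = 0 →
        |(s.map f).sum| ≤ K * 2 ^ k := by
  obtain ⟨σ, C, hσ0, hσ2, hC, H⟩ := exists_signs hq hc hcq hX hR
  have h2σ : 0 < 2 - σ := by linarith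
  -- `R` solves `(R + 1) * σ / 2 = R`
  set R : ℝ := σ / (2 - σ) with hR_def
  have hR0 : 0 < R := by positivity
  have hRσ : (R + 1) * σ = 2 * R := by rw [hR_def]; field_simp; ring
  set K : ℝ := (C + R + 1) * σ / (2 - σ) with hK
  have hK0 : 0 ≤ K := by positivity
  have hKσ : (C + R + 1) * σ = 2 * K - K * σ := by rw [hK]; field_simp
  refine ⟨K, hK0, fun f hf hfq => ?_⟩
  have hf0 : f 0 = 0 := by simpa using hf 0 0
  have hneg : ∀ x, f (-x) = -f x := fun x => by simpa using hf (-1) x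
  have key : ∀ (k : ℕ) (s : Multiset X), s.card ≤ 2 ^ k → (∀ x ∈ s, ‖x‖ ≤ 1) →
      ‖s.sum‖ ≤ R * σ ^ k → |(s.map f).sum - f s.sum| ≤ K * 2 ^ k - K * σ ^ k := by
    intro k
    induction k with
    | zero =>
      intro s hs _ _
      rw [pow_zero, Nat.le_one_iff_eq_zero_or_eq_one, Multiset.card_eq_zero,
        Multiset.card_eq_one] at hs
      rcases hs with rfl | ⟨x, rfl⟩ <;> simp [hf0]
    | succ k ih =>
      intro s hs hs1 hsum
      have hsplit : ∃ a b : Multiset X, s = a + b ∧ a.card ≤ 2 ^ k ∧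
          ‖a.sum - b.sum‖ ≤ σ ^ (k + 1) ∧
          |(a.map f).sum - (b.map f).sum - f (a.sum - b.sum)| ≤ C * σ ^ (k + 1) := by
        obtain ⟨a, b, rfl, h1, h2⟩ := H f hf hfq (k + 1) s hs hs1
        rw [Multiset.card_add, pow_succ] at hs
        rcases le_or_gt a.card (2 ^ k) with ha | ha
        · exact ⟨a, b, rfl, ha, h1, h2⟩
        · refine ⟨b, a, add_comm _ _, by omega, by rwa [norm_sub_rev], ?_⟩
          rw [← neg_sub a.sum b.sum, hneg, ← abs_neg]
          refine le_trans (le_of_eq ?_) h2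
          congr 1; ring
      obtain ⟨a, b, rfl, ha, hw, hD⟩ := hsplit
      set S := (a + b).sum with hS
      set w := a.sum - b.sum with hw_def
      have h2a : (2 : ℝ) • a.sum = S + w := by
        rw [hS, hw_def, Multiset.sum_add, two_smul]; abel
      have hfa : 2 * f a.sum = f (S + w) := by rw [← h2a, hf]
      have hna : ‖a.sum‖ ≤ R * σ ^ k := by
        have h3 : 2 * ‖a.sum‖ = ‖S + w‖ := by rw [← h2a, norm_smul]; simp
        have h4 : ‖S + w‖ ≤ R * σ ^ (k + 1) + σ ^ (k + 1) :=
          (norm_add_le _ _).trans (add_le_add hsum hw)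
        have h5 : R * σ ^ (k + 1) + σ ^ (k + 1) = 2 * (R * σ ^ k) := by
          calc _ = (R + 1) * σ * σ ^ k := by ring
            _ = _ := by rw [hRσ]; ring
        linarith
      have hih := ih a ha (fun x hx => hs1 x (Multiset.mem_add.2 (Or.inl hx))) hna
      have hq1 : |f (S + w) - f S - f w| ≤ R * σ ^ (k + 1) + σ ^ (k + 1) :=
        (hfq S w).trans (add_le_add hsum hw)
      have e : ((a + b).map f).sum - f S = 2 * ((a.map f).sum - f a.sum)
          + (f (S + w) - f S - f w) - ((a.map f).sum - (b.map f).sum - f w) := by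
        rw [Multiset.map_add, Multiset.sum_add, ← hfa]; ring
      have hfin : 2 * (K * 2 ^ k - K * σ ^ k) + (R * σ ^ (k + 1) + σ ^ (k + 1)) + C * σ ^ (k + 1)
          = K * 2 ^ (k + 1) - K * σ ^ (k + 1) := by
        calc _ = 2 * (K * 2 ^ k - K * σ ^ k) + (C + R + 1) * σ * σ ^ k := by ring
          _ = _ := by rw [hKσ]; ring
      rw [abs_le] at hih hq1 hD ⊢
      rw [e, ← hfin]
      constructor <;> linarith [hih.1, hih.2, hq1.1, hq1.2, hD.1, hD.2]
  intro k s hs hs1 hsum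
  have h1 := key k s hs hs1 (by rw [hsum, norm_zero]; positivity)
  rw [hsum, hf0, sub_zero] at h1
  have : 0 ≤ K * σ ^ k := by positivity
  linarith

/-- The families need not consist of unit vectors: vectors are multiplied by a large integer and cut
into pieces of norm at most `1`. -/
theorem exists_abs_sum_le_mul_sum_norm {q c : ℝ} (hq : 1 ≤ q) (hc : 0 < c) (hcq : 2 * c < 2 ^ q)
    (hX : HasTwoPointBound X q c) (hR : HasTwoPointBound ℝ q c) :
    ∃ K : ℝ, 0 ≤ K ∧ ∀ f : X → ℝ, (∀ (r : ℝ) x, f (r • x) = r * f x) →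
      (∀ x y, |f (x + y) - f x - f y| ≤ ‖x‖ + ‖y‖) →
      ∀ s : Multiset X, s.sum = 0 → |(s.map f).sum| ≤ K * (s.map norm).sum := by
  obtain ⟨K, hK, H⟩ := exists_abs_sum_sub_le hq hc hcq hX hR
  refine ⟨2 * K, by positivity, fun f hf hfq s hs => ?_⟩
  have key : ∀ N : ℕ, 0 < N → N * |(s.map f).sum| ≤
      2 * K * (N * (s.map norm).sum + s.card + 1) := by
    intro N hN
    -- cut `N` times every vector into equal pieces of norm at most `1`
    let n : X → ℕ := fun x => ⌊N * ‖x‖⌋₊ + 1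
    let t : Multiset X := s.bind fun x => Multiset.replicate (n x) (((N : ℝ) / n x) • x)
    have hn0 : ∀ x, (0 : ℝ) < n x := fun x => by positivity
    have hnle : ∀ x, (n x : ℝ) ≤ N * ‖x‖ + 1 := fun x => by
      have := Nat.floor_le (a := N * ‖x‖) (by positivity)
      simp only [n]; push_cast; linarith
    have ht1 : ∀ y ∈ t, ‖y‖ ≤ 1 := by
      intro y hy
      obtain ⟨x, _, hx⟩ := Multiset.mem_bind.1 hy
      rw [Multiset.eq_of_mem_replicate hx, norm_smul, Real.norm_of_nonneg (by positivity),
        div_mul_eq_mul_div, div_le_one (hn0 x)]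
      have := Nat.lt_floor_add_one (N * ‖x‖ : ℝ)
      simp only [n]; push_cast; exact this.le
    have hsum : t.sum = 0 := by
      have : ∀ x, (Multiset.replicate (n x) (((N : ℝ) / n x) • x)).sum = (N : ℝ) • x := fun x => by
        rw [Multiset.sum_replicate, ← Nat.cast_smul_eq_nsmul ℝ, smul_smul,
          mul_div_cancel₀ _ (hn0 x).ne']
      simp only [t, Multiset.sum_bind, this]
      rw [← Multiset.smul_sum, hs, smul_zero]
    have hfsum : (t.map f).sum = N * (s.map f).sum := by
      have : ∀ x, ((Multiset.replicate (n x) (((N : ℝ) / n x) • x)).map f).sum = N * f x :=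
        fun x => by
          rw [Multiset.map_replicate, Multiset.sum_replicate, hf, nsmul_eq_mul, ← mul_assoc,
            mul_div_cancel₀ _ (hn0 x).ne']
      simp only [t, Multiset.map_bind, Multiset.sum_bind, this]
      rw [Multiset.sum_map_mul_left]
    have hcard : (t.card : ℝ) ≤ N * (s.map norm).sum + s.card := by
      have h1 : (t.card : ℝ) = (s.map fun x => (n x : ℝ)).sum := by
        simp only [t, Multiset.card_bind, Function.comp_def, Multiset.card_replicate]
        rw [← Nat.coe_castRingHom, map_multiset_sum, Multiset.map_map]
        rfl
      have h2 : (s.map fun x => (n x : ℝ)).sum ≤ (s.map fun x => N * ‖x‖ + 1).sum :=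
        Multiset.sum_map_le_sum_map _ _ fun x _ => hnle x
      rw [h1]
      refine h2.trans (le_of_eq ?_)
      rw [Multiset.sum_map_add, Multiset.sum_map_mul_left]
      simp
    have h1 := H f hf hfq (Nat.log 2 (t.card + 1) + 1) t
      (by have := Nat.lt_pow_succ_log_self (b := 2) (by norm_num) (t.card + 1); omega) ht1 hsum
    have h2 : (2 : ℝ) ^ (Nat.log 2 (t.card + 1) + 1) ≤ 2 * (t.card + 1) := by
      have := Nat.pow_log_le_self 2 (x := t.card + 1) (by omega)
      rw [pow_succ, mul_comm]
      have h3 : ((2 ^ Nat.log 2 (t.card + 1) : ℕ) : ℝ) ≤ ((t.card + 1 : ℕ) : ℝ) := by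
        exact_mod_cast this
      push_cast at h3
      linarith
    rw [hfsum, abs_mul, Nat.abs_cast] at h1
    calc _ ≤ _ := h1
      _ ≤ K * (2 * (t.card + 1)) := by gcongr
      _ ≤ K * (2 * (N * (s.map norm).sum + s.card + 1)) := by gcongr
      _ = _ := by ring
  have hlim : Filter.Tendsto (fun N : ℕ => 2 * K * (s.map norm).sum
      + 2 * K * (s.card + 1) / (N : ℝ)) Filter.atTop
      (𝓝 (2 * K * (s.map norm).sum + 0)) :=
    tendsto_const_nhds.add (tendsto_const_div_atTop_nhds_zero_nat _)
  rw [add_zero] at hlim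
  refine ge_of_tendsto hlim ?_
  filter_upwards [Filter.eventually_gt_atTop 0] with N hN
  have hN' : (0 : ℝ) < N := by exact_mod_cast hN
  rw [← mul_le_mul_iff_right₀ hN']
  refine (key N hN).trans (le_of_eq ?_)
  field_simp
  ring

/-- Real quasilinear functions on a space with a nontrivial two-point bound are at finite distance
from linear ones. The Hahn–Banach theorem provides a linear minorant of the convex envelope
`x ↦ ⨅ ∑ f (x i) + K ‖x i‖` over the representations `x = ∑ x i`. -/
theorem exists_linear_approx_real {q c : ℝ} (hq : 1 ≤ q) (hc : 0 < c) (hcq : 2 * c < 2 ^ q)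
    (hX : HasTwoPointBound X q c) (hR : HasTwoPointBound ℝ q c) :
    ∃ K : ℝ, 0 ≤ K ∧ ∀ f : X → ℝ, (∀ (r : ℝ) x, f (r • x) = r * f x) →
      (∀ x y, |f (x + y) - f x - f y| ≤ ‖x‖ + ‖y‖) →
      ∃ g : X →ₗ[ℝ] ℝ, ∀ x, |f x - g x| ≤ K * ‖x‖ := by
  obtain ⟨K, hK, H⟩ := exists_abs_sum_le_mul_sum_norm hq hc hcq hX hR
  refine ⟨K, hK, fun f hf hfq => ?_⟩
  have hneg : ∀ x, f (-x) = -f x := fun x => by simpa using hf (-1) x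
  let φ : Multiset X → ℝ := fun s => (s.map f).sum + K * (s.map norm).sum
  have hφadd : ∀ s t, φ (s + t) = φ s + φ t := fun s t => by
    simp only [φ, Multiset.map_add, Multiset.sum_add]; ring
  have hφsmul : ∀ (r : ℝ), 0 ≤ r → ∀ s, φ (s.map (r • ·)) = r * φ s := fun r hr s => by
    have h1 : (f ∘ fun x => r • x) = fun x => r * f x := funext fun x => hf r x
    have h2 : (norm ∘ fun x : X => r • x) = fun x => r * ‖x‖ := funext fun x => by
      simp [norm_smul, abs_of_nonneg hr]
    simp only [φ, Multiset.map_map, h1, h2, Multiset.sum_map_mul_left]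
    ring
  have hlow : ∀ x, ∀ s : Multiset X, s.sum = x → f x - K * ‖x‖ ≤ φ s := by
    intro x s hs
    have h1 := H f hf hfq (s + {-x}) (by simp [hs])
    simp only [Multiset.map_add, Multiset.sum_add, Multiset.map_singleton,
      Multiset.sum_singleton, hneg, norm_neg] at h1
    have h2 := (abs_le.1 h1).1
    simp only [φ]
    linarith
  let p : X → ℝ := fun x => sInf (φ '' {s | s.sum = x})
  have hbdd : ∀ x, BddBelow (φ '' {s | s.sum = x}) := fun x =>
    ⟨f x - K * ‖x‖, by rintro _ ⟨s, hs, rfl⟩; exact hlow x s hs⟩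
  have hne : ∀ x, (φ '' {s | s.sum = x}).Nonempty := fun x =>
    ⟨_, {x}, Multiset.sum_singleton x, rfl⟩
  have hple : ∀ s, p s.sum ≤ φ s := fun s => csInf_le (hbdd _) ⟨s, rfl, rfl⟩
  have hsmul : ∀ r : ℝ, 0 < r → ∀ x, p (r • x) ≤ r * p x := by
    intro r hr x
    rw [← inv_mul_le_iff₀ hr]
    refine le_csInf (hne x) ?_
    rintro _ ⟨s, rfl, rfl⟩
    rw [inv_mul_le_iff₀ hr, ← hφsmul r hr.le]
    refine le_trans (le_of_eq ?_) (hple _)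
    rw [← Multiset.smul_sum]
  obtain ⟨g, -, hg⟩ := exists_extension_of_le_sublinear (⊥ : X →ₗ.[ℝ] ℝ) p
    (fun r hr x => le_antisymm (hsmul r hr x) (by
      have h1 := hsmul r⁻¹ (inv_pos.2 hr) (r • x)
      rwa [inv_smul_smul₀ hr.ne', le_inv_mul_iff₀ hr] at h1))
    (fun x y => by
      rw [← sub_le_iff_le_add]
      refine le_csInf (hne x) ?_
      rintro _ ⟨s, rfl, rfl⟩
      rw [sub_le_iff_le_add, ← sub_le_iff_le_add']
      refine le_csInf (hne y) ?_
      rintro _ ⟨t, rfl, rfl⟩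
      rw [sub_le_iff_le_add', ← hφadd, ← Multiset.sum_add]
      exact hple _)
    (by
      rintro ⟨x, hx⟩
      have hx0 : x = 0 := (Submodule.mem_bot ℝ).1 hx
      subst hx0
      have h1 : (⊥ : X →ₗ.[ℝ] ℝ) ⟨0, hx⟩ = 0 := LinearPMap.map_zero _
      rw [h1]
      refine le_csInf (hne 0) ?_
      rintro _ ⟨s, hs, rfl⟩
      have hf0 : f 0 = 0 := by simpa using hf 0 0
      simpa [hf0] using hlow 0 s hs)
  have hup : ∀ x, g x ≤ f x + K * ‖x‖ := fun x => (hg x).trans (by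
    have := hple {x}
    simpa [φ] using this)
  refine ⟨g, fun x => abs_le.2 ⟨?_, ?_⟩⟩
  · linarith [hup x]
  · have := hup (-x)
    rw [map_neg, hneg, norm_neg] at this
    linarith

/-- The complex case follows from the real one for the real part, since linear functionals are
determined by their real parts. -/
theorem exists_linear_approx (𝕜 : Type w) [RCLike 𝕜] {X : Type u} [NormedAddCommGroup X]
    [NormedSpace 𝕜 X] {q c : ℝ} (hq : 1 ≤ q) (hc : 0 < c) (hcq : 2 * c < 2 ^ q)
    (hX : HasTwoPointBound X q c) (hR : HasTwoPointBound ℝ q c) :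
    ∃ K : ℝ, 0 ≤ K ∧ ∀ (Q : ℝ), 0 < Q → ∀ f : X → 𝕜, IsHomogeneous 𝕜 f → IsQuasiBound f Q →
      ∃ g : X →ₗ[𝕜] 𝕜, ∀ x, ‖f x - g x‖ ≤ K * Q * ‖x‖ := by
  let _ : NormedSpace ℝ X := NormedSpace.restrictScalars ℝ 𝕜 X
  have : IsScalarTower ℝ 𝕜 X := RestrictScalars.isScalarTower ℝ 𝕜 X
  obtain ⟨K, hK, H⟩ := exists_linear_approx_real hq hc hcq hX hR
  refine ⟨K, hK, fun Q hQ f hf hfQ => ?_⟩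
  have hsm : ∀ (r : ℝ) (x : X), r • x = (r : 𝕜) • x := fun r x =>
    (algebraMap_smul 𝕜 r x).symm
  obtain ⟨g, hg⟩ := H (fun x => Q⁻¹ * RCLike.re (f x))
    (fun r x => by
      rw [hsm, hf, smul_eq_mul, RCLike.re_ofReal_mul]; ring)
    (fun x y => by
      rw [← mul_sub, ← mul_sub, abs_mul, abs_of_pos (inv_pos.2 hQ), inv_mul_le_iff₀ hQ,
        ← map_sub, ← map_sub]
      exact (RCLike.abs_re_le_norm _).trans (hfQ x y))
  have hre : ∀ x, |RCLike.re (f x - Module.Dual.extendRCLike (𝕜 := 𝕜) (Q • g) x)| ≤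
      K * Q * ‖x‖ := fun x => by
    rw [map_sub, Module.Dual.re_extendRCLike_apply, LinearMap.smul_apply, smul_eq_mul]
    have e : RCLike.re (f x) - Q * g x = Q * (Q⁻¹ * RCLike.re (f x) - g x) := by
      field_simp
    rw [e, abs_mul, abs_of_pos hQ]
    calc _ ≤ Q * (K * ‖x‖) := by gcongr; exact hg x
      _ = _ := by ring
  refine ⟨Module.Dual.extendRCLike (𝕜 := 𝕜) (Q • g), fun x => ?_⟩
  -- rotate `x` so that the difference becomes real
  obtain ⟨a, ha, hax⟩ := RCLike.exists_norm_eq_mul_self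
    (f x - Module.Dual.extendRCLike (𝕜 := 𝕜) (Q • g) x)
  have h1 := hre (a • x)
  rw [hf, map_smul, ← smul_sub, smul_eq_mul, ← hax, RCLike.ofReal_re, abs_of_nonneg (norm_nonneg _),
    norm_smul, ha, one_mul] at h1
  exact h1

end ScalarMaps

/-! ### The spaces `ℓ_p(I)` and `c₀`: finiteness of `K₀` -/

section Sequences

variable {𝕜 : Type w} [RCLike 𝕜]

/-- By the parallelogram law, `‖a + b‖ ^ 2` and `‖a - b‖ ^ 2` have sum `2 * (‖a‖ ^ 2 + ‖b‖ ^ 2)`;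
the rest is concavity or convexity of `t ↦ t ^ (q / 2)`. -/
theorem HasTwoPointBound.rclike {q : ℝ} (hq : 0 ≤ q) :
    HasTwoPointBound 𝕜 q (max 1 (2 ^ (q - 2))) := by
  intro a b
  set A := ‖a‖ ^ 2 with hA
  set B := ‖b‖ ^ 2 with hB
  set s := ‖a + b‖ ^ 2 with hs
  set t := ‖a - b‖ ^ 2 with ht
  have hA0 : 0 ≤ A := by positivity
  have hB0 : 0 ≤ B := by positivity
  have hs0 : 0 ≤ s := by positivity
  have ht0 : 0 ≤ t := by positivity
  have hpar : s + t = 2 * (A + B) := parallelogram_law_with_norm 𝕜 a b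
  have hpow : ∀ z : 𝕜, ‖z‖ ^ q = (‖z‖ ^ 2) ^ (q / 2) := fun z => by
    rw [← Real.rpow_natCast, ← Real.rpow_mul (norm_nonneg z)]
    congr 1
    push_cast; ring
  rw [hpow, hpow, hpow, hpow, ← hA, ← hB, ← hs, ← ht]
  have hAB : 0 ≤ A ^ (q / 2) + B ^ (q / 2) := by positivity
  rcases le_total (q / 2) 1 with h | h
  · have h1 : s ^ (q / 2) + t ^ (q / 2) ≤ 2 * (A + B) ^ (q / 2) := by
      have hcv := (Real.concaveOn_rpow (by positivity) h).2
      have := @hcv s hs0 t ht0 (1 / 2) (1 / 2) (by norm_num) (by norm_num) (by norm_num)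
      simp only [smul_eq_mul] at this
      rw [← mul_add, ← mul_add, hpar, show 1 / 2 * (2 * (A + B)) = A + B by ring] at this
      linarith
    calc _ ≤ 2 * (A + B) ^ (q / 2) := h1
      _ ≤ 2 * (A ^ (q / 2) + B ^ (q / 2)) := by
        gcongr
        exact Real.rpow_add_le_add_rpow hA0 hB0 (by positivity) h
      _ = 2 * 1 * (A ^ (q / 2) + B ^ (q / 2)) := by ring
      _ ≤ _ := by gcongr; exact le_max_left _ _
  · have h1 : s ^ (q / 2) + t ^ (q / 2) ≤ (2 * (A + B)) ^ (q / 2) := by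
      rw [← hpar]; exact Real.add_rpow_le_rpow_add hs0 ht0 h
    have h2 : (1 / 2 * A + 1 / 2 * B) ^ (q / 2) ≤ 1 / 2 * A ^ (q / 2) + 1 / 2 * B ^ (q / 2) := by
      have hcv := (convexOn_rpow h).2
      have := @hcv A hA0 B hB0 (1 / 2) (1 / 2) (by norm_num) (by norm_num) (by norm_num)
      simpa only [smul_eq_mul] using this
    have h3 : (2 * (A + B)) ^ (q / 2) = 4 ^ (q / 2) * (1 / 2 * A + 1 / 2 * B) ^ (q / 2) := by
      rw [← Real.mul_rpow (by norm_num) (by positivity)]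
      congr 1; ring
    have h4 : (4 : ℝ) ^ (q / 2) = 4 * 2 ^ (q - 2) := by
      rw [show (4 : ℝ) = 2 ^ (2 : ℝ) by norm_num, ← Real.rpow_mul (by norm_num),
        ← Real.rpow_add (by norm_num)]
      congr 1; ring
    calc _ ≤ (2 * (A + B)) ^ (q / 2) := h1
      _ ≤ 4 ^ (q / 2) * (1 / 2 * A ^ (q / 2) + 1 / 2 * B ^ (q / 2)) := by
        rw [h3]; gcongr
      _ = 2 * 2 ^ (q - 2) * (A ^ (q / 2) + B ^ (q / 2)) := by rw [h4]; ring
      _ ≤ _ := by gcongr; exact le_max_right _ _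

theorem two_mul_max_lt_two_rpow {q : ℝ} (hq : 1 < q) : 2 * max 1 ((2 : ℝ) ^ (q - 2)) < 2 ^ q := by
  rw [mul_max_of_nonneg _ _ (by norm_num)]
  refine max_lt ?_ ?_
  · calc (2 : ℝ) * 1 = 2 ^ (1 : ℝ) := by norm_num
      _ < 2 ^ q := Real.rpow_lt_rpow_of_exponent_lt (by norm_num) hq
  · calc (2 : ℝ) * 2 ^ (q - 2) = 2 ^ (1 + (q - 2)) := by
          rw [Real.rpow_add (by norm_num), Real.rpow_one]
      _ < 2 ^ q := Real.rpow_lt_rpow_of_exponent_lt (by norm_num) (by linarith)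

variable {I : Type u} {p : ℝ≥0∞} [Fact (1 ≤ p)]

theorem HasTwoPointBound.lp {c : ℝ} (hp : 0 < p.toReal) (h : HasTwoPointBound 𝕜 p.toReal c) :
    HasTwoPointBound (lp (fun _ : I => 𝕜) p) p.toReal c := fun x y =>
  hasSum_le (fun i => h (x i) (y i))
    ((lp.hasSum_norm hp (x + y)).add (lp.hasSum_norm hp (x - y)))
    (((lp.hasSum_norm hp x).add (lp.hasSum_norm hp y)).mul_left _)

variable [DecidableEq I]

/-- The projection of `ℓ_p(I)` onto the coordinates in a finite set. -/
noncomputable def coordProj (A : Finset I) : lp (fun _ : I => 𝕜) p →ₗ[𝕜] lp (fun _ : I => 𝕜) p where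
  toFun x := ∑ i ∈ A, lp.single p i (x i)
  map_add' x y := by
    simp only [lp.coeFn_add, Pi.add_apply, lp.single_add, Finset.sum_add_distrib]
  map_smul' c x := by
    simp only [lp.coeFn_smul, Pi.smul_apply, lp.single_smul, Finset.smul_sum, RingHom.id_apply]

theorem coordProj_apply (A : Finset I) (x : lp (fun _ : I => 𝕜) p) :
    coordProj A x = ∑ i ∈ A, lp.single p i (x i) := rfl

theorem norm_coordProj_le (hp : 0 < p.toReal) (A : Finset I) (x : lp (fun _ : I => 𝕜) p) :
    ‖coordProj A x‖ ≤ ‖x‖ := by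
  rw [← Real.rpow_le_rpow_iff (norm_nonneg _) (norm_nonneg _) hp, coordProj_apply,
    lp.norm_sum_single hp]
  exact lp.sum_rpow_le_norm_rpow hp x A

/-- A bounded functional on `ℓ_p(I)`, `1 < p < ∞`, is small on most of the unit vectors. -/
theorem finite_le_norm_apply_single (hp1 : 1 < p) (hp : p < ⊤) {M : ℝ}
    (g : lp (fun _ : I => 𝕜) p →ₗ[𝕜] 𝕜) (hg : ∀ x, ‖g x‖ ≤ M * ‖x‖) {ε : ℝ} (hε : 0 < ε) :
    {i | ε ≤ ‖g (lp.single p i 1)‖}.Finite := by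
  have hq1 : 1 < p.toReal := by
    rw [← ENNReal.toReal_one]
    exact (ENNReal.toReal_lt_toReal ENNReal.one_ne_top hp.ne).2 hp1
  have hq0 : 0 < p.toReal := by linarith
  by_contra hinf
  have hlim : Filter.Tendsto (fun k : ℕ => (k : ℝ) ^ (p.toReal - 1)) Filter.atTop Filter.atTop :=
    (tendsto_rpow_atTop (by linarith)).comp tendsto_natCast_atTop_atTop
  obtain ⟨k, hk, hk0⟩ := ((hlim.eventually_gt_atTop ((M / ε) ^ p.toReal)).and
    (Filter.eventually_gt_atTop 0)).exists
  have hk0' : (0 : ℝ) < k := by exact_mod_cast hk0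
  obtain ⟨s, hs, hsk⟩ := Set.Infinite.exists_subset_card_eq hinf k
  choose a ha hax using fun i => RCLike.exists_norm_eq_mul_self (g (lp.single p i (1 : 𝕜)))
  set x : lp (fun _ : I => 𝕜) p := ∑ i ∈ s, lp.single p i (a i) with hx
  have hnx : ‖x‖ ^ p.toReal = k := by
    rw [hx, lp.norm_sum_single hq0]
    simp [ha, hsk]
  have hgx : g x = ((∑ i ∈ s, ‖g (lp.single p i (1 : 𝕜))‖ : ℝ) : 𝕜) := by
    rw [hx, map_sum, RCLike.ofReal_sum]
    refine Finset.sum_congr rfl fun i _ => ?_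
    rw [hax, ← smul_eq_mul, ← map_smul, ← lp.single_smul, smul_eq_mul, mul_one]
  have hgx' : k * ε ≤ ‖g x‖ := by
    rw [hgx, RCLike.norm_ofReal]
    refine le_trans ?_ (le_abs_self _)
    rw [← hsk, ← nsmul_eq_mul]
    exact Finset.card_nsmul_le_sum _ _ _ fun i hi => hs hi
  have h1 : k * ε ≤ M * ‖x‖ := hgx'.trans (hg x)
  have hx0 : 0 < ‖x‖ := by
    refine (norm_nonneg x).lt_of_ne fun h => ?_
    rw [← h, Real.zero_rpow hq0.ne'] at hnx
    linarith
  have hM0 : 0 < M := by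
    by_contra hM
    have : M * ‖x‖ ≤ 0 := mul_nonpos_of_nonpos_of_nonneg (not_lt.1 hM) hx0.le
    have : 0 < k * ε := by positivity
    linarith
  have h2 : (k : ℝ) ≤ M / ε * ‖x‖ := by
    rw [div_mul_eq_mul_div, le_div_iff₀ hε]; exact h1
  have h3 : (k : ℝ) ^ p.toReal ≤ (M / ε) ^ p.toReal * k := by
    calc (k : ℝ) ^ p.toReal ≤ (M / ε * ‖x‖) ^ p.toReal := by gcongr
      _ = _ := by rw [Real.mul_rpow (by positivity) (norm_nonneg _), hnx]
  have h4 : (k : ℝ) ^ p.toReal = (k : ℝ) ^ (p.toReal - 1) * k := by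
    rw [Real.rpow_sub_one hk0'.ne']; field_simp
  rw [h4] at h3
  exact absurd (le_of_mul_le_mul_right h3 hk0') (not_le.2 hk)

theorem countable_apply_single_ne_zero (hp1 : 1 < p) (hp : p < ⊤) {M : ℝ}
    (g : lp (fun _ : I => 𝕜) p →ₗ[𝕜] 𝕜) (hg : ∀ x, ‖g x‖ ≤ M * ‖x‖) :
    {i | g (lp.single p i 1) ≠ 0}.Countable := by
  refine (Set.countable_iUnion fun n : ℕ => (finite_le_norm_apply_single hp1 hp g hg
    (ε := 1 / (n + 1)) (by positivity)).countable).mono fun i hi => ?_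
  obtain ⟨n, hn⟩ := exists_nat_one_div_lt (norm_pos_iff.2 hi)
  exact Set.mem_iUnion.2 ⟨n, hn.le⟩

theorem ZeroAtInftyContinuousMap.tendsto_atTop (f : C₀(ℕ, 𝕜)) :
    Filter.Tendsto f Filter.atTop (𝓝 0) := by
  have := f.zero_at_infty'
  rw [Filter.cocompact_eq_cofinite, Nat.cofinite_eq_atTop] at this
  exact this

theorem ZeroAtInftyContinuousMap.norm_apply_le (f : C₀(ℕ, 𝕜)) (n : ℕ) : ‖f n‖ ≤ ‖f‖ := by
  rw [← ZeroAtInftyContinuousMap.norm_toBCF_eq_norm]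
  exact f.toBCF.norm_coe_le_norm n

theorem ZeroAtInftyContinuousMap.norm_le {f : C₀(ℕ, 𝕜)} {c : ℝ} (hc : 0 ≤ c)
    (h : ∀ n, ‖f n‖ ≤ c) : ‖f‖ ≤ c := by
  rw [← ZeroAtInftyContinuousMap.norm_toBCF_eq_norm]
  exact (BoundedContinuousFunction.norm_le hc).2 h

/-- The sequence in `c₀` with given coordinates. -/
def ZeroAtInftyContinuousMap.ofTendsto (f : ℕ → 𝕜) (hf : Filter.Tendsto f Filter.atTop (𝓝 0)) :
    C₀(ℕ, 𝕜) :=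
  ⟨⟨f, continuous_of_discreteTopology⟩, by
    rw [Filter.cocompact_eq_cofinite, Nat.cofinite_eq_atTop]; exact hf⟩

/-- A diagonal sequence along which eventual properties hold. -/
theorem exists_tendsto_of_eventually {P : ℕ → ℕ → Prop} (h0 : ∀ n, P 0 n)
    (h : ∀ m, ∀ᶠ n in Filter.atTop, P m n) :
    ∃ m : ℕ → ℕ, Filter.Tendsto m Filter.atTop Filter.atTop ∧ ∀ n, P (m n) n := by
  classical
  refine ⟨fun n => Nat.findGreatest (fun m => P m n) n, ?_, fun n =>
    Nat.findGreatest_spec (P := fun m => P m n) (Nat.zero_le n) (h0 n)⟩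
  refine Filter.tendsto_atTop.2 fun m => ?_
  filter_upwards [h m, Filter.eventually_ge_atTop m] with n hn hmn
  exact Nat.le_findGreatest hmn hn

/-- If functionals `g n` stay within `κ` of functions `f n` tending pointwise to zero, then on each
finite-dimensional coordinate subspace they have eventually norm at most `2 * κ`. -/
theorem eventually_norm_coordProj_le (hp : 0 < p.toReal) {M κ : ℝ} (hκ : 0 < κ) (hM : 0 ≤ M)
    (f : ℕ → lp (fun _ : I => 𝕜) p → 𝕜) (g : ℕ → lp (fun _ : I => 𝕜) p →ₗ[𝕜] 𝕜)
    (hg : ∀ n x, ‖g n x‖ ≤ M * ‖x‖) (hfg : ∀ n x, ‖f n x - g n x‖ ≤ κ * ‖x‖)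
    (hf : ∀ x, Filter.Tendsto (fun n => f n x) Filter.atTop (𝓝 0)) (A : Finset I) :
    ∀ᶠ n in Filter.atTop, ∀ x, ‖g n (coordProj A x)‖ ≤ 2 * κ * ‖x‖ := by
  set S : Set (lp (fun _ : I => 𝕜) p) := (fun c : I → 𝕜 => ∑ i ∈ A, lp.single p i (c i)) ''
    Set.univ.pi fun _ => Metric.closedBall 0 1 with hS
  have hcomp : IsCompact S := by
    refine (isCompact_univ_pi fun _ => isCompact_closedBall 0 1).image ?_
    refine continuous_finsetSum _ fun i _ => ?_
    exact (lp.isometry_single i).continuous.comp (continuous_apply i)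
  have hmem : ∀ x : lp (fun _ : I => 𝕜) p, ‖x‖ ≤ 1 → coordProj A x ∈ S := fun x hx => by
    refine ⟨x, fun i _ => ?_, rfl⟩
    rw [mem_closedBall_zero_iff]
    exact (lp.norm_apply_le_norm (zero_lt_one.trans_le Fact.out).ne' x i).trans hx
  -- a finite net in a compact set containing the projections of the unit ball
  obtain ⟨t, -, htf, hcov⟩ := finite_cover_balls_of_compact hcomp
    (e := κ / (2 * (M + κ))) (by positivity)
  have hev : ∀ᶠ n in Filter.atTop, ∀ y ∈ t, ‖f n y‖ < κ / 2 := by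
    rw [Filter.eventually_all_finite htf]
    intro y _
    have := (hf y).norm
    rw [norm_zero] at this
    exact this.eventually (gt_mem_nhds (by positivity))
  filter_upwards [hev] with n hn
  have h1 : ∀ x : lp (fun _ : I => 𝕜) p, ‖x‖ ≤ 1 → ‖g n (coordProj A x)‖ ≤ 2 * κ := by
    intro x hx
    obtain ⟨y, hyt, hy⟩ := Set.mem_iUnion₂.1 (hcov (hmem x hx))
    rw [mem_ball_iff_norm] at hy
    have hPx := (norm_coordProj_le hp A x).trans hx
    have hyn : ‖y‖ ≤ 1 + κ / (2 * (M + κ)) := by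
      have : ‖y‖ ≤ ‖coordProj A x‖ + ‖coordProj A x - y‖ := by
        have := norm_sub_le (coordProj A x) (coordProj A x - y)
        rwa [sub_sub_cancel] at this
      linarith
    have e : g n (coordProj A x) = g n (coordProj A x - y) + (f n y - (f n y - g n y)) := by
      rw [map_sub]; ring
    have h2 : (M + κ) * (κ / (2 * (M + κ))) = κ / 2 := by field_simp
    rw [e]
    calc _ ≤ M * (κ / (2 * (M + κ))) + (κ / 2 + κ * (1 + κ / (2 * (M + κ)))) := by
          refine (norm_add_le _ _).trans (add_le_add ((hg n _).trans ?_)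
            ((norm_sub_le _ _).trans (add_le_add (hn y hyt).le ((hfg n y).trans ?_))))
          · gcongr
          · gcongr
      _ = (M + κ) * (κ / (2 * (M + κ))) + κ / 2 + κ := by ring
      _ = 2 * κ := by rw [h2]; ring
  intro x
  rcases eq_or_ne x 0 with rfl | hx
  · simp
  · have hx0 : 0 < ‖x‖ := norm_pos_iff.2 hx
    have h2 := h1 (((‖x‖⁻¹ : ℝ) : 𝕜) • x) (by
      rw [norm_smul, RCLike.norm_ofReal, abs_of_pos (by positivity), inv_mul_cancel₀ hx0.ne'])
    rw [map_smul, map_smul, norm_smul, RCLike.norm_ofReal, abs_of_pos (by positivity),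
      inv_mul_le_iff₀ hx0] at h2
    linarith

/-- Exhaustion of a countable set by finite sets, starting with the empty one. -/
theorem Set.Countable.exists_finset_exhaustion {J : Set I} (hJ : J.Countable) :
    ∃ A : ℕ → Finset I, A 0 = ∅ ∧ Monotone A ∧ ∀ i ∈ J, ∃ m, i ∈ A m := by
  rcases J.eq_empty_or_nonempty with rfl | hne
  · exact ⟨fun _ => ∅, rfl, fun _ _ _ => le_rfl, by simp⟩
  · obtain ⟨e, he⟩ := hJ.exists_eq_range hne
    refine ⟨fun m => (Finset.range m).image e, by simp, fun m n hmn =>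
      Finset.image_subset_image (Finset.range_mono hmn), fun i hi => ?_⟩
    rw [he] at hi
    obtain ⟨k, rfl⟩ := hi
    exact ⟨k + 1, Finset.mem_image_of_mem e (Finset.self_mem_range_succ k)⟩

/-- `g n (x - P x) → 0` when the coordinate projections `P` exhaust the supports of the bounded
functionals `g n`. -/
theorem tendsto_apply_sub_coordProj (hp : p ≠ ⊤) {M : ℝ}
    (hM : 0 ≤ M) (g : ℕ → lp (fun _ : I => 𝕜) p →ₗ[𝕜] 𝕜) (hg : ∀ n x, ‖g n x‖ ≤ M * ‖x‖)
    {A : ℕ → Finset I} (hA : Monotone A)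
    (hAg : ∀ n i, g n (lp.single p i 1) ≠ 0 → ∃ m, i ∈ A m) {m : ℕ → ℕ}
    (hm : Filter.Tendsto m Filter.atTop Filter.atTop) (x : lp (fun _ : I => 𝕜) p) :
    Filter.Tendsto (fun n => g n (x - coordProj (A (m n)) x)) Filter.atTop (𝓝 0) := by
  rw [Metric.tendsto_atTop']
  intro ε hε
  have hsum := lp.hasSum_single hp x
  rw [HasSum, Metric.tendsto_nhds] at hsum
  obtain ⟨S, hS⟩ := Filter.eventually_atTop.1 (hsum (ε / (M + 1)) (by positivity))
  -- eventually the coordinates in `S` that are not removed are annihilated by all the functionals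
  have hev : ∀ᶠ n in Filter.atTop, ∀ i ∈ S, (∃ k, i ∈ A k) → i ∈ A (m n) := by
    rw [Filter.eventually_all_finset]
    intro i _
    by_cases h : ∃ k, i ∈ A k
    · obtain ⟨k, hk⟩ := h
      filter_upwards [hm.eventually_ge_atTop k] with n hn _
      exact hA hn hk
    · exact Filter.Eventually.of_forall fun n h' => absurd h' h
  obtain ⟨N, hN⟩ := Filter.eventually_atTop.1 hev
  refine ⟨N, fun n hn => ?_⟩
  have hN := hN n hn.le
  rw [dist_zero_right]
  have h1 := hS (S ∪ A (m n)) Finset.subset_union_left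
  rw [dist_comm, dist_eq_norm] at h1
  have h2 : g n (coordProj (S ∪ A (m n)) x) = g n (coordProj (A (m n)) x) := by
    rw [coordProj_apply, coordProj_apply, map_sum, map_sum]
    symm
    refine Finset.sum_subset Finset.subset_union_right fun i hi hi' => ?_
    have hiS : i ∈ S := (Finset.mem_union.1 hi).resolve_right hi'
    have h3 : g n (lp.single p i 1) = 0 := by
      by_contra hne
      exact hi' (hN i hiS (hAg n i hne))
    have h4 : lp.single (E := fun _ : I => 𝕜) p i (x i) = x i • lp.single p i (1 : 𝕜) := by
      rw [← lp.single_smul, smul_eq_mul, mul_one]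
    rw [h4, map_smul, h3, smul_zero]
  rw [map_sub, ← h2, ← map_sub]
  calc _ ≤ M * ‖x - coordProj (S ∪ A (m n)) x‖ := hg n _
    _ ≤ M * (ε / (M + 1)) := by gcongr; exact h1.le
    _ < (M + 1) * (ε / (M + 1)) := by gcongr; linarith
    _ = ε := by field_simp

/-- The coordinates of a bounded quasilinear map into `c₀` are within `κ` of functionals `g n`. The
weak* cluster points of `g n` have norm at most `κ`, so that removing from each `g n` a functional
of norm at most `2 * κ` makes the sequence weak* null. -/
theorem K₀_lp_c₀_lt_top (hp1 : 1 < p) (hp : p < ⊤) :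
    K₀ 𝕜 (lp (fun _ : I => 𝕜) p) C₀(ℕ, 𝕜) < ⊤ := by
  have hq1 : 1 < p.toReal := by
    rw [← ENNReal.toReal_one]
    exact (ENNReal.toReal_lt_toReal ENNReal.one_ne_top hp.ne).2 hp1
  have hq0 : 0 < p.toReal := by linarith
  obtain ⟨K, hK, H⟩ := exists_linear_approx 𝕜 (X := lp (fun _ : I => 𝕜) p) hq1.le
    (lt_max_of_lt_left one_pos) (two_mul_max_lt_two_rpow hq1)
    ((HasTwoPointBound.rclike hq0.le).lp hq0) (HasTwoPointBound.rclike hq0.le)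
  refine K₀_lt_top_iff.2 ⟨⟨3 * (K + 1), by positivity⟩, fun F hF hFb c hc hFc => ?_⟩
  obtain ⟨b, hb⟩ := hFb
  have hc' : (0 : ℝ) < c := hc
  have hcoord : ∀ n, ∃ g : lp (fun _ : I => 𝕜) p →ₗ[𝕜] 𝕜, ∀ x,
      ‖F x n - g x‖ ≤ K * c * ‖x‖ := fun n =>
    H c hc' (fun x => F x n) (fun a x => by
      change F (a • x) n = _
      rw [hF.1]; rfl) fun x y =>
      (ZeroAtInftyContinuousMap.norm_apply_le (F (x + y) - F x - F y) n).trans (hFc x y)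
  choose g hg using hcoord
  set κ : ℝ := (K + 1) * c with hκ
  have hκ0 : 0 < κ := by positivity
  have hfg : ∀ n x, ‖F x n - g n x‖ ≤ κ * ‖x‖ := fun n x => (hg n x).trans (by
    rw [hκ]; gcongr; linarith)
  set M : ℝ := b + κ with hM
  have hM0 : 0 ≤ M := by positivity
  have hgM : ∀ n x, ‖g n x‖ ≤ M * ‖x‖ := fun n x => by
    have e : g n x = F x n - (F x n - g n x) := by ring
    rw [e, hM, add_mul]
    exact (norm_sub_le _ _).trans (add_le_add
      ((ZeroAtInftyContinuousMap.norm_apply_le _ n).trans (hb x)) (hfg n x))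
  obtain ⟨A, hA0, hAm, hAJ⟩ := (Set.countable_iUnion fun n =>
    countable_apply_single_ne_zero hp1 hp (g n) (hgM n)).exists_finset_exhaustion
  obtain ⟨m, hm, hmA⟩ := exists_tendsto_of_eventually
    (P := fun m n => ∀ x, ‖g n (coordProj (A m) x)‖ ≤ 2 * κ * ‖x‖)
    (fun n x => by
      rw [hA0, coordProj_apply, Finset.sum_empty, map_zero, norm_zero]; positivity)
    (fun m => eventually_norm_coordProj_le hq0 hκ0 hM0 (fun n x => F x n) g hgM hfg
      (fun x => (F x).tendsto_atTop) (A m))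
  have hlim := tendsto_apply_sub_coordProj hp.ne hM0 g hgM hAm
    (fun n i hi => hAJ i (Set.mem_iUnion.2 ⟨n, hi⟩)) hm
  refine ⟨{ toFun := fun x => ZeroAtInftyContinuousMap.ofTendsto _ (hlim x)
            map_add' := fun x y => ZeroAtInftyContinuousMap.ext fun n => ?_
            map_smul' := fun a x => ZeroAtInftyContinuousMap.ext fun n => ?_ }, fun x => ?_⟩
  · change g n (x + y - coordProj (A (m n)) (x + y)) =
      g n (x - coordProj (A (m n)) x) + g n (y - coordProj (A (m n)) y)
    rw [map_add (coordProj (A (m n))), add_sub_add_comm, map_add]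
  · change g n (a • x - coordProj (A (m n)) (a • x)) = a • g n (x - coordProj (A (m n)) x)
    rw [map_smul (coordProj (A (m n))), ← smul_sub, map_smul]
  · have h0 : 0 ≤ 3 * (K + 1) * c * ‖x‖ := by positivity
    refine ZeroAtInftyContinuousMap.norm_le h0 fun n => ?_
    change ‖F x n - g n (x - coordProj (A (m n)) x)‖ ≤ 3 * (K + 1) * c * ‖x‖
    have e : F x n - g n (x - coordProj (A (m n)) x) =
        (F x n - g n x) + g n (coordProj (A (m n)) x) := by rw [map_sub]; ring
    rw [e]
    calc _ ≤ κ * ‖x‖ + 2 * κ * ‖x‖ := (norm_add_le _ _).trans (add_le_add (hfg n x) (hmA n x))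
      _ = _ := by rw [hκ]; ring

end Sequences

/-! ### Almost disjoint families and a nontrivial extension -/

section AlmostDisjoint

/-- The codes of the finite initial segments of a binary sequence. -/
def branch (b : ℕ → Bool) : Set ℕ :=
  Set.range fun n => Encodable.encode ((List.range n).map b)

theorem infinite_branch (b : ℕ → Bool) : (branch b).Infinite := by
  refine Set.infinite_range_of_injective fun m n h => ?_
  have := congrArg List.length (Encodable.encode_injective h)
  simpa using this

theorem finite_branch_inter {b b' : ℕ → Bool} (h : b ≠ b') : (branch b ∩ branch b').Finite := by
  obtain ⟨k, hk⟩ := Function.ne_iff.1 h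
  refine ((Set.finite_Iic k).image fun n => Encodable.encode ((List.range n).map b)).subset ?_
  rintro _ ⟨⟨n, rfl⟩, ⟨m, hm⟩⟩
  refine ⟨n, Set.mem_Iic.2 (not_lt.1 fun hkn => hk ?_), rfl⟩
  have h1 := Encodable.encode_injective hm
  have h2 : m = n := by simpa using congrArg List.length h1
  subst h2
  exact ((List.map_inj_left.1 h1) k (List.mem_range.2 hkn)).symm

/-- The family may contain empty sets, since `I` may have more elements than `ℕ` has subsets. -/
theorem exists_almostDisjoint (I : Type u) [Uncountable I] :
    ∃ A : I → Set ℕ, (∀ i j, i ≠ j → (A i ∩ A j).Finite) ∧ ¬ {i | (A i).Infinite}.Countable := by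
  rcases Function.Embedding.total I (ℕ → Bool) with ⟨⟨f⟩⟩ | ⟨⟨f⟩⟩
  · refine ⟨fun i => branch (f i), fun i j hij => finite_branch_inter (f.injective.ne hij), ?_⟩
    simp only [infinite_branch, Set.ofPred_true]
    exact Set.not_countable_univ
  · refine ⟨fun i => ⋃ b ∈ {b | f b = i}, branch b, fun i j hij => ?_, fun h => ?_⟩
    · by_cases hi : ∃ b, f b = i
      · by_cases hj : ∃ b, f b = j
        · obtain ⟨b, rfl⟩ := hi
          obtain ⟨b', rfl⟩ := hj
          have := finite_branch_inter (fun h => hij (congrArg f h) : b ≠ b')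
          simpa [f.injective.eq_iff] using this
        · have : {b | f b = j} = ∅ := Set.eq_empty_of_forall_notMem fun b hb => hj ⟨b, hb⟩
          simp [this]
      · have : {b | f b = i} = ∅ := Set.eq_empty_of_forall_notMem fun b hb => hi ⟨b, hb⟩
        simp [this]
    · have h1 := h.preimage f.injective
      have h2 : f ⁻¹' {i | (⋃ b ∈ {b | f b = i}, branch b).Infinite} = Set.univ :=
        Set.eq_univ_of_forall fun b => by
          simpa [f.injective.eq_iff] using infinite_branch b
      rw [h2, Set.countable_univ_iff] at h1
      have h3 : Cardinal.mk (ℕ → Bool) ≤ Cardinal.aleph0 := Cardinal.mk_le_aleph0_iff.2 h1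
      simp only [Cardinal.mk_pi, Cardinal.mk_bool, Cardinal.prod_const, Cardinal.mk_nat,
        Cardinal.lift_uzero] at h3
      exact absurd (Cardinal.cantor Cardinal.aleph0) (not_lt.2 h3)

variable {𝕜 : Type w} [RCLike 𝕜] {I : Type u} {p : ℝ≥0∞} [Fact (1 ≤ p)]

open Classical in
/-- `g = ∑ x i • 1_(A i)` modulo null sequences, in the sense of convergence of the finite partial
sums in `ℓ_∞ / c₀`. -/
def IsAlmostSum (A : I → Set ℕ) (x : lp (fun _ : I => 𝕜) p) (g : ℕ → 𝕜) : Prop :=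
  ∀ ε : ℝ, 0 < ε → ∀ᶠ S : Finset I in Filter.atTop, ∀ᶠ t in Filter.atTop,
    ‖g t - ∑ i ∈ S, if t ∈ A i then x i else 0‖ ≤ ε

variable {A : I → Set ℕ} {x y : lp (fun _ : I => 𝕜) p} {f g : ℕ → 𝕜}

theorem IsAlmostSum.add (hf : IsAlmostSum A x f) (hg : IsAlmostSum A y g) :
    IsAlmostSum A (x + y) (f + g) := fun ε hε => by
  classical
  filter_upwards [hf (ε / 2) (by positivity), hg (ε / 2) (by positivity)] with S h1 h2
  filter_upwards [h1, h2] with t h3 h4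
  have e : (f + g) t - ∑ i ∈ S, (if t ∈ A i then (x + y) i else 0) =
      (f t - ∑ i ∈ S, if t ∈ A i then x i else 0) +
        (g t - ∑ i ∈ S, if t ∈ A i then y i else 0) := by
    rw [sub_add_sub_comm, ← Finset.sum_add_distrib, Pi.add_apply]
    congr 1
    refine Finset.sum_congr rfl fun i _ => ?_
    split_ifs
    · rfl
    · rw [add_zero]
  rw [e]
  exact (norm_add_le _ _).trans (by linarith)

theorem IsAlmostSum.smul (c : 𝕜) (hf : IsAlmostSum A x f) : IsAlmostSum A (c • x) (c • f) :=
    fun ε hε => by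
  classical
  filter_upwards [hf (ε / (‖c‖ + 1)) (by positivity)] with S h1
  filter_upwards [h1] with t h2
  have e : (c • f) t - ∑ i ∈ S, (if t ∈ A i then (c • x) i else 0) =
      c * (f t - ∑ i ∈ S, if t ∈ A i then x i else 0) := by
    rw [mul_sub, Finset.mul_sum, Pi.smul_apply, smul_eq_mul]
    congr 1
    refine Finset.sum_congr rfl fun i _ => ?_
    split_ifs
    · rfl
    · rw [mul_zero]
  rw [e, norm_mul]
  calc _ ≤ (‖c‖ + 1) * (ε / (‖c‖ + 1)) := by gcongr; linarith
    _ = ε := by field_simp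

theorem isAlmostSum_zero_iff :
    IsAlmostSum A (0 : lp (fun _ : I => 𝕜) p) f ↔ Filter.Tendsto f Filter.atTop (𝓝 0) := by
  classical
  have key : ∀ (S : Finset I) t, (∑ i ∈ S, if t ∈ A i then (0 : lp (fun _ : I => 𝕜) p) i else 0)
      = 0 := fun S t => Finset.sum_eq_zero fun i _ => by split_ifs <;> rfl
  rw [tendsto_zero_iff_norm_tendsto_zero, Metric.tendsto_nhds]
  constructor
  · intro h ε hε
    obtain ⟨S, hS⟩ := (h (ε / 2) (by positivity)).exists
    filter_upwards [hS] with t ht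
    rw [key, sub_zero] at ht
    rw [dist_zero_right, norm_norm]
    linarith
  · intro h ε hε
    refine Filter.Eventually.of_forall fun S => ?_
    filter_upwards [h ε hε] with t ht
    rw [dist_zero_right, norm_norm] at ht
    rw [key, sub_zero]
    exact ht.le

theorem IsAlmostSum.sub (hf : IsAlmostSum A x f) (hg : IsAlmostSum A y g) :
    IsAlmostSum A (x - y) (f - g) := by
  have := hf.add (hg.smul (-1))
  rwa [neg_one_smul, neg_one_smul, ← sub_eq_add_neg, ← sub_eq_add_neg] at this

theorem finite_le_norm_apply (hp : 0 < p.toReal) (x : lp (fun _ : I => 𝕜) p) {ε : ℝ} (hε : 0 < ε) :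
    {i | ε ≤ ‖x i‖}.Finite := by
  have h := (lp.hasSum_norm hp x).summable.tendsto_cofinite_zero.eventually
    (gt_mem_nhds (Real.rpow_pos_of_pos hε p.toReal))
  refine (Filter.eventually_cofinite.1 h).subset fun i hi => not_lt.2 ?_
  exact Real.rpow_le_rpow hε.le hi hp.le

theorem exists_isMaxOn_norm_apply (hp : 0 < p.toReal) (x : lp (fun _ : I => 𝕜) p) {T : Set I}
    (hT : T.Nonempty) : ∃ i ∈ T, ∀ j ∈ T, ‖x j‖ ≤ ‖x i‖ := by
  obtain ⟨i, hi⟩ := hT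
  by_cases h : ∃ j ∈ T, x j ≠ 0
  · obtain ⟨j, hj, hxj⟩ := h
    have hfin : {k | k ∈ T ∧ ‖x j‖ ≤ ‖x k‖}.Finite :=
      (finite_le_norm_apply hp x (norm_pos_iff.2 hxj)).subset fun k hk => hk.2
    obtain ⟨m, hm, hmax⟩ := Set.exists_max_image _ (fun k => ‖x k‖) hfin ⟨j, hj, le_rfl⟩
    refine ⟨m, hm.1, fun k hk => ?_⟩
    rcases le_total ‖x j‖ ‖x k‖ with h' | h'
    · exact hmax k ⟨hk, h'⟩
    · exact h'.trans hm.2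
  · push Not at h
    exact ⟨i, hi, fun j hj => by rw [h j hj, norm_zero]; exact norm_nonneg _⟩

/-- At `t`, the largest coefficient of those `1_(A i)` which do not vanish at `t` is chosen. -/
theorem exists_isAlmostSum (hp : 0 < p.toReal) (hA : ∀ i j, i ≠ j → (A i ∩ A j).Finite)
    (x : lp (fun _ : I => 𝕜) p) :
    ∃ g : ℕ → 𝕜, (∀ t, ‖g t‖ ≤ ‖x‖) ∧ IsAlmostSum A x g := by
  classical
  have hp0 : p ≠ 0 := (zero_lt_one.trans_le Fact.out).ne'
  have h : ∀ t, ∃ z : 𝕜, ((∃ i, t ∈ A i ∧ z = x i) ∨ z = 0) ∧ ∀ i, t ∈ A i → ‖x i‖ ≤ ‖z‖ := by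
    intro t
    by_cases ht : {i | t ∈ A i}.Nonempty
    · obtain ⟨i, hi, hmax⟩ := exists_isMaxOn_norm_apply hp x ht
      exact ⟨x i, Or.inl ⟨i, hi, rfl⟩, hmax⟩
    · exact ⟨0, Or.inr rfl, fun i hi => absurd ⟨i, hi⟩ ht⟩
  choose g hg hmax using h
  refine ⟨g, fun t => ?_, fun ε hε => ?_⟩
  · rcases hg t with ⟨i, -, h⟩ | h
    · rw [h]; exact lp.norm_apply_le_norm hp0 x i
    · rw [h, norm_zero]; exact norm_nonneg x
  have hfin := finite_le_norm_apply hp x (half_pos hε)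
  filter_upwards [Filter.eventually_ge_atTop hfin.toFinset] with S hS
  have hsmall : ∀ i, i ∉ S → ‖x i‖ < ε / 2 := fun i hi =>
    not_le.1 fun h => hi (hS (hfin.mem_toFinset.2 h))
  -- beyond the finitely many pairwise intersections, at most one set of the finite family occurs
  have hev : ∀ᶠ t in Filter.atTop, ∀ i ∈ S, ∀ j ∈ S, i ≠ j → t ∉ A i ∩ A j := by
    rw [Filter.eventually_all_finset]
    intro i _
    rw [Filter.eventually_all_finset]
    intro j _
    rw [Filter.eventually_imp_distrib_left]
    intro hij
    rw [← Nat.cofinite_eq_atTop]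
    exact (hA i j hij).eventually_cofinite_notMem
  filter_upwards [hev] with t ht
  by_cases hex : ∃ i ∈ S, t ∈ A i
  · obtain ⟨i, hiS, hti⟩ := hex
    have hsum : (∑ j ∈ S, if t ∈ A j then x j else 0) = x i := by
      rw [Finset.sum_eq_single_of_mem i hiS, if_pos hti]
      exact fun j hj hji => if_neg fun htj => ht i hiS j hj hji.symm ⟨hti, htj⟩
    rw [hsum]
    have hxi := hmax t i hti
    rcases hg t with ⟨j, htj, h⟩ | h
    · by_cases hj : j ∈ S
      · by_cases hij : i = j
        · rw [h, hij, sub_self, norm_zero]; exact hε.le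
        · exact absurd ⟨hti, htj⟩ (ht i hiS j hj hij)
      · have := hsmall j hj
        rw [h] at hxi ⊢
        exact (norm_sub_le _ _).trans (by linarith)
    · rw [h, norm_zero] at hxi
      rw [h, zero_sub, norm_neg]
      linarith
  · push Not at hex
    rw [Finset.sum_eq_zero fun i hi => if_neg (hex i hi), sub_zero]
    rcases hg t with ⟨j, htj, h⟩ | h
    · rw [h]
      have := hsmall j fun hj => hex j hj htj
      linarith
    · rw [h, norm_zero]; exact hε.le

variable (𝕜) in
/-- The null sequences, as a subspace of all sequences. -/
def nullSequences : Submodule 𝕜 (ℕ → 𝕜) where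
  carrier := {f | Filter.Tendsto f Filter.atTop (𝓝 0)}
  add_mem' hf hg := by
    have := Filter.Tendsto.add hf hg
    rwa [add_zero] at this
  zero_mem' := tendsto_const_nhds
  smul_mem' c f hf := by
    have := Filter.Tendsto.const_smul hf c
    rwa [smul_zero] at this

variable (𝕜) in
/-- An algebraic projection onto the null sequences. -/
theorem exists_projection_nullSequences :
    ∃ P : (ℕ → 𝕜) →ₗ[𝕜] C₀(ℕ, 𝕜), ∀ f, Filter.Tendsto f Filter.atTop (𝓝 0) →
      ∀ t, P f t = f t := by
  obtain ⟨P, hP⟩ := LinearMap.exists_leftInverse_of_injective (nullSequences 𝕜).subtype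
    (nullSequences 𝕜).ker_subtype
  refine ⟨{ toFun := fun f => ZeroAtInftyContinuousMap.ofTendsto (P f) (P f).2
            map_add' := fun f g => ZeroAtInftyContinuousMap.ext fun t => ?_
            map_smul' := fun c f => ZeroAtInftyContinuousMap.ext fun t => ?_ }, fun f hf t => ?_⟩
  · change (P (f + g) : ℕ → 𝕜) t = _
    rw [map_add]; rfl
  · change (P (c • f) : ℕ → 𝕜) t = _
    rw [map_smul]; rfl
  · change (P f : ℕ → 𝕜) t = _
    rw [show P f = ⟨f, hf⟩ from LinearMap.congr_fun hP ⟨f, hf⟩]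

/-- No map `x ↦ ∑ x i • 1_(A i)` modulo null sequences lifts to a linear map bounded by the norm:
each coordinate of the lift would have countable support. -/
theorem not_exists_linear_isAlmostSum [DecidableEq I] (hp1 : 1 < p) (hp : p < ⊤)
    (hA : ¬ {i | (A i).Infinite}.Countable) (G : lp (fun _ : I => 𝕜) p →ₗ[𝕜] ℕ → 𝕜) {M : ℝ}
    (hM : ∀ x t, ‖G x t‖ ≤ M * ‖x‖) (hG : ∀ x, IsAlmostSum A x (G x)) : False := by
  have hc : (⋃ t, {i | G (lp.single p i 1) t ≠ 0}).Countable := Set.countable_iUnion fun t =>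
    countable_apply_single_ne_zero hp1 hp (LinearMap.proj t ∘ₗ G) fun x => hM x t
  obtain ⟨i, hi, hi'⟩ := Set.not_subset.1 fun h => hA (hc.mono h)
  have h0 : G (lp.single p i 1) = 0 := funext fun t => by
    by_contra h
    exact hi' (Set.mem_iUnion.2 ⟨t, h⟩)
  classical
  obtain ⟨S, hS, hiS⟩ := ((hG (lp.single p i 1) (1 / 2) (by norm_num)).and
    (Filter.eventually_ge_atTop {i})).exists
  rw [← Nat.cofinite_eq_atTop] at hS
  obtain ⟨t, hti, ht⟩ := ((Set.infinite_iff_frequently_cofinite.1 hi).and_eventually hS).exists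
  rw [Finset.sum_eq_single_of_mem i (Finset.singleton_subset_iff.1 hiS), if_pos hti, h0,
    lp.single_apply_self, Pi.zero_apply, zero_sub, norm_neg, norm_one] at ht
  · norm_num at ht
  · intro j _ hji
    rw [lp.single_apply_ne p i _ hji, ite_self]

theorem exists_not_isTrivialMap_lp_c₀ [Uncountable I] (hp1 : 1 < p) (hp : p < ⊤) :
    ∃ F : lp (fun _ : I => 𝕜) p → C₀(ℕ, 𝕜), IsQuasilinear 𝕜 F ∧ ¬ IsTrivialMap 𝕜 F := by
  classical
  have hp0 : 0 < p.toReal := ENNReal.toReal_pos (zero_lt_one.trans hp1).ne' hp.ne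
  obtain ⟨A, hA, hA'⟩ := exists_almostDisjoint I
  obtain ⟨g, hgh, hg⟩ := exists_homogeneous_selection (𝕜 := 𝕜)
    (P := fun (x : lp (fun _ : I => 𝕜) p) (g : ℕ → 𝕜) => (∀ t, ‖g t‖ ≤ ‖x‖) ∧ IsAlmostSum A x g)
    (fun c x g h => ⟨fun t => by
      rw [Pi.smul_apply, norm_smul, norm_smul]
      exact mul_le_mul_of_nonneg_left (h.1 t) (norm_nonneg c), h.2.smul c⟩)
    (exists_isAlmostSum hp0 hA)
  obtain ⟨P, hP⟩ := exists_projection_nullSequences 𝕜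
  have hdiff : ∀ x y, Filter.Tendsto (g (x + y) - g x - g y) Filter.atTop (𝓝 0) := fun x y => by
    have := ((hg (x + y)).2.sub (hg x).2).sub (hg y).2
    rwa [add_sub_cancel_left, sub_self, isAlmostSum_zero_iff] at this
  refine ⟨fun x => P (g x), ⟨fun c x => by
    change P (g (c • x)) = c • P (g x)
    rw [hgh, map_smul], 2, fun x y => ?_⟩, ?_⟩
  · rw [← map_sub, ← map_sub]
    refine ZeroAtInftyContinuousMap.norm_le (by positivity) fun t => ?_
    rw [hP _ (hdiff x y)]
    calc _ ≤ ‖g (x + y) t‖ + ‖g x t‖ + ‖g y t‖ :=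
          (norm_sub_le _ _).trans (add_le_add_left (norm_sub_le _ _) _)
      _ ≤ (‖x‖ + ‖y‖) + ‖x‖ + ‖y‖ := add_le_add (add_le_add
          (((hg _).1 t).trans (norm_add_le x y)) ((hg x).1 t)) ((hg y).1 t)
      _ = _ := by push_cast; ring
  · rintro ⟨B, L, hB, ⟨M, hM⟩, hFB⟩
    have hB0 : ∀ x, Filter.Tendsto (B x) Filter.atTop (𝓝 0) := fun x => (B x).tendsto_atTop
    have hPB : ∀ x, P (B x) = B x := fun x => ZeroAtInftyContinuousMap.ext (hP _ (hB0 x))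
    -- `g - B` is linear, because it is so both after `P` and modulo null sequences
    have hPG : ∀ x, P (g x - B x) = L x := fun x => by
      rw [map_sub, hPB, show P (g x) = B x + L x from hFB x, add_sub_cancel_left]
    have hinj : ∀ f : ℕ → 𝕜, Filter.Tendsto f Filter.atTop (𝓝 0) → P f = 0 → f = 0 :=
      fun f hf h => funext fun t => by rw [← hP f hf, h]; rfl
    let G : lp (fun _ : I => 𝕜) p →ₗ[𝕜] ℕ → 𝕜 :=
      { toFun := fun x => g x - B x
        map_add' := fun x y => by
          rw [← sub_eq_zero]
          refine hinj _ ?_ (by rw [map_sub, map_add, hPG, hPG, hPG, map_add, sub_self])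
          have := (((hdiff x y).sub (hB0 (x + y))).add (hB0 x)).add (hB0 y)
          rw [sub_zero, add_zero, add_zero] at this
          refine this.congr fun t => ?_
          simp only [Pi.sub_apply, Pi.add_apply]
          ring
        map_smul' := fun c x => by
          rw [hgh, hB]
          exact (smul_sub c (g x) (B x)).symm }
    refine not_exists_linear_isAlmostSum hp1 hp hA' G (M := 1 + M) (fun x t => ?_) fun x => ?_
    · rw [add_mul, one_mul]
      exact (norm_sub_le _ _).trans (add_le_add ((hg x).1 t)
        ((ZeroAtInftyContinuousMap.norm_apply_le _ t).trans (hM x)))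
    · have := (hg x).2.sub (isAlmostSum_zero_iff (p := p) (A := A).2 (hB0 x))
      rwa [sub_zero] at this

end AlmostDisjoint

/-! ### The theorem -/

theorem mainTheorem3 (𝕜 : Type w) [RCLike 𝕜] :
    (∀ (X : Type u) (Y : Type v)
        [AddCommGroup X] [Module 𝕜 X] [Norm X] [QuasiBanachSpace 𝕜 X]
        [AddCommGroup Y] [Module 𝕜 Y] [Norm Y] [QuasiBanachSpace 𝕜 Y],
        T2Space (QBExt 𝕜 X Y) ↔ K₀ 𝕜 X Y < ⊤) ∧
    (∀ (I : Type u) [Uncountable I] (p : ℝ≥0∞) [Fact (1 ≤ p)], 1 < p → p < ⊤ →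
        T2Space (QBExt 𝕜 (lp (fun _ : I => 𝕜) p) C₀(ℕ, 𝕜)) ∧
          ∃ e : QBExt 𝕜 (lp (fun _ : I => 𝕜) p) C₀(ℕ, 𝕜), e ≠ 0) := by
  classical
  refine ⟨fun X Y => QBExt.t2Space_iff_K₀_lt_top, fun I _ p _ hp1 hp =>
    ⟨QBExt.t2Space_iff_K₀_lt_top.2 (K₀_lp_c₀_lt_top hp1 hp), ?_⟩⟩
  obtain ⟨F, hF, hF'⟩ := exists_not_isTrivialMap_lp_c₀ (𝕜 := 𝕜) (I := I) hp1 hp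
  exact ⟨QBExt.ofMap F hF, fun h => hF' ((QBExt.ofMap_eq_zero_iff hF).1 h)⟩
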